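/- Let $d\ge 2$ and let $\mathbb P$ be an i.i.d. product measure on environments $\omega=(\omega_x)_{x\in\mathbb Z^d}$, where each $\omega_x=(\omega_{x,z})_{z\in\mathbb Z^d}$ is a probability vector. Under $P_z^\omega$ the walk $X$ is the Markov chain on $\mathbb Z^d$ that starts at $z$ and jumps from $x$ to $y$ with probability $\omega_{x,y-x}$; put $P_z=\int P^\omega_z\,\mathbb P(d\omega)$ and $P_{x,y}=\int P_x^\omega\otimes P_y^\omega\,\mathbb P(d\omega)$ (two walks $X,\widetilde X$ in a common environment). Fix $\hat u\in\mathbb Z^d$ and assume: * (transience) $P_0\{X_n\cdot\hat u\to\infty\}=1$; * (moment) $E_0[\tau_1^{p_0}]<\infty$ for a real $p_0>176d$, where $\tau_1$ is the first $n\ge 1$ with $\sup_{m<n}X_m\cdot\hat u<X_n\cdot\hat u=\inf_{m\ge n}X_m\cdot\hat u$; * (bounded steps) there is a constant $M\in(0,\infty)$ with $\mathbb P\{\omega_{0,z}=0\}=1$ whenever $|z|>M$ (Euclidean norm). For a pair of paths $(X,\widetilde X)$ that start on a common level $\lambda_0=X_0\cdot\hat u=\widetilde X_0\cdot\hat u$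 define the joint regeneration times as follows. Let $\beta=\inf\{n:X_n\cdot\hat u<X_0\cdot\hat u\}$, $\gamma_\ell=\inf\{n: X_n\cdot\hat u\ge \ell\}$, $M_n=\max_{i\le n}X_i\cdot\hat u$, let $\tilde\beta,\tilde\gamma_\ell,\widetilde M_n$ be the same quantities for $\widetilde X$, and let $h$ be the greatest common divisor of $\{\ell\ge 0:P_0(\exists n: X_n\cdot\hat u=\ell)>0\}$. A level $\ell\in\mathbb Z$ is *common fresh* if $\gamma_\ell,\tilde\gamma_\ell<\infty$ and $X_{\gamma_\ell}\cdot\hat u=\widetilde X_{\tilde\gamma_\ell}\cdot\hat u=\ell$. If $\beta\wedge\tilde\beta=\infty$ let $\lambda=\infty$; otherwise let $\lambda$ be the first common fresh level $\ge M_{\beta\wedge\tilde\beta}\vee\widetilde M_{\beta\wedge\tilde\beta}+h$ ($\infty$ if there is none). Let $\lambda_1$ be the first common fresh level $\ge\lambda_0+h$ and, as long as $\lambda_n<\infty$, let $\lambda_{n+1}$ be the level $\lambda$ of the pair of shifted paths $(X_{\gamma_{\lambda_n}+k})_{k\ge0}$, $(\widetilde X_{\tilde\gamma_{\lambda_n}+k})_{k\ge0}$.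 Put $\Lambda=\sup\{\lambda_n: n\ge 1,\ \lambda_n<\infty\}$ and $(\mu_1,\tilde\mu_1)=(\gamma_\Lambda,\tilde\gamma_\Lambda)$. On the hyperplane $\mathbb V_d=\{z\in\mathbb Z^d: z\cdot\hat u=0\}$ define $$q(x,y)=P_{0,x}\{\widetilde X_{\tilde\mu_1}-X_{\mu_1}=y\mid \beta=\tilde\beta=\infty\},$$ and let $\bar q(x,y)$ be given by the same formula with $P_{0,x}$ replaced by $P_0\otimes P_x$, that is, for two walks in independent environments. **Proposition.** The transitions $q$ and $\bar q$ can be coupled: there are a constant $C\in(0,\infty)$ and a Markov kernel on $\mathbb V_d\times\mathbb V_d$ which from any state $(x,x')$ moves to a pair $(Y_1,\bar Y_1)$ such that $Y_1$ has distribution $q(x,\cdot)$ and $\bar Y_1$ has distribution $\bar q(x',\cdot)$, and such that, when both coordinates start from a common state $x\ne 0$, $$P_{x,x}\{Y_1\ne\bar Y_1\}\le C|x|^{-p_0/6}\qquad\text{for all }x\in\mathbb V_d\setminus\{0\}.$$ The constant $C$ does not depend on $x$. -/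

import Mathlib

open MeasureTheory ProbabilityTheory
open scoped ENNReal

namespace RWRE

/-! ## Lattice, environments, quenched and averaged walks -/

/-- The lattice `ℤ^d`. -/
abbrev Site (d : ℕ) : Type := Fin d → ℤ

/-- Euclidean norm of a lattice point. -/
noncomputable def eucNorm {d : ℕ} (x : Site d) : ℝ := Real.sqrt (∑ i, (x i : ℝ) ^ 2)

/-- The level `x · u` of a lattice point with respect to the integer vector `u`. -/
def level {d : ℕ} (u x : Site d) : ℤ := x ⬝ᵥ u

/-- The hyperplane `{z ∈ ℤ^d : z · u = 0}`. -/
abbrev Hyper {d : ℕ} (u : Site d) : Type := {z : Site d // level u z = 0}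

/-- Probability vectors on `ℤ^d`, with the σ-algebra generated by the coordinates. -/
abbrev ProbVec (d : ℕ) : Type := {p : Site d → ℝ≥0∞ // ∑' z, p z = 1}

/-- Environments: `ω x z` is the probability of the jump `z` out of the site `x`; the σ-algebra
is the product one. -/
abbrev Env (d : ℕ) : Type := Site d → ProbVec d

/-- The product measure on environments under which the vectors `ω x` are i.i.d. with law `ν`. -/
noncomputable def envLaw {d : ℕ} (ν : Measure (ProbVec d)) : Measure (Env d) :=
  Measure.infinitePi fun _ : Site d => ν

/-- Paths `x_0, x_1, x_2, …` in `ℤ^d`. -/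
abbrev Path (d : ℕ) : Type := ℕ → Site d

/-- The law of the next position of the walk in environment `ω` that is now at `x`: it gives
mass `ω x z` to `x + z`. -/
noncomputable def stepLaw {d : ℕ} (ω : Env d) (x : Site d) : Measure (Site d) :=
  Measure.sum fun z => (ω x).1 z • Measure.dirac (x + z)

theorem stepLaw_univ {d : ℕ} (ω : Env d) (x : Site d) : stepLaw ω x Set.univ = 1 := by
  simp [stepLaw, Measure.sum_apply, (ω x).2]

/-- The Markov step as a kernel that reads the last position of the path up to time `n`. -/
noncomputable def stepKernel {d : ℕ} (ω : Env d) (n : ℕ) :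
    Kernel (Finset.Iic n → Site d) (Site d) :=
  Kernel.ofFunOfCountable fun h => stepLaw ω (h ⟨n, Finset.mem_Iic.2 le_rfl⟩)

instance {d : ℕ} (ω : Env d) (n : ℕ) : IsMarkovKernel (stepKernel ω n) :=
  ⟨fun _ => ⟨stepLaw_univ ω _⟩⟩

/-- The quenched path measure `P_z^ω`: the law of the Markov chain that starts at `z` and moves
from `x` to `y` with probability `ω x (y - x)`. -/
noncomputable def quenchedMeasure {d : ℕ} (z : Site d) (ω : Env d) : Measure (Path d) :=
  Kernel.traj (X := fun _ => Site d) (stepKernel ω) 0 fun _ => z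

instance {d : ℕ} (z : Site d) (ω : Env d) : IsProbabilityMeasure (quenchedMeasure z ω) := by
  unfold quenchedMeasure; infer_instance

theorem measurable_stepLaw_apply {d : ℕ} (x : Site d) (T : Set (Site d)) :
    Measurable fun ω : Env d => stepLaw ω x T := by
  have h : (fun ω : Env d => stepLaw ω x T)
      = fun ω : Env d => ∑' z, (ω x).1 z * Measure.dirac (x + z) T := by
    funext ω
    simp [stepLaw, Measure.sum_apply _ (MeasurableSet.of_discrete (s := T))]
  rw [h]
  refine Measurable.tsum fun z => Measurable.mul_const ?_ _
  exact (measurable_pi_apply z).comp (measurable_subtype_coe.comp (measurable_pi_apply x))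

theorem measurable_partialTraj_apply {d : ℕ} (z : Site d) (n : ℕ)
    (S : Set (Finset.Iic n → Site d)) :
    Measurable fun ω : Env d =>
      Kernel.partialTraj (X := fun _ => Site d) (stepKernel ω) 0 n (fun _ => z) S := by
  induction n with
  | zero => simp
  | succ n ih =>
    have h : ∀ ω : Env d,
        Kernel.partialTraj (X := fun _ => Site d) (stepKernel ω) 0 (n + 1) (fun _ => z) S
        = ∑' y, Kernel.partialTraj (X := fun _ => Site d) (stepKernel ω) n (n + 1) y S
            * Kernel.partialTraj (X := fun _ => Site d) (stepKernel ω) 0 n (fun _ => z) {y} := by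
      intro ω
      rw [Kernel.partialTraj_succ_eq_comp (Nat.zero_le n),
        Kernel.comp_apply' _ _ _ (MeasurableSet.of_discrete (s := S)), lintegral_countable']
    simp_rw [h]
    refine Measurable.tsum fun y => Measurable.mul ?_ (ih {y})
    have h2 : ∀ ω : Env d,
        Kernel.partialTraj (X := fun _ => Site d) (stepKernel ω) n (n + 1) y S
        = stepLaw ω (y ⟨n, Finset.mem_Iic.2 le_rfl⟩)
            ((fun w => IicProdIoc (X := fun _ => Site d) n (n + 1)
              (y, MeasurableEquiv.piSingleton (X := fun _ => Site d) n w)) ⁻¹' S) := by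
      intro ω
      rw [Kernel.partialTraj_succ_self,
        Kernel.map_apply _ (measurable_IicProdIoc (X := fun _ => Site d) (m := n) (n := n + 1)),
        Measure.map_apply (measurable_IicProdIoc (X := fun _ => Site d) (m := n) (n := n + 1))
          (MeasurableSet.of_discrete (s := S)),
        Kernel.prod_apply, Kernel.id_apply,
        Kernel.map_apply _ (MeasurableEquiv.piSingleton (X := fun _ => Site d) n).measurable,
        Measure.dirac_prod,
        Measure.map_apply (by fun_prop) (MeasurableSet.of_discrete),
        Measure.map_apply (MeasurableEquiv.measurable _) (MeasurableSet.of_discrete)]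
      rfl
    simp_rw [h2]
    exact measurable_stepLaw_apply _ _

theorem measurable_quenchedMeasure {d : ℕ} (z : Site d) :
    Measurable (quenchedMeasure (d := d) z) := by
  refine Measurable.measure_of_isPiSystem_of_isProbabilityMeasure
    (generateFrom_measurableCylinders (α := fun _ : ℕ => Site d)).symm
    isPiSystem_measurableCylinders ?_
  intro A hA
  simp only [measurableCylinders_nat, Set.mem_iUnion, Set.mem_singleton_iff, exists_prop] at hA
  obtain ⟨n, S, hS, rfl⟩ := hA
  have h : ∀ ω : Env d, quenchedMeasure z ω (cylinder (Finset.Iic n) S)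
      = Kernel.partialTraj (X := fun _ => Site d) (stepKernel ω) 0 n (fun _ => z) S := by
    intro ω
    rw [← Kernel.traj_map_frestrictLe_apply,
      Measure.map_apply (Preorder.measurable_frestrictLe n) hS]
    rfl
  simp_rw [h]
  exact measurable_partialTraj_apply z n S

/-- The quenched path measures as a kernel from environments to paths. -/
noncomputable def quenched {d : ℕ} (z : Site d) : Kernel (Env d) (Path d) :=
  ⟨quenchedMeasure z, measurable_quenchedMeasure z⟩

instance {d : ℕ} (z : Site d) : IsMarkovKernel (quenched z) :=
  ⟨fun ω => inferInstanceAs (IsProbabilityMeasure (quenchedMeasure z ω))⟩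

/-- The averaged law `P_z` of one walk. -/
noncomputable def avg {d : ℕ} (ν : Measure (ProbVec d)) (z : Site d) : Measure (Path d) :=
  (envLaw ν).bind (quenched z)

/-- The averaged law `P_{x,y}` of two walks that are independent given their common
environment: the `ω`-average of `P_x^ω ⊗ P_y^ω`. -/
noncomputable def avgPair {d : ℕ} (ν : Measure (ProbVec d)) (x y : Site d) :
    Measure (Path d × Path d) :=
  (envLaw ν).bind (quenched x ×ₖ quenched y)

/-! ## Backtracking, regeneration and joint regeneration -/

/-- The left shift by `k` on paths. -/
def shift {d : ℕ} (k : ℕ) (x : Path d) : Path d := fun n => x (k + n)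

/-- The first backtracking time `β = inf {n : x_n · u < x_0 · u}`. -/
noncomputable def backtrackTime {d : ℕ} (u : Site d) (x : Path d) : ℕ∞ :=
  ⨅ (n : ℕ) (_ : level u (x n) < level u (x 0)), (n : ℕ∞)

/-- The first regeneration time `τ_1`: the first time `n ≥ 1` such that
`sup_{m < n} x_m · u < x_n · u = inf_{m ≥ n} x_m · u`. -/
noncomputable def regenTime {d : ℕ} (u : Site d) (x : Path d) : ℕ∞ :=
  ⨅ (n : ℕ) (_ : 1 ≤ n ∧ (∀ m < n, level u (x m) < level u (x n)) ∧
    ∀ m, n ≤ m → level u (x n) ≤ level u (x m)), (n : ℕ∞)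

/-- The hitting time `γ_ℓ = inf {n : x_n · u ≥ ℓ}`. -/
noncomputable def hitTime {d : ℕ} (u : Site d) (ℓ : ℤ) (x : Path d) : ℕ∞ :=
  ⨅ (n : ℕ) (_ : ℓ ≤ level u (x n)), (n : ℕ∞)

/-- The running maximum `M_n = max {x_i · u : i ≤ n}`. -/
def runMax {d : ℕ} (u : Site d) (x : Path d) (n : ℕ) : ℤ :=
  (Finset.range (n + 1)).sup' ⟨0, by simp⟩ fun i => level u (x i)

/-- Level `ℓ` is a common fresh level: `x_{γ_ℓ} · u = y_{γ_ℓ} · u = ℓ`, where each path has its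
own finite hitting time `γ_ℓ`. -/
def CommonFresh {d : ℕ} (u : Site d) (x y : Path d) (ℓ : ℤ) : Prop :=
  ∃ m n : ℕ, hitTime u ℓ x = m ∧ hitTime u ℓ y = n ∧ level u (x m) = ℓ ∧ level u (y n) = ℓ

open Classical in
/-- The first common fresh level that is at least `a`, and `⊤` if there is none. -/
noncomputable def firstCommonFresh {d : ℕ} (u : Site d) (a : ℤ) (x y : Path d) : WithTop ℤ :=
  if ∃ ℓ, a ≤ ℓ ∧ CommonFresh u x y ℓ then
    ((sInf {ℓ : ℤ | a ≤ ℓ ∧ CommonFresh u x y ℓ} : ℤ) : WithTop ℤ)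
  else ⊤

/-- The level `λ` for a pair of paths that start on a common level: `⊤` if neither path
backtracks; otherwise, with `b` the smaller of the two backtracking times, the first common fresh
level that is at least `J = max (M_b of x) (M_b of y) + h`. -/
noncomputable def nextLevel {d : ℕ} (h : ℤ) (u : Site d) (x y : Path d) : WithTop ℤ :=
  match min (backtrackTime u x) (backtrackTime u y) with
  | ⊤ => ⊤
  | (b : ℕ) => firstCommonFresh u (max (runMax u x b) (runMax u y b) + h) x y

/-- The successive common fresh levels, `freshLevel h u x y n` being `λ_{n+1}`: here `λ_1` is the
first common fresh level that is at least the initial level plus `h`, and as long as `λ_n < ⊤`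
the level `λ_{n+1}` is `nextLevel` of the two paths restarted at their hitting times of `λ_n`. -/
noncomputable def freshLevel {d : ℕ} (h : ℤ) (u : Site d) (x y : Path d) : ℕ → WithTop ℤ
  | 0 => firstCommonFresh u (level u (x 0) + h) x y
  | n + 1 =>
    match freshLevel h u x y n with
    | ⊤ => ⊤
    | (ℓ : ℤ) =>
      nextLevel h u (shift (hitTime u ℓ x).toNat x) (shift (hitTime u ℓ y).toNat y)

open Classical in
/-- The first joint regeneration level `Λ = sup {λ_n : λ_n < ⊤}`, with the value `⊤` if that set
is empty or unbounded. -/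
noncomputable def jointLevel {d : ℕ} (h : ℤ) (u : Site d) (x y : Path d) : WithTop ℤ :=
  if {ℓ : ℤ | ∃ n, freshLevel h u x y n = ℓ}.Nonempty ∧
      BddAbove {ℓ : ℤ | ∃ n, freshLevel h u x y n = ℓ} then
    ((sSup {ℓ : ℤ | ∃ n, freshLevel h u x y n = ℓ} : ℤ) : WithTop ℤ)
  else ⊤

/-- The event that neither path of a pair backtracks. -/
def noBacktrack {d : ℕ} (u : Site d) : Set (Path d × Path d) :=
  {w | backtrackTime u w.1 = ⊤ ∧ backtrackTime u w.2 = ⊤}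

/-- The event that the first joint regeneration level `Λ` is finite and reached by both paths,
and that the second path minus the first, each at its joint regeneration time `γ_Λ`, is `y`. -/
def jointDiffEq {d : ℕ} (h : ℤ) (u y : Site d) : Set (Path d × Path d) :=
  {w | ∃ (ℓ : ℤ) (m n : ℕ), jointLevel h u w.1 w.2 = ℓ ∧
    hitTime u ℓ w.1 = m ∧ hitTime u ℓ w.2 = n ∧ w.2 n - w.1 m = y}

/-! ## The two transition probabilities -/

/-- The set of levels `ℓ ≥ 0` that the walk from the origin visits with positive probability. -/
def accessibleLevels {d : ℕ} (ν : Measure (ProbVec d)) (u : Site d) : Set ℕ :=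
  {ℓ | 0 < avg ν 0 {X | ∃ n, level u (X n) = (ℓ : ℤ)}}

/-- The greatest common divisor `h` of the accessible levels. -/
noncomputable def levelGcd {d : ℕ} (ν : Measure (ProbVec d)) (u : Site d) : ℕ :=
  sSup {g : ℕ | ∀ ℓ ∈ accessibleLevels ν u, g ∣ ℓ}

/-- `q(x,y)`: two walks in a common environment, started at `0` and `x`, conditioned on never
backtracking; the probability that their difference at the first joint regeneration is `y`. -/
noncomputable def q {d : ℕ} (ν : Measure (ProbVec d)) (u x y : Site d) : ℝ≥0∞ :=
  cond (avgPair ν 0 x) (noBacktrack u) (jointDiffEq (levelGcd ν u) u y)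

/-- `q̄(x,y)`: the same for two walks in independent environments, that is, under `P_0 ⊗ P_x`. -/
noncomputable def qbar {d : ℕ} (ν : Measure (ProbVec d)) (u x y : Site d) : ℝ≥0∞ :=
  cond ((avg ν 0).prod (avg ν x)) (noBacktrack u) (jointDiffEq (levelGcd ν u) u y)

end RWRE

namespace RWRE

/-! ## Cylinder probabilities -/

/-! Two walks feel that they share an environment only at a site that both of them leave: the
averaged probability of a pair of finite paths is an integral of a product of `ω`-factors attached
to the sites left, and it factors when the two sets of sites are disjoint. Steps are bounded by some
`R`, so walks started at `0` and `x` with `2 * R * N < |x j|` for a coordinate `j` cannot leave a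
common site before time `N`. Hence `avgPair ν 0 x` and the product law agree on every event
determined by the first `N` steps (`avgPair_eq_prod_of_far`).

The displacement at the first joint regeneration is not such an event, but it nearly is. If the
joint regeneration happens by time `N`, freezing both paths at time `N` does not change the
displacement. The error is therefore controlled by two probabilities: that there is no joint
regeneration by time `N` without backtracking, and that a walk first backtracks after time `N`.
Dividing by the probability of no backtracking is harmless because that probability is bounded below
uniformly in the starting points (`Ballistic.exists_le_avgPair_noBacktrack`). For distant points
this follows by comparison with independent walks; for each of the finitely many remaining
differences positivity is shown by merging the walks at their first meeting.

The quantitative input is the tail estimate `FreshLaw.jointRegenBy_tail`, with one parameter `s`.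
Three things can go wrong. First, one of the walks has a regeneration interval longer than `s` at
one of the relevant levels; by renewal each level costs at most the tail of the first regeneration
time, of order `s ^ (-p)`. Second, a stretch of `s * (Q + 1)` levels contains no common fresh level;
both walks can be steered to a common fresh level with probability at least `c` in every block, so
this costs `(1 - c) ^ s`. Third, `s` attempts at a joint regeneration fail, which costs `(1 - ρ) ^
s`. Outside these events a deterministic argument (`exists_jointRegen`) gives a joint regeneration
within order `s ^ 2` levels, hence by time `N` of order `s ^ 3`. The total error is of order `s ^ 2
* s ^ (-p)` plus exponentially small terms, so at most a constant times `s ^ (-p / 2)` as soon as `4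
≤ p`. Taking `s` of order `|x| ^ (1 / 3)`, so that `N` stays below the separation of the walks,
yields the exponent `-p / 6`.

The laws in a common and in independent environments are treated together through the structure
`FreshLaw`, which records their marginals and the renewal property on entering an unexplored half
space. The kernel is the maximal coupling of the two difference laws, chosen for every pair of
states; its failure probability on the diagonal is the one-sided bound on the difference of the two
laws. -/

/-- The paths that agree with `a` up to time `m`. -/
def cyl {d : ℕ} (m : ℕ) (a : Path d) : Set (Path d) := {x | ∀ i ≤ m, x i = a i}

/-- The probability, in the environment `ω`, of the first `m` steps of the path `a`. -/
noncomputable def weight {d : ℕ} (ω : Env d) (m : ℕ) (a : Path d) : ℝ≥0∞ :=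
  ∏ i ∈ Finset.range m, (ω (a i)).1 (a (i + 1) - a i)

theorem cyl_eq_preimage {d : ℕ} (m : ℕ) (a : Path d) :
    cyl m a = (Preorder.frestrictLe (π := fun _ : ℕ => Site d) m) ⁻¹'
      {Preorder.frestrictLe m a} := by
  ext x
  simp only [cyl, Set.mem_ofPred_eq, Set.mem_preimage, Set.mem_singleton_iff, funext_iff,
    Preorder.frestrictLe_apply, Subtype.forall, Finset.mem_Iic]

theorem measurableSet_cyl {d : ℕ} (m : ℕ) (a : Path d) : MeasurableSet (cyl m a) := by
  rw [cyl_eq_preimage]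
  exact Preorder.measurable_frestrictLe m (MeasurableSet.singleton _)

theorem stepLaw_singleton {d : ℕ} (ω : Env d) (x y : Site d) :
    stepLaw ω x {y} = (ω x).1 (y - x) := by
  rw [stepLaw, Measure.sum_apply _ (MeasurableSet.singleton y), tsum_eq_single (y - x)]
  · simp
  · intro z hz
    have : x + z ≠ y := fun h => hz (by rw [← h]; abel)
    simp [this]

theorem quenchedMeasure_cyl_eq {d : ℕ} (z : Site d) (ω : Env d) (m : ℕ) (a : Path d) :
    quenchedMeasure z ω (cyl m a) = Kernel.partialTraj (X := fun _ => Site d) (stepKernel ω) 0 m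
      (fun _ => z) {Preorder.frestrictLe m a} := by
  rw [cyl_eq_preimage, ← Kernel.traj_map_frestrictLe_apply,
    Measure.map_apply (Preorder.measurable_frestrictLe m) (MeasurableSet.singleton _)]
  rfl

-- Induction on the time: in the composition over the countable set of histories only the history of
-- `a` itself contributes, and the last step adds one factor to `weight`.
open Classical in
theorem partialTraj_singleton {d : ℕ} (z : Site d) (ω : Env d) (m : ℕ) (a : Path d) :
    Kernel.partialTraj (X := fun _ => Site d) (stepKernel ω) 0 m (fun _ => z)
      {Preorder.frestrictLe m a} = if a 0 = z then weight ω m a else 0 := by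
  induction m with
  | zero =>
    rw [Kernel.partialTraj_self, Kernel.id_apply, Measure.dirac_apply' _ (MeasurableSet.singleton _)]
    by_cases h : a 0 = z
    · have : (fun _ : Finset.Iic 0 => z) = Preorder.frestrictLe (π := fun _ : ℕ => Site d) 0 a := by
        funext ⟨i, hi⟩
        have : i = 0 := by simpa using hi
        subst this; simp [h]
      simp [h, weight, this]
    · have : (fun _ : Finset.Iic 0 => z) ≠ Preorder.frestrictLe (π := fun _ : ℕ => Site d) 0 a := by
        intro h'
        exact h (congrFun h' ⟨0, by simp⟩).symm
      simp [h, this]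
  | succ n ih =>
    rw [Kernel.partialTraj_succ_eq_comp (Nat.zero_le n),
        Kernel.comp_apply' _ _ _ (MeasurableSet.singleton _), lintegral_countable',
        tsum_eq_single (Preorder.frestrictLe n a)]
    · rw [ih, Kernel.partialTraj_succ_self,
        Kernel.map_apply _ (measurable_IicProdIoc (X := fun _ => Site d) (m := n) (n := n + 1)),
        Measure.map_apply (measurable_IicProdIoc (X := fun _ => Site d) (m := n) (n := n + 1))
          (MeasurableSet.singleton _),
        Kernel.prod_apply, Kernel.id_apply,
        Kernel.map_apply _ (MeasurableEquiv.piSingleton (X := fun _ => Site d) n).measurable,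
        Measure.dirac_prod,
        Measure.map_apply (by fun_prop) (MeasurableSet.of_discrete),
        Measure.map_apply (MeasurableEquiv.measurable _) (MeasurableSet.of_discrete)]
      have hS : ((MeasurableEquiv.piSingleton (X := fun _ => Site d) n) ⁻¹'
          ((Prod.mk (Preorder.frestrictLe (π := fun _ : ℕ => Site d) n a)) ⁻¹'
            ((IicProdIoc (X := fun _ => Site d) n (n + 1)) ⁻¹'
              {Preorder.frestrictLe (n + 1) a}))) = {a (n + 1)} := by
        ext w
        simp only [Set.mem_preimage, Set.mem_singleton_iff, funext_iff, Subtype.forall,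
          Finset.mem_Iic, Preorder.frestrictLe_apply]
        constructor
        · intro h
          have := h (n + 1) le_rfl
          simpa [IicProdIoc, MeasurableEquiv.piSingleton] using this
        · intro h i hi
          have h : w = a (n + 1) := funext h
          subst h
          refine congrFun ?_
          by_cases hin : i ≤ n
          · simp [IicProdIoc, hin]
          · have : i = n + 1 := by omega
            subst this
            simp [IicProdIoc, MeasurableEquiv.piSingleton]
      rw [hS]
      change stepLaw ω (a n) {a (n + 1)} * _ = _
      rw [stepLaw_singleton]
      by_cases h : a 0 = z
      · simp only [h, if_true, weight]
        rw [Finset.prod_range_succ, mul_comm]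
      · simp [h]
    · intro y hy
      have : Kernel.partialTraj (X := fun _ => Site d) (stepKernel ω) n (n + 1) y
          {Preorder.frestrictLe (n + 1) a} = 0 := by
        rw [Kernel.partialTraj_succ_self,
          Kernel.map_apply _ (measurable_IicProdIoc (X := fun _ => Site d) (m := n) (n := n + 1)),
          Measure.map_apply (measurable_IicProdIoc (X := fun _ => Site d) (m := n) (n := n + 1))
            (MeasurableSet.singleton _),
          Kernel.prod_apply, Kernel.id_apply,
          Measure.dirac_prod,
          Measure.map_apply (by fun_prop) (MeasurableSet.of_discrete)]
        convert measure_empty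
        · ext w
          simp only [Set.mem_preimage, Set.mem_singleton_iff, Set.mem_empty_iff_false, iff_false]
          intro h
          apply hy
          funext ⟨i, hi⟩
          have hi' : i ≤ n := by simpa using hi
          have := congrFun h ⟨i, by simp; omega⟩
          simpa [IicProdIoc, hi'] using this
        · infer_instance
      simp [this]

open Classical in
theorem quenched_cyl {d : ℕ} (z : Site d) (ω : Env d) (m : ℕ) (a : Path d) :
    quenched z ω (cyl m a) = if a 0 = z then weight ω m a else 0 := by
  rw [← partialTraj_singleton, ← quenchedMeasure_cyl_eq]; rfl

theorem quenched_cyl_self {d : ℕ} (ω : Env d) (m : ℕ) (a : Path d) :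
    quenched (a 0) ω (cyl m a) = weight ω m a := by
  classical rw [quenched_cyl, if_pos rfl]

theorem weight_le_one {d : ℕ} (ω : Env d) (m : ℕ) (a : Path d) : weight ω m a ≤ 1 := by
  rw [← quenched_cyl_self]; exact prob_le_one

theorem measurable_env_apply {d : ℕ} (x z : Site d) : Measurable fun ω : Env d => (ω x).1 z :=
  (measurable_pi_apply z).comp (measurable_subtype_coe.comp (measurable_pi_apply x))

theorem measurable_weight {d : ℕ} (m : ℕ) (a : Path d) :
    Measurable fun ω : Env d => weight ω m a :=
  Finset.measurable_prod _ fun _ _ => measurable_env_apply _ _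

theorem weight_add {d : ℕ} (ω : Env d) (m k : ℕ) (a : Path d) :
    weight ω (m + k) a = weight ω m a * weight ω k (shift m a) := by
  simp only [weight, shift, Finset.prod_range_add]
  rfl

theorem weight_congr {d : ℕ} (ω : Env d) {m : ℕ} {a b : Path d} (h : ∀ i ≤ m, a i = b i) :
    weight ω m a = weight ω m b := by
  refine Finset.prod_congr rfl fun i hi => ?_
  have := Finset.mem_range.1 hi
  rw [h i (by omega), h (i + 1) (by omega)]

theorem cyl_congr {d : ℕ} {m : ℕ} {a b : Path d} (h : ∀ i ≤ m, a i = b i) : cyl m a = cyl m b := by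
  ext x
  exact forall₂_congr fun i hi => by rw [h i hi]

instance {d : ℕ} (ν : Measure (ProbVec d)) [IsProbabilityMeasure ν] :
    IsProbabilityMeasure (envLaw ν) := by
  unfold envLaw; infer_instance

instance {d : ℕ} (ν : Measure (ProbVec d)) [IsProbabilityMeasure ν] (z : Site d) :
    IsProbabilityMeasure (avg ν z) := by
  unfold avg; infer_instance

instance {d : ℕ} (ν : Measure (ProbVec d)) [IsProbabilityMeasure ν] (x y : Site d) :
    IsProbabilityMeasure (avgPair ν x y) := by
  unfold avgPair; infer_instance

theorem avg_apply {d : ℕ} (ν : Measure (ProbVec d)) (z : Site d) {B : Set (Path d)}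
    (hB : MeasurableSet B) : avg ν z B = ∫⁻ ω, quenched z ω B ∂(envLaw ν) := by
  rw [avg, Measure.bind_apply hB (Kernel.aemeasurable _)]

theorem avgPair_apply {d : ℕ} (ν : Measure (ProbVec d)) (x y : Site d)
    {B : Set (Path d × Path d)} (hB : MeasurableSet B) :
    avgPair ν x y B = ∫⁻ ω, ((quenched x ω).prod (quenched y ω)) B ∂(envLaw ν) := by
  rw [avgPair, Measure.bind_apply hB (Kernel.aemeasurable _)]
  simp_rw [Kernel.prod_apply]

theorem avg_cyl {d : ℕ} (ν : Measure (ProbVec d)) (m : ℕ) (a : Path d) :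
    avg ν (a 0) (cyl m a) = ∫⁻ ω, weight ω m a ∂(envLaw ν) := by
  rw [avg_apply ν _ (measurableSet_cyl m a)]
  simp_rw [quenched_cyl_self]

theorem avg_cyl_of_ne {d : ℕ} (ν : Measure (ProbVec d)) {z : Site d} (m : ℕ) {a : Path d}
    (h : a 0 ≠ z) : avg ν z (cyl m a) = 0 := by
  classical
  rw [avg_apply ν _ (measurableSet_cyl m a)]
  simp [quenched_cyl, h]

theorem avgPair_prod {d : ℕ} (ν : Measure (ProbVec d)) (x y : Site d) {A B : Set (Path d)}
    (hA : MeasurableSet A) (hB : MeasurableSet B) :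
    avgPair ν x y (A ×ˢ B) = ∫⁻ ω, quenched x ω A * quenched y ω B ∂(envLaw ν) := by
  rw [avgPair_apply ν _ _ (hA.prod hB)]
  simp_rw [Measure.prod_prod]

theorem avgPair_cyl {d : ℕ} (ν : Measure (ProbVec d)) (m n : ℕ) (a b : Path d) :
    avgPair ν (a 0) (b 0) (cyl m a ×ˢ cyl n b)
      = ∫⁻ ω, weight ω m a * weight ω n b ∂(envLaw ν) := by
  rw [avgPair_prod ν _ _ (measurableSet_cyl m a) (measurableSet_cyl n b)]
  simp_rw [quenched_cyl_self]

theorem avgPair_map_fst {d : ℕ} (ν : Measure (ProbVec d)) (x y : Site d) {A : Set (Path d)}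
    (hA : MeasurableSet A) : avgPair ν x y (A ×ˢ Set.univ) = avg ν x A := by
  rw [avgPair_prod ν x y hA MeasurableSet.univ, avg_apply ν x hA]
  simp

theorem avgPair_map_snd {d : ℕ} (ν : Measure (ProbVec d)) (x y : Site d) {A : Set (Path d)}
    (hA : MeasurableSet A) : avgPair ν x y (Set.univ ×ˢ A) = avg ν y A := by
  rw [avgPair_prod ν x y MeasurableSet.univ hA, avg_apply ν y hA]
  simp

/-! ## Independence of disjoint sets of sites -/

/-- Functions of the environment on disjoint finite sets of sites are independent. -/
theorem lintegral_mul_of_disjoint {d : ℕ} (ν : Measure (ProbVec d)) [IsProbabilityMeasure ν]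
    (S T : Finset (Site d)) (hST : Disjoint S T) {f : (S → ProbVec d) → ℝ≥0∞}
    {g : (T → ProbVec d) → ℝ≥0∞} (hf : Measurable f) (hg : Measurable g) :
    ∫⁻ ω, f (fun s => ω s) * g (fun t => ω t) ∂(envLaw ν)
      = (∫⁻ ω, f (fun s => ω s) ∂(envLaw ν)) * ∫⁻ ω, g (fun t => ω t) ∂(envLaw ν) := by
  have hi : iIndepFun (fun (s : Site d) (ω : Env d) => ω s) (envLaw ν) :=
    iIndepFun_infinitePi (X := fun _ (p : ProbVec d) => p) (fun _ => measurable_id)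
  have h2 := hi.indepFun_finset S T hST (fun s => measurable_pi_apply s)
  have h3 := h2.comp hf hg
  exact lintegral_mul_eq_lintegral_mul_lintegral_of_indepFun
    (hf.comp (measurable_pi_lambda _ fun s => measurable_pi_apply (s : Site d)))
    (hg.comp (measurable_pi_lambda _ fun s => measurable_pi_apply (s : Site d))) h3

open Classical in
/-- The sites from which the path `a` jumps before time `m`. -/
noncomputable def exits {d : ℕ} (m : ℕ) (a : Path d) : Finset (Site d) :=
  (Finset.range m).image a

theorem mem_exits {d : ℕ} {m : ℕ} {a : Path d} {x : Site d} :
    x ∈ exits m a ↔ ∃ i < m, a i = x := by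
  simp [exits]

/-- The weight as a function of the environment on a set of sites that contains the exits. -/
theorem weight_eq_restrict {d : ℕ} (m : ℕ) (a : Path d) (S : Finset (Site d))
    (hS : exits m a ⊆ S) : ∃ f : (S → ProbVec d) → ℝ≥0∞, Measurable f ∧
      ∀ ω : Env d, weight ω m a = f fun s => ω s := by
  refine ⟨fun p => ∏ i : Fin m, (p ⟨a i, hS (mem_exits.2 ⟨i, i.2, rfl⟩)⟩).1 (a (i + 1) - a i),
    ?_, ?_⟩
  · refine Finset.measurable_prod _ fun i _ => ?_
    exact (measurable_pi_apply _).comp (measurable_subtype_coe.comp (measurable_pi_apply _))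
  · intro ω
    rw [weight, Finset.prod_range]

theorem lintegral_weight_mul_of_disjoint {d : ℕ} (ν : Measure (ProbVec d))
    [IsProbabilityMeasure ν] {m n : ℕ} {a b : Path d} (h : Disjoint (exits m a) (exits n b)) :
    ∫⁻ ω, weight ω m a * weight ω n b ∂(envLaw ν)
      = (∫⁻ ω, weight ω m a ∂(envLaw ν)) * ∫⁻ ω, weight ω n b ∂(envLaw ν) := by
  obtain ⟨f, hf, hf'⟩ := weight_eq_restrict m a _ subset_rfl
  obtain ⟨g, hg, hg'⟩ := weight_eq_restrict n b _ subset_rfl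
  simp_rw [hf', hg']
  exact lintegral_mul_of_disjoint ν _ _ h hf hg

/-- Past and future of two walks in one environment decouple when the pasts use sites of `S` and the
futures sites of `T`; within each group the two paths may share sites. -/
theorem lintegral_weight_mul_four {d : ℕ} (ν : Measure (ProbVec d)) [IsProbabilityMeasure ν]
    {m n m' n' : ℕ} {a b a' b' : Path d} {S T : Finset (Site d)} (h : Disjoint S T)
    (ha : exits m a ⊆ S) (hb : exits n b ⊆ S) (ha' : exits m' a' ⊆ T) (hb' : exits n' b' ⊆ T) :
    ∫⁻ ω, (weight ω m a * weight ω n b) * (weight ω m' a' * weight ω n' b') ∂(envLaw ν)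
      = (∫⁻ ω, weight ω m a * weight ω n b ∂(envLaw ν))
        * ∫⁻ ω, weight ω m' a' * weight ω n' b' ∂(envLaw ν) := by
  obtain ⟨f, hf, hf'⟩ := weight_eq_restrict m a S ha
  obtain ⟨g, hg, hg'⟩ := weight_eq_restrict n b S hb
  obtain ⟨f', hf₂, hf₂'⟩ := weight_eq_restrict m' a' T ha'
  obtain ⟨g', hg₂, hg₂'⟩ := weight_eq_restrict n' b' T hb'
  simp_rw [hf', hg', hf₂', hg₂']
  exact lintegral_mul_of_disjoint ν S T h (hf.mul hg) (hf₂.mul hg₂)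

/-! ## Translation invariance -/

theorem lintegral_envLaw_translate {d : ℕ} (ν : Measure (ProbVec d)) [IsProbabilityMeasure ν]
    (z : Site d) {F : Env d → ℝ≥0∞} (hF : Measurable F) :
    ∫⁻ ω, F (fun s => ω (z + s)) ∂(envLaw ν) = ∫⁻ ω, F ω ∂(envLaw ν) := by
  have hm : Measurable fun (ω : Env d) (s : Site d) => ω (z + s) :=
    measurable_pi_lambda _ fun s => measurable_pi_apply _
  have h : (envLaw ν).map (fun (ω : Env d) (s : Site d) => ω (z + s)) = envLaw ν := by
    refine Measure.eq_infinitePi _ fun S t ht => ?_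
    classical
    rw [Measure.map_apply hm (MeasurableSet.pi S.countable_toSet fun i _ => ht i)]
    have : (fun (ω : Env d) (s : Site d) => ω (z + s)) ⁻¹' (S : Set (Site d)).pi t
        = ((S.image (z + ·) : Finset (Site d)) : Set (Site d)).pi fun s => t (s - z) := by
      ext ω
      simp only [Set.mem_preimage, Set.mem_pi, Finset.mem_coe, Finset.mem_image,
        forall_exists_index, and_imp, forall_apply_eq_imp_iff₂, add_sub_cancel_left]
    rw [this, envLaw, Measure.infinitePi_pi _ fun i _ => ht _,
      Finset.prod_image (by intro a _ b _ hab; simpa using hab)]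
    simp
  rw [← lintegral_map hF hm, h]

theorem weight_translate {d : ℕ} (ω : Env d) (z : Site d) (m : ℕ) (a : Path d) :
    weight ω m (fun i => z + a i) = weight (fun s => ω (z + s)) m a := by
  simp [weight]

theorem lintegral_weight_translate {d : ℕ} (ν : Measure (ProbVec d)) [IsProbabilityMeasure ν]
    (z : Site d) (m : ℕ) (a : Path d) :
    ∫⁻ ω, weight ω m (fun i => z + a i) ∂(envLaw ν) = ∫⁻ ω, weight ω m a ∂(envLaw ν) := by
  simp_rw [weight_translate]
  exact lintegral_envLaw_translate ν z (measurable_weight m a)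

/-! ## Comparing measures on the atoms of a filtration -/

/-- Comparison of measures along the fibres of a countably valued map. -/
theorem measure_le_of_fibers {Ω E : Type*} [MeasurableSpace Ω] [MeasurableSpace E] [Countable E]
    [MeasurableSingletonClass E] {r : Ω → E} (hr : Measurable r) {μ₁ μ₂ : Measure Ω} {S T : Set Ω}
    (h : ∀ w, μ₁ (r ⁻¹' {r w} ∩ S) ≤ μ₂ (r ⁻¹' {r w} ∩ T)) : μ₁ S ≤ μ₂ T := by
  have hm : ∀ e, MeasurableSet (r ⁻¹' {e}) := fun e => hr (MeasurableSet.singleton e)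
  calc μ₁ S ≤ μ₁ (⋃ e, r ⁻¹' {e} ∩ S) := measure_mono fun w hw => by
        simpa using hw
    _ ≤ ∑' e, μ₁ (r ⁻¹' {e} ∩ S) := measure_iUnion_le _
    _ ≤ ∑' e, μ₂.restrict T (r ⁻¹' {e}) := by
        refine ENNReal.tsum_le_tsum fun e => ?_
        rw [Measure.restrict_apply (hm e)]
        -- Neither `S` nor `T` has to be measurable: subadditivity suffices for `S`, and the
        -- restriction to `T` is only evaluated on the measurable fibres.
        by_cases he : ∃ w, r w = e
        · obtain ⟨w, rfl⟩ := he
          exact h w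
        · have : r ⁻¹' {e} = ∅ := by
            ext w; simp only [Set.mem_preimage, Set.mem_singleton_iff, Set.mem_empty_iff_false,
              iff_false]
            exact fun h => he ⟨w, h⟩
          simp [this]
    _ = μ₂.restrict T (⋃ e, r ⁻¹' {e}) := by
        rw [measure_iUnion _ hm]
        intro e e' hee'
        exact Disjoint.preimage _ (by simpa using hee')
    _ = μ₂ T := by
        have : (⋃ e, r ⁻¹' {e}) = Set.univ := by ext; simp
        rw [this, Measure.restrict_apply_univ]

/-- Such a set is the preimage of its image, and every subset of a countable discrete space is
measurable. -/
theorem measurableSet_of_determined {Ω E : Type*} [MeasurableSpace Ω] [MeasurableSpace E]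
    [Countable E] [MeasurableSingletonClass E] {r : Ω → E} (hr : Measurable r) {S : Set Ω}
    (h : ∀ w w', r w = r w' → w ∈ S → w' ∈ S) : MeasurableSet S := by
  have : S = r ⁻¹' (r '' S) := by
    ext w
    constructor
    · exact fun hw => ⟨w, hw, rfl⟩
    · rintro ⟨w', hw', h'⟩
      exact h _ _ h' hw'
  rw [this]
  exact hr (Set.to_countable _).measurableSet

/-- Two finite measures that agree on the atoms of a filtration inside a decreasing sequence of
sets `V k` agree on the measurable subsets of the intersection of the `V k`. -/
theorem measure_eq_of_atoms {Ω : Type*} [mΩ : MeasurableSpace Ω] {E : ℕ → Type*}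
    [∀ k, MeasurableSpace (E k)] [∀ k, Countable (E k)] [∀ k, MeasurableSingletonClass (E k)]
    {r : ∀ k, Ω → E k} (hr : ∀ k, Measurable (r k))
    (hmono : ∀ k l, k ≤ l → ∀ w w', r l w = r l w' → r k w = r k w')
    (hgen : mΩ ≤ ⨆ k, MeasurableSpace.comap (r k) inferInstance)
    (μ₁ μ₂ : Measure Ω) [IsFiniteMeasure μ₁] [IsFiniteMeasure μ₂] {V : ℕ → Set Ω}
    (hV : Antitone V) (hVdet : ∀ k w w', r k w = r k w' → w ∈ V k → w' ∈ V k)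
    (hat : ∀ k w, w ∈ V k → μ₁ (r k ⁻¹' {r k w}) = μ₂ (r k ⁻¹' {r k w}))
    {B : Set Ω} (hB : MeasurableSet B) (hBV : B ⊆ ⋂ k, V k) : μ₁ B = μ₂ B := by
  have hVm : ∀ k, MeasurableSet (V k) := fun k => measurableSet_of_determined (hr k) (hVdet k)
  have hdet : ∀ k (S : Set Ω), (∀ w w', r k w = r k w' → w ∈ S → w' ∈ S) → S ⊆ V k →
      μ₁ S = μ₂ S := by
    intro k S hS hSV
    have hat' : ∀ w, μ₁ (r k ⁻¹' {r k w} ∩ S) = μ₂ (r k ⁻¹' {r k w} ∩ S) := by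
      intro w
      by_cases hw : w ∈ S
      · have : r k ⁻¹' {r k w} ∩ S = r k ⁻¹' {r k w} :=
          Set.inter_eq_left.2 fun w' hw' => hS w w' (Eq.symm hw') hw
        rw [this]; exact hat k w (hSV hw)
      · have : r k ⁻¹' {r k w} ∩ S = ∅ := by
          ext w'
          simp only [Set.mem_inter_iff, Set.mem_preimage, Set.mem_singleton_iff,
            Set.mem_empty_iff_false, iff_false, not_and]
          exact fun h1 h2 => hw (hS w' w h1 h2)
        rw [this]; simp
    exact le_antisymm (measure_le_of_fibers (hr k) fun w => (hat' w).le)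
      (measure_le_of_fibers (hr k) fun w => (hat' w).ge)
  set W : Set Ω := ⋂ k, V k with hW
  have hWm : MeasurableSet W := MeasurableSet.iInter hVm
  -- Agreement on subsets of `V (k + j)` determined at stage `k + j` passes to the intersection `W`
  -- by continuity from above. The events of the filtration form a generating π-system, so the
  -- measures restricted to `W` coincide.
  have key : ∀ k (S : Set Ω), (∀ w w', r k w = r k w' → w ∈ S → w' ∈ S) →
      μ₁ (S ∩ W) = μ₂ (S ∩ W) := by
    intro k S hS
    have hSm : MeasurableSet S := measurableSet_of_determined (hr k) hS
    have hSW : S ∩ W = ⋂ j, S ∩ V (k + j) := by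
      rw [← Set.inter_iInter]
      congr 1
      exact Set.Subset.antisymm (Set.subset_iInter fun j => Set.iInter_subset _ _)
        (Set.subset_iInter fun j => (Set.iInter_subset _ j).trans (hV (Nat.le_add_left j k)))
    have hanti : Antitone fun j => S ∩ V (k + j) :=
      fun i j hij => Set.inter_subset_inter_right _ (hV (by omega))
    have hlim : ∀ μ : Measure Ω, IsFiniteMeasure μ →
        Filter.Tendsto (fun j => μ (S ∩ V (k + j))) Filter.atTop (nhds (μ (S ∩ W))) := by
      intro μ _
      rw [hSW]
      exact tendsto_measure_iInter_atTop (fun j => (hSm.inter (hVm _)).nullMeasurableSet) hanti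
        ⟨0, measure_ne_top _ _⟩
    have heq : ∀ j, μ₁ (S ∩ V (k + j)) = μ₂ (S ∩ V (k + j)) := fun j =>
      hdet (k + j) _ (fun w w' hww' hw =>
        ⟨hS w w' (hmono k (k + j) (by omega) w w' hww') hw.1, hVdet _ w w' hww' hw.2⟩)
        Set.inter_subset_right
    have h1 := hlim μ₁ inferInstance
    simp_rw [heq] at h1
    exact tendsto_nhds_unique h1 (hlim μ₂ inferInstance)
  set F : ℕ → MeasurableSpace Ω := fun k => MeasurableSpace.comap (r k) inferInstance with hF
  have hgen' : mΩ = MeasurableSpace.generateFrom (⋃ k, {t | MeasurableSet[F k] t}) :=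
    (le_antisymm hgen (iSup_le fun k => (hr k).comap_le)).trans
      (MeasurableSpace.generateFrom_iUnion_measurableSet F).symm
  have hpi : IsPiSystem (⋃ k, {t | MeasurableSet[F k] t}) := by
    refine isPiSystem_iUnion_of_monotone _
      (fun k => @MeasurableSpace.isPiSystem_measurableSet Ω (F k)) ?_
    intro k l hkl t ht
    obtain ⟨T, hT, rfl⟩ := ht
    refine ⟨r l '' (r k ⁻¹' T), (Set.to_countable _).measurableSet, ?_⟩
    ext w
    constructor
    · rintro ⟨w', hw', h⟩
      have := hmono k l hkl _ _ h
      simpa [← this] using hw'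
    · exact fun hw => ⟨w, hw, rfl⟩
  have hext : μ₁.restrict W = μ₂.restrict W := by
    refine ext_of_generate_finite _ hgen' hpi ?_ ?_
    · intro s hs
      obtain ⟨k, T, hT, rfl⟩ := Set.mem_iUnion.1 hs
      rw [Measure.restrict_apply (hr k hT), Measure.restrict_apply (hr k hT)]
      refine key k _ fun w w' h hw => ?_
      simpa [← h] using hw
    · rw [Measure.restrict_apply_univ, Measure.restrict_apply_univ]
      have := key 0 Set.univ (fun _ _ _ _ => trivial)
      simpa using this
  have h1 : μ₁.restrict W B = μ₁ B := by
    rw [Measure.restrict_apply hB, Set.inter_eq_left.2 hBV]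
  have h2 : μ₂.restrict W B = μ₂ B := by
    rw [Measure.restrict_apply hB, Set.inter_eq_left.2 hBV]
  rw [← h1, ← h2, hext]

/-! ## The filtrations of paths and of pairs of paths -/

/-- The initial segment of a path. -/
abbrev seg {d : ℕ} (m : ℕ) (x : Path d) : Finset.Iic m → Site d :=
  Preorder.frestrictLe (π := fun _ : ℕ => Site d) m x

theorem measurable_seg {d : ℕ} (m : ℕ) : Measurable (seg (d := d) m) :=
  Preorder.measurable_frestrictLe m

theorem seg_eq_iff {d : ℕ} {m : ℕ} {x y : Path d} : seg m x = seg m y ↔ ∀ i ≤ m, x i = y i := by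
  simp [seg, funext_iff]

theorem seg_preimage {d : ℕ} (m : ℕ) (x : Path d) : seg m ⁻¹' {seg m x} = cyl m x := by
  ext y
  simp only [Set.mem_preimage, Set.mem_singleton_iff, seg_eq_iff, cyl, Set.mem_ofPred_eq]

theorem path_le_iSup_seg {d : ℕ} : (inferInstance : MeasurableSpace (Path d))
    ≤ ⨆ k, MeasurableSpace.comap (seg (d := d) k) inferInstance := by
  refine iSup_le fun i => le_trans ?_ (le_iSup _ i)
  have : (fun x : Path d => x i) = (fun s => s ⟨i, by simp⟩) ∘ seg i := rfl
  rw [this, ← MeasurableSpace.comap_comp]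
  exact MeasurableSpace.comap_mono (measurable_pi_apply _).comap_le

/-- The initial segments of a pair of paths. -/
abbrev seg₂ {d : ℕ} (m n : ℕ) (w : Path d × Path d) :
    (Finset.Iic m → Site d) × (Finset.Iic n → Site d) := (seg m w.1, seg n w.2)

theorem measurable_seg₂ {d : ℕ} (m n : ℕ) : Measurable (seg₂ (d := d) m n) :=
  ((measurable_seg m).comp measurable_fst).prodMk ((measurable_seg n).comp measurable_snd)

theorem seg₂_preimage {d : ℕ} (m n : ℕ) (w : Path d × Path d) :
    seg₂ m n ⁻¹' {seg₂ m n w} = cyl m w.1 ×ˢ cyl n w.2 := by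
  rw [← seg_preimage, ← seg_preimage]
  ext y
  simp only [Set.mem_preimage, Set.mem_singleton_iff, Prod.ext_iff, Set.mem_prod]

theorem seg₂_eq_iff {d : ℕ} {m n : ℕ} {w w' : Path d × Path d} :
    seg₂ m n w = seg₂ m n w' ↔ (∀ i ≤ m, w.1 i = w'.1 i) ∧ ∀ i ≤ n, w.2 i = w'.2 i := by
  rw [Prod.ext_iff, seg_eq_iff, seg_eq_iff]

theorem pair_le_iSup_seg₂ {d : ℕ} : (inferInstance : MeasurableSpace (Path d × Path d))
    ≤ ⨆ k, MeasurableSpace.comap (seg₂ (d := d) k k) inferInstance := by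
  refine sup_le ?_ ?_
  · refine (MeasurableSpace.comap_mono path_le_iSup_seg).trans ?_
    rw [MeasurableSpace.comap_iSup]
    refine iSup_mono fun k => ?_
    rw [MeasurableSpace.comap_comp]
    have : seg k ∘ Prod.fst = Prod.fst ∘ seg₂ (d := d) k k := rfl
    rw [this, ← MeasurableSpace.comap_comp]
    exact MeasurableSpace.comap_mono measurable_fst.comap_le
  · refine (MeasurableSpace.comap_mono path_le_iSup_seg).trans ?_
    rw [MeasurableSpace.comap_iSup]
    refine iSup_mono fun k => ?_
    rw [MeasurableSpace.comap_comp]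
    have : seg k ∘ Prod.snd = Prod.snd ∘ seg₂ (d := d) k k := rfl
    rw [this, ← MeasurableSpace.comap_comp]
    exact MeasurableSpace.comap_mono measurable_snd.comap_le

/-- The sets `V k` allow identities known only for special cylinders, such as those staying in a
half space or those of two disjoint paths, to be extended to measurable events that respect the same
constraint at all times. -/
theorem path_measure_eq_of_cyl {d : ℕ} (μ₁ μ₂ : Measure (Path d)) [IsFiniteMeasure μ₁]
    [IsFiniteMeasure μ₂] {V : ℕ → Set (Path d)} (hV : Antitone V)
    (hVdet : ∀ k x x', (∀ i ≤ k, x i = x' i) → x ∈ V k → x' ∈ V k)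
    (hat : ∀ k x, x ∈ V k → μ₁ (cyl k x) = μ₂ (cyl k x))
    {B : Set (Path d)} (hB : MeasurableSet B) (hBV : ∀ k, B ⊆ V k) : μ₁ B = μ₂ B :=
  measure_eq_of_atoms (r := fun k => seg k) (fun k => measurable_seg k)
    (fun k l hkl w w' h => seg_eq_iff.2 fun i hi => seg_eq_iff.1 h i (hi.trans hkl))
    path_le_iSup_seg μ₁ μ₂ hV (fun k w w' h => hVdet k w w' (seg_eq_iff.1 h))
    (fun k w hw => by rw [seg_preimage]; exact hat k w hw) hB (Set.subset_iInter hBV)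

theorem pair_measure_eq_of_cyl {d : ℕ} (μ₁ μ₂ : Measure (Path d × Path d)) [IsFiniteMeasure μ₁]
    [IsFiniteMeasure μ₂] {V : ℕ → Set (Path d × Path d)} (hV : Antitone V)
    (hVdet : ∀ k w w', (∀ i ≤ k, w.1 i = w'.1 i) → (∀ i ≤ k, w.2 i = w'.2 i) →
      w ∈ V k → w' ∈ V k)
    (hat : ∀ k w, w ∈ V k → μ₁ (cyl k w.1 ×ˢ cyl k w.2) = μ₂ (cyl k w.1 ×ˢ cyl k w.2))
    {B : Set (Path d × Path d)} (hB : MeasurableSet B) (hBV : ∀ k, B ⊆ V k) : μ₁ B = μ₂ B :=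
  measure_eq_of_atoms (r := fun k => seg₂ k k) (fun k => measurable_seg₂ k k)
    (fun k l hkl w w' h => seg₂_eq_iff.2 ⟨fun i hi => (seg₂_eq_iff.1 h).1 i (hi.trans hkl),
      fun i hi => (seg₂_eq_iff.1 h).2 i (hi.trans hkl)⟩)
    pair_le_iSup_seg₂ μ₁ μ₂ hV
    (fun k w w' h => hVdet k w w' (seg₂_eq_iff.1 h).1 (seg₂_eq_iff.1 h).2)
    (fun k w hw => by rw [seg₂_preimage]; exact hat k w hw) hB (Set.subset_iInter hBV)

/-! ## The renewal structure of the averaged walks -/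

theorem measurable_shift {d : ℕ} (k : ℕ) : Measurable (shift (d := d) k) :=
  measurable_pi_lambda _ fun _ => measurable_pi_apply _

/-- The path that follows `a` before time `m` and `c` from time `m` on. -/
def splice {d : ℕ} (m : ℕ) (a c : Path d) : Path d := fun i => if i < m then a i else c (i - m)

theorem splice_of_lt {d : ℕ} {m i : ℕ} (a c : Path d) (h : i < m) : splice m a c i = a i :=
  if_pos h

theorem splice_add {d : ℕ} (m i : ℕ) (a c : Path d) : splice m a c (m + i) = c i := by
  simp [splice]

theorem splice_of_le {d : ℕ} {m i : ℕ} {a c : Path d} (hc : c 0 = a m) (h : i ≤ m) :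
    splice m a c i = a i := by
  rcases h.lt_or_eq with h | rfl
  · exact splice_of_lt a c h
  · simpa [hc] using splice_add i 0 a c

theorem shift_splice {d : ℕ} (m : ℕ) (a c : Path d) : shift m (splice m a c) = c := by
  funext i
  exact splice_add m i a c

theorem cyl_splice {d : ℕ} {m k : ℕ} {a c : Path d} (hc : c 0 = a m) :
    cyl (m + k) (splice m a c) = cyl m a ∩ shift m ⁻¹' cyl k c := by
  ext x
  simp only [cyl, Set.mem_ofPred_eq, Set.mem_inter_iff, Set.mem_preimage, shift]
  constructor
  · intro h
    refine ⟨fun i hi => ?_, fun i hi => ?_⟩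
    · rw [h i (by omega), splice_of_le hc hi]
    · rw [h (m + i) (by omega), splice_add]
  · rintro ⟨h1, h2⟩ i hi
    rcases le_total i m with him | him
    · rw [h1 i him, splice_of_le hc him]
    · obtain ⟨j, rfl⟩ := Nat.exists_eq_add_of_le him
      rw [h2 j (by omega), splice_add]

/-- The sites left before time `m` lie below level `L`, those left afterwards at or above it. The
endpoint of a finite path is not left, so nothing is required of its level. -/
theorem avg_cyl_factor {d : ℕ} (ν : Measure (ProbVec d)) [IsProbabilityMeasure ν] {u : Site d}
    {L : ℤ} {m k : ℕ} {a : Path d} (h1 : ∀ i < m, level u (a i) < L)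
    (h2 : ∀ i < k, L ≤ level u (a (m + i))) :
    avg ν (a 0) (cyl (m + k) a) = avg ν (a 0) (cyl m a) * avg ν (a m) (cyl k (shift m a)) := by
  have hd : Disjoint (exits m a) (exits k (shift m a)) := by
    rw [Finset.disjoint_left]
    intro s hs hs'
    obtain ⟨i, hi, rfl⟩ := mem_exits.1 hs
    obtain ⟨j, hj, hj'⟩ := mem_exits.1 hs'
    have := h2 j hj
    rw [shift] at hj'
    rw [hj'] at this
    exact absurd (h1 i hi) (not_lt.2 this)
  have h3 : shift m a 0 = a m := rfl
  rw [avg_cyl, avg_cyl, ← h3, avg_cyl]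
  simp_rw [weight_add]
  exact lintegral_weight_mul_of_disjoint ν hd

/-- A family of laws of pairs of walks whose marginals are averaged walks and that renews itself
where both walks enter an unexplored half space. -/
structure FreshLaw {d : ℕ} (ν : Measure (ProbVec d)) (u : Site d)
    (P : Site d → Site d → Measure (Path d × Path d)) : Prop where
  prob : ∀ x y, IsProbabilityMeasure (P x y)
  fst : ∀ x y {A : Set (Path d)}, MeasurableSet A → P x y (A ×ˢ Set.univ) = avg ν x A
  snd : ∀ x y {A : Set (Path d)}, MeasurableSet A → P x y (Set.univ ×ˢ A) = avg ν y A
  factor : ∀ {L : ℤ} {m k n l : ℕ} {a b : Path d}, (∀ i < m, level u (a i) < L) →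
    (∀ i < n, level u (b i) < L) → (∀ i < k, L ≤ level u (a (m + i))) →
    (∀ i < l, L ≤ level u (b (n + i))) →
    P (a 0) (b 0) (cyl (m + k) a ×ˢ cyl (n + l) b) = P (a 0) (b 0) (cyl m a ×ˢ cyl n b)
      * P (a m) (b n) (cyl k (shift m a) ×ˢ cyl l (shift n b))

theorem freshLaw_avgPair {d : ℕ} (ν : Measure (ProbVec d)) [IsProbabilityMeasure ν]
    (u : Site d) : FreshLaw ν u (avgPair ν) where
  prob x y := inferInstance
  fst x y _ hA := avgPair_map_fst ν x y hA
  snd x y _ hA := avgPair_map_snd ν x y hA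
  factor {L m k n l a b} ha hb ha' hb' := by
    classical
    have h3 : shift m a 0 = a m := rfl
    have h4 : shift n b 0 = b n := rfl
    rw [avgPair_cyl, avgPair_cyl, ← h3, ← h4, avgPair_cyl]
    simp_rw [weight_add]
    have hd : Disjoint (exits m a ∪ exits n b) (exits k (shift m a) ∪ exits l (shift n b)) := by
      rw [Finset.disjoint_left]
      intro s hs hs'
      have h5 : level u s < L := by
        rcases Finset.mem_union.1 hs with h | h <;> obtain ⟨i, hi, rfl⟩ := mem_exits.1 h
        exacts [ha i hi, hb i hi]
      have h6 : L ≤ level u s := by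
        rcases Finset.mem_union.1 hs' with h | h <;> obtain ⟨i, hi, rfl⟩ := mem_exits.1 h
        exacts [ha' i hi, hb' i hi]
      omega
    rw [← lintegral_weight_mul_four ν hd Finset.subset_union_left Finset.subset_union_right
      Finset.subset_union_left Finset.subset_union_right]
    refine lintegral_congr fun ω => ?_
    ring

theorem freshLaw_prod {d : ℕ} (ν : Measure (ProbVec d)) [IsProbabilityMeasure ν]
    (u : Site d) : FreshLaw ν u fun x y => (avg ν x).prod (avg ν y) where
  prob x y := inferInstance
  fst x y A hA := by rw [Measure.prod_prod]; simp
  snd x y A hA := by rw [Measure.prod_prod]; simp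
  factor {L m k n l a b} ha hb ha' hb' := by
    simp_rw [Measure.prod_prod]
    rw [avg_cyl_factor ν ha ha', avg_cyl_factor ν hb hb']
    ring

theorem FreshLaw.cyl_of_ne {d : ℕ} {ν : Measure (ProbVec d)} {u : Site d}
    {P : Site d → Site d → Measure (Path d × Path d)} (hP : FreshLaw ν u P) {x y : Site d}
    {m n : ℕ} {a b : Path d} (h : a 0 ≠ x ∨ b 0 ≠ y) : P x y (cyl m a ×ˢ cyl n b) = 0 := by
  rcases h with h | h
  · refine measure_mono_null (Set.prod_mono_right (Set.subset_univ _)) ?_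
    rw [hP.fst x y (measurableSet_cyl m a), avg_cyl_of_ne ν m h]
  · refine measure_mono_null (Set.prod_mono_left (Set.subset_univ _)) ?_
    rw [hP.snd x y (measurableSet_cyl n b), avg_cyl_of_ne ν n h]

/-- Renewal for one walk: on entering the unexplored half space `{level ≥ L}` at the end of the
finite path `a`, events on which the walk stays in that half space are independent of `a`. -/
theorem avg_cyl_inter_shift {d : ℕ} (ν : Measure (ProbVec d)) [IsProbabilityMeasure ν]
    {u : Site d} {L : ℤ} {m : ℕ} {a : Path d} (h1 : ∀ i < m, level u (a i) < L)
    {B : Set (Path d)} (hB : MeasurableSet B) (hBL : ∀ x ∈ B, ∀ k, L ≤ level u (x k)) :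
    avg ν (a 0) (cyl m a ∩ shift m ⁻¹' B) = avg ν (a 0) (cyl m a) * avg ν (a m) B := by
  -- The law of the future on the cylinder is compared with a multiple of the law of a new walk.
  -- They agree on cylinders that stay in the half space, where gluing the new path to `a` gives a
  -- path that factors at time `m`.
  have h := path_measure_eq_of_cyl (((avg ν (a 0)).restrict (cyl m a)).map (shift m))
    ((avg ν (a 0) (cyl m a)).toNNReal • avg ν (a m)) (V := fun k => {x | ∀ i < k, L ≤ level u (x i)})
    (fun k l hkl x hx i hi => hx i (hi.trans_le hkl))
    (fun k x x' hxx' hx i hi => by rw [← hxx' i hi.le]; exact hx i hi) ?_ hB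
    (fun k x hx i _ => hBL x hx i)
  · rw [Measure.map_apply (measurable_shift m) hB,
      Measure.restrict_apply (measurable_shift m hB), Set.inter_comm] at h
    rw [h, Measure.smul_apply, ENNReal.smul_def, ENNReal.coe_toNNReal (measure_ne_top _ _),
      smul_eq_mul]
  · intro k x hx
    rw [Measure.map_apply (measurable_shift m) (measurableSet_cyl k x),
      Measure.restrict_apply (measurable_shift m (measurableSet_cyl k x)), Set.inter_comm,
      Measure.smul_apply, ENNReal.smul_def, ENNReal.coe_toNNReal (measure_ne_top _ _), smul_eq_mul]
    by_cases h0 : x 0 = a m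
    · rw [← cyl_splice h0]
      have hs : splice m a x 0 = a 0 := splice_of_le h0 (Nat.zero_le _)
      have hs' : splice m a x m = a m := splice_of_le h0 le_rfl
      have := avg_cyl_factor ν (L := L) (m := m) (k := k) (a := splice m a x)
        (fun i hi => by rw [splice_of_lt _ _ hi]; exact h1 i hi)
        (fun i hi => by rw [splice_add]; exact hx i hi)
      rw [hs, hs', shift_splice, cyl_congr (b := a) fun i hi => splice_of_le h0 hi] at this
      exact this
    · rw [avg_cyl_of_ne ν k h0, mul_zero]
      convert measure_empty (μ := avg ν (a 0))
      ext y
      simp only [Set.mem_inter_iff, Set.mem_preimage, Set.mem_empty_iff_false, iff_false, not_and]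
      intro hy hy'
      exact h0 ((hy' 0 (Nat.zero_le _)).symm.trans (hy m le_rfl))

theorem cyl_inter_shift_eq_empty {d : ℕ} {m k : ℕ} {a c : Path d} (h : c 0 ≠ a m) :
    cyl m a ∩ shift m ⁻¹' cyl k c = ∅ := by
  ext y
  simp only [Set.mem_inter_iff, Set.mem_preimage, Set.mem_empty_iff_false, iff_false, not_and]
  intro hy hy'
  exact h ((hy' 0 (Nat.zero_le _)).symm.trans (hy m le_rfl))

/-- The shift of a pair of paths, each by its own time. -/
def shift₂ {d : ℕ} (m n : ℕ) (w : Path d × Path d) : Path d × Path d :=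
  (shift m w.1, shift n w.2)

theorem measurable_shift₂ {d : ℕ} (m n : ℕ) : Measurable (shift₂ (d := d) m n) :=
  ((measurable_shift m).comp measurable_fst).prodMk ((measurable_shift n).comp measurable_snd)

theorem FreshLaw.cyl_splice {d : ℕ} {ν : Measure (ProbVec d)} {u : Site d}
    {P : Site d → Site d → Measure (Path d × Path d)} (hP : FreshLaw ν u P)
    {L : ℤ} {m n k l : ℕ} {a b c e : Path d} (ha : ∀ i < m, level u (a i) < L)
    (hb : ∀ i < n, level u (b i) < L) (hc : ∀ i < k, L ≤ level u (c i))
    (he : ∀ i < l, L ≤ level u (e i)) :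
    P (a 0) (b 0) ((cyl m a ×ˢ cyl n b) ∩ shift₂ m n ⁻¹' (cyl k c ×ˢ cyl l e))
      = P (a 0) (b 0) (cyl m a ×ˢ cyl n b) * P (a m) (b n) (cyl k c ×ˢ cyl l e) := by
  have hset : (cyl m a ×ˢ cyl n b) ∩ shift₂ m n ⁻¹' (cyl k c ×ˢ cyl l e)
      = (cyl m a ∩ shift m ⁻¹' cyl k c) ×ˢ (cyl n b ∩ shift n ⁻¹' cyl l e) := by
    ext w
    simp only [Set.mem_inter_iff, Set.mem_prod, Set.mem_preimage, shift₂]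
    tauto
  rw [hset]
  by_cases h0 : c 0 = a m ∧ e 0 = b n
  · obtain ⟨h0, h0'⟩ := h0
    rw [← RWRE.cyl_splice h0, ← RWRE.cyl_splice h0']
    have := hP.factor (L := L) (m := m) (k := k) (n := n) (l := l) (a := splice m a c)
      (b := splice n b e)
      (fun i hi => by rw [splice_of_lt _ _ hi]; exact ha i hi)
      (fun i hi => by rw [splice_of_lt _ _ hi]; exact hb i hi)
      (fun i hi => by rw [splice_add]; exact hc i hi)
      (fun i hi => by rw [splice_add]; exact he i hi)
    rw [splice_of_le h0 (Nat.zero_le _), splice_of_le h0' (Nat.zero_le _), splice_of_le h0 le_rfl,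
      splice_of_le h0' le_rfl, shift_splice, shift_splice,
      cyl_congr (b := a) fun i hi => splice_of_le h0 hi,
      cyl_congr (b := b) fun i hi => splice_of_le h0' hi] at this
    exact this
  · have h0' : c 0 ≠ a m ∨ e 0 ≠ b n := not_and_or.1 h0
    rw [hP.cyl_of_ne h0', mul_zero]
    rcases h0' with h | h
    · rw [cyl_inter_shift_eq_empty h]; simp
    · rw [cyl_inter_shift_eq_empty h]; simp

/-- Renewal for two walks: once both have entered the unexplored half space `{level ≥ L}`, events
on which both stay in that half space are independent of the past. -/
theorem FreshLaw.cyl_inter_shift {d : ℕ} {ν : Measure (ProbVec d)} {u : Site d}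
    {P : Site d → Site d → Measure (Path d × Path d)} (hP : FreshLaw ν u P)
    {L : ℤ} {m n : ℕ} {a b : Path d} (ha : ∀ i < m, level u (a i) < L)
    (hb : ∀ i < n, level u (b i) < L) {B : Set (Path d × Path d)} (hB : MeasurableSet B)
    (hBL : ∀ w ∈ B, ∀ k, L ≤ level u (w.1 k) ∧ L ≤ level u (w.2 k)) :
    P (a 0) (b 0) ((cyl m a ×ˢ cyl n b) ∩ shift₂ m n ⁻¹' B)
      = P (a 0) (b 0) (cyl m a ×ˢ cyl n b) * P (a m) (b n) B := by
  have := hP.prob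
  have h := pair_measure_eq_of_cyl
    (((P (a 0) (b 0)).restrict (cyl m a ×ˢ cyl n b)).map (shift₂ m n))
    ((P (a 0) (b 0) (cyl m a ×ˢ cyl n b)).toNNReal • P (a m) (b n))
    (V := fun k => {w | ∀ i < k, L ≤ level u (w.1 i) ∧ L ≤ level u (w.2 i)})
    (fun k l hkl x hx i hi => hx i (hi.trans_le hkl))
    (fun k w w' h1 h2 hw i hi => by rw [← h1 i hi.le, ← h2 i hi.le]; exact hw i hi) ?_ hB
    (fun k x hx i _ => hBL x hx i)
  · rw [Measure.map_apply (measurable_shift₂ m n) hB,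
      Measure.restrict_apply (measurable_shift₂ m n hB), Set.inter_comm] at h
    rw [h, Measure.smul_apply, ENNReal.smul_def, ENNReal.coe_toNNReal (measure_ne_top _ _),
      smul_eq_mul]
  · intro k w hw
    have hm := (measurableSet_cyl k w.1).prod (measurableSet_cyl k w.2)
    rw [Measure.map_apply (measurable_shift₂ m n) hm,
      Measure.restrict_apply (measurable_shift₂ m n hm), Set.inter_comm,
      Measure.smul_apply, ENNReal.smul_def, ENNReal.coe_toNNReal (measure_ne_top _ _), smul_eq_mul]
    exact hP.cyl_splice ha hb (fun i hi => (hw i hi).1) (fun i hi => (hw i hi).2)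

/-- Upper bound for one walk at a time `m` at which it enters an unexplored half space. -/
theorem avg_inter_shift_le {d : ℕ} (ν : Measure (ProbVec d)) [IsProbabilityMeasure ν]
    {u : Site d} {L : ℤ} {m : ℕ} {z : Site d} {A : Set (Path d)}
    (hdet : ∀ x x', (∀ i ≤ m, x i = x' i) → x ∈ A → x' ∈ A)
    (hfresh : ∀ x ∈ A, ∀ i < m, level u (x i) < L)
    {B : Set (Path d)} (hB : MeasurableSet B) (hBL : ∀ x ∈ B, ∀ k, L ≤ level u (x k))
    {c : ℝ≥0∞} (hc : ∀ y, avg ν y B ≤ c) :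
    avg ν z (A ∩ shift m ⁻¹' B) ≤ c * avg ν z A := by
  have := measure_le_of_fibers (measurable_seg (d := d) m) (μ₁ := avg ν z) (μ₂ := c • avg ν z)
    (S := A ∩ shift m ⁻¹' B) (T := A) ?_
  · simpa using this
  intro x
  rw [seg_preimage, Measure.smul_apply, smul_eq_mul]
  by_cases hx : x ∈ A
  · have h1 : cyl m x ⊆ A := fun x' hx' => hdet x x' (fun i hi => (hx' i hi).symm) hx
    rw [← Set.inter_assoc, Set.inter_eq_left.2 h1]
    by_cases h0 : x 0 = z
    · subst h0
      rw [avg_cyl_inter_shift ν (hfresh x hx) hB hBL, mul_comm]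
      gcongr
      exact hc _
    · rw [measure_mono_null Set.inter_subset_left (avg_cyl_of_ne ν m h0)]
      exact zero_le
  · have : cyl m x ∩ (A ∩ shift m ⁻¹' B) = ∅ := by
      ext x'
      simp only [Set.mem_inter_iff, Set.mem_empty_iff_false, iff_false, not_and]
      exact fun h1 h2 => absurd (hdet x' x h1 h2) hx
    rw [this]; simp

/-- Lower bound for two walks after both have entered an unexplored half space. -/
theorem FreshLaw.le_inter_shift {d : ℕ} {ν : Measure (ProbVec d)} {u : Site d}
    {P : Site d → Site d → Measure (Path d × Path d)} (hP : FreshLaw ν u P)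
    {L : ℤ} {m n : ℕ} {x y : Site d} {A : Set (Path d × Path d)}
    (hdet : ∀ w w', (∀ i ≤ m, w.1 i = w'.1 i) → (∀ i ≤ n, w.2 i = w'.2 i) → w ∈ A → w' ∈ A)
    (hfresh : ∀ w ∈ A, (∀ i < m, level u (w.1 i) < L) ∧ ∀ i < n, level u (w.2 i) < L)
    {B : Set (Path d × Path d)} (hB : MeasurableSet B)
    (hBL : ∀ w ∈ B, ∀ k, L ≤ level u (w.1 k) ∧ L ≤ level u (w.2 k))
    {c : ℝ≥0∞} (hc : ∀ w ∈ A, c ≤ P (w.1 m) (w.2 n) B) :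
    c * P x y A ≤ P x y (A ∩ shift₂ m n ⁻¹' B) := by
  have := measure_le_of_fibers (measurable_seg₂ (d := d) m n) (μ₁ := c • P x y) (μ₂ := P x y)
    (S := A) (T := A ∩ shift₂ m n ⁻¹' B) ?_
  · simpa using this
  intro w
  rw [seg₂_preimage, Measure.smul_apply, smul_eq_mul]
  by_cases hw : w ∈ A
  · have h1 : cyl m w.1 ×ˢ cyl n w.2 ⊆ A := fun w' hw' =>
      hdet w w' (fun i hi => (hw'.1 i hi).symm) (fun i hi => (hw'.2 i hi).symm) hw
    rw [← Set.inter_assoc, Set.inter_eq_left.2 h1]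
    by_cases h0 : w.1 0 = x ∧ w.2 0 = y
    · obtain ⟨rfl, rfl⟩ := h0
      rw [hP.cyl_inter_shift (hfresh w hw).1 (hfresh w hw).2 hB hBL, mul_comm]
      gcongr
      exact hc _ hw
    · rw [hP.cyl_of_ne (not_and_or.1 h0), mul_zero]
      exact zero_le
  · have : (cyl m w.1 ×ˢ cyl n w.2) ∩ A = ∅ := by
      ext w'
      simp only [Set.mem_inter_iff, Set.mem_empty_iff_false, iff_false, not_and]
      exact fun h1 h2 => hw (hdet w' w h1.1 h1.2 h2)
    rw [this]; simp

/-- Lower bound for the event that two walks follow prescribed finite paths after both have entered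
an unexplored half space. -/
theorem FreshLaw.le_inter_of_cyl {d : ℕ} {ν : Measure (ProbVec d)} {u : Site d}
    {P : Site d → Site d → Measure (Path d × Path d)} (hP : FreshLaw ν u P)
    {L : ℤ} {m n : ℕ} {x y : Site d} {A G : Set (Path d × Path d)}
    (hdet : ∀ w w', (∀ i ≤ m, w.1 i = w'.1 i) → (∀ i ≤ n, w.2 i = w'.2 i) → w ∈ A → w' ∈ A)
    (hfresh : ∀ w ∈ A, (∀ i < m, level u (w.1 i) < L) ∧ ∀ i < n, level u (w.2 i) < L)
    {c : ℝ≥0∞} (hG : ∀ w ∈ A, ∃ (k l : ℕ) (α β : Path d), (∀ i < k, L ≤ level u (α i)) ∧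
      (∀ i < l, L ≤ level u (β i)) ∧ c ≤ P (w.1 m) (w.2 n) (cyl k α ×ˢ cyl l β) ∧
      ∀ w' ∈ A, shift m w'.1 ∈ cyl k α → shift n w'.2 ∈ cyl l β → w' ∈ G) :
    c * P x y A ≤ P x y (A ∩ G) := by
  have := measure_le_of_fibers (measurable_seg₂ (d := d) m n) (μ₁ := c • P x y) (μ₂ := P x y)
    (S := A) (T := A ∩ G) ?_
  · simpa using this
  intro w
  rw [seg₂_preimage, Measure.smul_apply, smul_eq_mul]
  by_cases hw : w ∈ A
  · have h1 : cyl m w.1 ×ˢ cyl n w.2 ⊆ A := fun w' hw' =>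
      hdet w w' (fun i hi => (hw'.1 i hi).symm) (fun i hi => (hw'.2 i hi).symm) hw
    rw [← Set.inter_assoc, Set.inter_eq_left.2 h1]
    by_cases h0 : w.1 0 = x ∧ w.2 0 = y
    · obtain ⟨rfl, rfl⟩ := h0
      obtain ⟨k, l, α, β, hα, hβ, hc, hG⟩ := hG w hw
      calc c * P (w.1 0) (w.2 0) (cyl m w.1 ×ˢ cyl n w.2)
          ≤ P (w.1 0) (w.2 0) (cyl m w.1 ×ˢ cyl n w.2)
              * P (w.1 m) (w.2 n) (cyl k α ×ˢ cyl l β) := by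
            rw [mul_comm]; gcongr
        _ = P (w.1 0) (w.2 0) ((cyl m w.1 ×ˢ cyl n w.2)
              ∩ shift₂ m n ⁻¹' (cyl k α ×ˢ cyl l β)) :=
            (hP.cyl_splice (hfresh w hw).1 (hfresh w hw).2 hα hβ).symm
        _ ≤ P (w.1 0) (w.2 0) ((cyl m w.1 ×ˢ cyl n w.2) ∩ G) :=
            measure_mono fun w' hw' => ⟨hw'.1, hG w' (h1 hw'.1) hw'.2.1 hw'.2.2⟩
    · rw [hP.cyl_of_ne (not_and_or.1 h0), mul_zero]
      exact zero_le
  · have : (cyl m w.1 ×ˢ cyl n w.2) ∩ A = ∅ := by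
      ext w'
      simp only [Set.mem_inter_iff, Set.mem_empty_iff_false, iff_false, not_and]
      exact fun h1 h2 => hw (hdet w' w h1.1 h1.2 h2)
    rw [this]; simp

/-- Averaged laws are translation invariant. -/
theorem avg_translate {d : ℕ} (ν : Measure (ProbVec d)) [IsProbabilityMeasure ν] (z : Site d)
    {B : Set (Path d)} (hB : MeasurableSet B) :
    avg ν z B = avg ν 0 {x | (fun i => z + x i) ∈ B} := by
  have hm : Measurable fun (x : Path d) (i : ℕ) => z + x i :=
    measurable_pi_lambda _ fun i => measurable_const.add (measurable_pi_apply i)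
  have h := path_measure_eq_of_cyl (avg ν z) ((avg ν 0).map fun (x : Path d) (i : ℕ) => z + x i)
    (V := fun _ => Set.univ) (fun _ _ _ => le_rfl) (fun _ _ _ _ _ => trivial) ?_ hB
    (fun k => Set.subset_univ _)
  · rw [h, Measure.map_apply hm hB]; rfl
  · intro k a _
    rw [Measure.map_apply hm (measurableSet_cyl k a)]
    have hset : (fun (x : Path d) (i : ℕ) => z + x i) ⁻¹' cyl k a = cyl k fun i => -z + a i := by
      ext x
      simp only [cyl, Set.mem_preimage, Set.mem_ofPred_eq]
      exact forall₂_congr fun i _ => by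
        constructor
        · intro h; rw [← h]; abel
        · intro h; rw [h]; abel
    rw [hset]
    by_cases h0 : a 0 = z
    · have h1 : avg ν 0 (cyl k fun i => -z + a i)
          = avg ν ((fun i => -z + a i) 0) (cyl k fun i => -z + a i) := by simp [h0]
      rw [h1, avg_cyl ν k fun i => -z + a i, lintegral_weight_translate, ← avg_cyl, h0]
    · rw [avg_cyl_of_ne ν k h0, avg_cyl_of_ne]
      intro h
      apply h0
      have h : -z + a 0 = 0 := h
      rw [neg_add_eq_zero] at h
      exact h.symm

/-! ## Hitting times and fresh levels of deterministic paths -/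

theorem iInf_coe_eq_coe_iff {p : ℕ → Prop} {m : ℕ} :
    (⨅ (n : ℕ) (_ : p n), (n : ℕ∞)) = m ↔ p m ∧ ∀ i < m, ¬ p i := by
  constructor
  · intro h
    have hle : ∀ i, p i → (m : ℕ∞) ≤ i := fun i hi => h ▸ iInf₂_le i hi
    refine ⟨?_, fun i hi hpi => absurd (hle i hpi) (by exact_mod_cast not_le.2 hi)⟩
    by_contra hm
    have : ((m + 1 : ℕ) : ℕ∞) ≤ ⨅ (n : ℕ) (_ : p n), (n : ℕ∞) := by
      refine le_iInf₂ fun n hn => ?_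
      have h1 : m ≤ n := by exact_mod_cast hle n hn
      have h2 : m ≠ n := fun h => hm (h ▸ hn)
      exact_mod_cast (show m + 1 ≤ n by omega)
    rw [h] at this
    have : m + 1 ≤ m := by exact_mod_cast this
    omega
  · rintro ⟨h1, h2⟩
    refine le_antisymm (iInf₂_le m h1) (le_iInf₂ fun n hn => ?_)
    exact_mod_cast not_lt.1 fun h => h2 n h hn

theorem iInf_coe_eq_top_iff {p : ℕ → Prop} :
    (⨅ (n : ℕ) (_ : p n), (n : ℕ∞)) = ⊤ ↔ ∀ n, ¬ p n := by
  simp only [iInf_eq_top, ENat.natCast_ne_top, imp_false]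

/-- The path `x` reaches the half space `{level ≥ ℓ}` for the first time at time `m`. -/
def Enters {d : ℕ} (u : Site d) (ℓ : ℤ) (x : Path d) (m : ℕ) : Prop :=
  ℓ ≤ level u (x m) ∧ ∀ i < m, level u (x i) < ℓ

/-- The path `x` enters the half space `{level ≥ ℓ}` at time `m`, exactly at level `ℓ`. -/
def FirstHit {d : ℕ} (u : Site d) (ℓ : ℤ) (x : Path d) (m : ℕ) : Prop :=
  level u (x m) = ℓ ∧ ∀ i < m, level u (x i) < ℓ

theorem FirstHit.enters {d : ℕ} {u : Site d} {ℓ : ℤ} {x : Path d} {m : ℕ}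
    (h : FirstHit u ℓ x m) : Enters u ℓ x m := ⟨h.1.ge, h.2⟩

theorem Enters.unique {d : ℕ} {u : Site d} {ℓ : ℤ} {x : Path d} {m n : ℕ}
    (h : Enters u ℓ x m) (h' : Enters u ℓ x n) : m = n := by
  rcases lt_trichotomy m n with hmn | hmn | hmn
  · exact absurd (h'.2 m hmn) (not_lt.2 h.1)
  · exact hmn
  · exact absurd (h.2 n hmn) (not_lt.2 h'.1)

theorem exists_enters {d : ℕ} {u : Site d} {ℓ : ℤ} {x : Path d} {m : ℕ}
    (h : ℓ ≤ level u (x m)) : ∃ n ≤ m, Enters u ℓ x n := by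
  classical
  have hex : ∃ n, ℓ ≤ level u (x n) := ⟨m, h⟩
  exact ⟨Nat.find hex, Nat.find_min' hex h, Nat.find_spec hex,
    fun i hi => not_le.1 (Nat.find_min hex hi)⟩

theorem hitTime_eq_iff {d : ℕ} {u : Site d} {ℓ : ℤ} {x : Path d} {m : ℕ} :
    hitTime u ℓ x = m ↔ Enters u ℓ x m := by
  simp only [hitTime, iInf_coe_eq_coe_iff, not_le, Enters]

theorem backtrackTime_eq_top_iff {d : ℕ} {u : Site d} {x : Path d} :
    backtrackTime u x = ⊤ ↔ ∀ n, level u (x 0) ≤ level u (x n) := by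
  simp only [backtrackTime, iInf_coe_eq_top_iff, not_lt]

theorem min_backtrackTime_eq {d : ℕ} {u : Site d} {x y : Path d} :
    min (backtrackTime u x) (backtrackTime u y)
      = ⨅ (n : ℕ) (_ : level u (x n) < level u (x 0) ∨ level u (y n) < level u (y 0)), (n : ℕ∞) := by
  rw [backtrackTime, backtrackTime, ← iInf_inf_eq]
  exact iInf_congr fun n => (iInf_or (s := fun _ => (n : ℕ∞))).symm

theorem commonFresh_iff {d : ℕ} {u : Site d} {x y : Path d} {ℓ : ℤ} :
    CommonFresh u x y ℓ ↔ ∃ m n, FirstHit u ℓ x m ∧ FirstHit u ℓ y n := by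
  constructor
  · rintro ⟨m, n, h1, h2, h3, h4⟩
    exact ⟨m, n, ⟨h3, (hitTime_eq_iff.1 h1).2⟩, ⟨h4, (hitTime_eq_iff.1 h2).2⟩⟩
  · rintro ⟨m, n, h1, h2⟩
    exact ⟨m, n, hitTime_eq_iff.2 h1.enters, hitTime_eq_iff.2 h2.enters, h1.1, h2.1⟩

theorem FirstHit.congr {d : ℕ} {u : Site d} {ℓ : ℤ} {x x' : Path d} {m : ℕ}
    (h : FirstHit u ℓ x m) (hx : ∀ i ≤ m, x i = x' i) : FirstHit u ℓ x' m :=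
  ⟨by rw [← hx m le_rfl]; exact h.1, fun i hi => by rw [← hx i hi.le]; exact h.2 i hi⟩

theorem FirstHit.le_of_le {d : ℕ} {u : Site d} {ℓ ℓ' : ℤ} {x : Path d} {m m' : ℕ}
    (h : FirstHit u ℓ x m) (h' : FirstHit u ℓ' x m') (hl : ℓ ≤ ℓ') : m ≤ m' := by
  by_contra hm
  have := h.2 m' (not_le.1 hm)
  rw [h'.1] at this
  omega

theorem FirstHit.lt_of_lt {d : ℕ} {u : Site d} {ℓ ℓ' : ℤ} {x : Path d} {m m' : ℕ}
    (h : FirstHit u ℓ x m) (h' : FirstHit u ℓ' x m') (hl : ℓ < ℓ') : m < m' := by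
  refine lt_of_le_of_ne (h.le_of_le h' hl.le) fun hm => ?_
  subst hm
  exact hl.ne (h.1.symm.trans h'.1)

theorem FirstHit.shift_iff {d : ℕ} {u : Site d} {ℓ ℓ' : ℤ} {x : Path d} {m j : ℕ}
    (h : FirstHit u ℓ x m) (hl : ℓ < ℓ') : FirstHit u ℓ' (shift m x) j ↔ FirstHit u ℓ' x (m + j) := by
  constructor
  · rintro ⟨h1, h2⟩
    refine ⟨h1, fun i hi => ?_⟩
    rcases lt_or_ge i m with him | him
    · exact (h.2 i him).trans hl
    · obtain ⟨k, rfl⟩ := Nat.exists_eq_add_of_le him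
      exact h2 k (by omega)
  · rintro ⟨h1, h2⟩
    exact ⟨h1, fun i hi => h2 (m + i) (by omega)⟩

theorem commonFresh_shift_iff {d : ℕ} {u : Site d} {ℓ ℓ' : ℤ} {x y : Path d} {m n : ℕ}
    (hx : FirstHit u ℓ x m) (hy : FirstHit u ℓ y n) (hl : ℓ < ℓ') :
    CommonFresh u (shift m x) (shift n y) ℓ' ↔ CommonFresh u x y ℓ' := by
  rw [commonFresh_iff, commonFresh_iff]
  constructor
  · rintro ⟨i, j, hi, hj⟩
    exact ⟨m + i, n + j, (hx.shift_iff hl).1 hi, (hy.shift_iff hl).1 hj⟩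
  · rintro ⟨i, j, hi, hj⟩
    obtain ⟨i, rfl⟩ := Nat.exists_eq_add_of_le (hx.lt_of_lt hi hl).le
    obtain ⟨j, rfl⟩ := Nat.exists_eq_add_of_le (hy.lt_of_lt hj hl).le
    exact ⟨i, j, (hx.shift_iff hl).2 hi, (hy.shift_iff hl).2 hj⟩

/-- Whether a level `ℓ' ≤ ℓ` is common fresh is determined by the paths up to the times at which
they hit `ℓ`. -/
theorem commonFresh_congr {d : ℕ} {u : Site d} {ℓ ℓ' : ℤ} {x y x' y' : Path d} {m n : ℕ}
    (hx : FirstHit u ℓ x m) (hy : FirstHit u ℓ y n) (hxx : ∀ i ≤ m, x i = x' i)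
    (hyy : ∀ i ≤ n, y i = y' i) (hl : ℓ' ≤ ℓ) :
    CommonFresh u x' y' ℓ' ↔ CommonFresh u x y ℓ' := by
  rw [commonFresh_iff, commonFresh_iff]
  constructor
  · rintro ⟨i, j, hi, hj⟩
    have h1 := hi.le_of_le (hx.congr hxx) hl
    have h2 := hj.le_of_le (hy.congr hyy) hl
    exact ⟨i, j, hi.congr fun k hk => (hxx k (hk.trans h1)).symm,
      hj.congr fun k hk => (hyy k (hk.trans h2)).symm⟩
  · rintro ⟨i, j, hi, hj⟩
    have h1 := hi.le_of_le hx hl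
    have h2 := hj.le_of_le hy hl
    exact ⟨i, j, hi.congr fun k hk => hxx k (hk.trans h1),
      hj.congr fun k hk => hyy k (hk.trans h2)⟩

theorem firstCommonFresh_eq_coe_iff {d : ℕ} {u : Site d} {a ℓ : ℤ} {x y : Path d} :
    firstCommonFresh u a x y = ℓ ↔ a ≤ ℓ ∧ CommonFresh u x y ℓ ∧
      ∀ ℓ', a ≤ ℓ' → ℓ' < ℓ → ¬ CommonFresh u x y ℓ' := by
  unfold firstCommonFresh
  have hbdd : BddBelow {ℓ : ℤ | a ≤ ℓ ∧ CommonFresh u x y ℓ} := ⟨a, fun ℓ h => h.1⟩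
  split_ifs with hex
  · have hmem := Int.csInf_mem (s := {ℓ : ℤ | a ≤ ℓ ∧ CommonFresh u x y ℓ}) hex hbdd
    rw [WithTop.coe_inj]
    constructor
    · rintro rfl
      refine ⟨hmem.1, hmem.2, fun ℓ' h1 h2 h3 => ?_⟩
      exact absurd (csInf_le hbdd ⟨h1, h3⟩) (not_le.2 h2)
    · rintro ⟨h1, h2, h3⟩
      refine le_antisymm (csInf_le hbdd ⟨h1, h2⟩) ?_
      by_contra h4
      exact h3 _ hmem.1 (not_le.1 h4) hmem.2
  · simp only [WithTop.top_ne_coe, false_iff]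
    rintro ⟨h1, h2, -⟩
    exact hex ⟨ℓ, h1, h2⟩

theorem exists_firstCommonFresh_le {d : ℕ} {u : Site d} {a ℓ : ℤ} {x y : Path d} (ha : a ≤ ℓ)
    (h : CommonFresh u x y ℓ) : ∃ ℓ' ≤ ℓ, firstCommonFresh u a x y = (ℓ' : ℤ) := by
  have hex : ∃ ℓ, a ≤ ℓ ∧ CommonFresh u x y ℓ := ⟨ℓ, ha, h⟩
  refine ⟨sInf {ℓ : ℤ | a ≤ ℓ ∧ CommonFresh u x y ℓ}, csInf_le ⟨a, fun ℓ h => h.1⟩ ⟨ha, h⟩, ?_⟩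
  rw [firstCommonFresh, if_pos hex]

/-- The pair of paths first backtracks at time `b`. -/
def BacktracksAt {d : ℕ} (u : Site d) (x y : Path d) (b : ℕ) : Prop :=
  (level u (x b) < level u (x 0) ∨ level u (y b) < level u (y 0)) ∧
    ∀ i < b, level u (x 0) ≤ level u (x i) ∧ level u (y 0) ≤ level u (y i)

theorem min_backtrackTime_eq_coe_iff {d : ℕ} {u : Site d} {x y : Path d} {b : ℕ} :
    min (backtrackTime u x) (backtrackTime u y) = b ↔ BacktracksAt u x y b := by
  rw [min_backtrackTime_eq, iInf_coe_eq_coe_iff, BacktracksAt]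
  simp only [not_or, not_lt]

theorem mem_noBacktrack_iff {d : ℕ} {u : Site d} {w : Path d × Path d} :
    w ∈ noBacktrack u ↔ ∀ n, level u (w.1 0) ≤ level u (w.1 n) ∧ level u (w.2 0) ≤ level u (w.2 n) := by
  simp only [noBacktrack, Set.mem_ofPred_eq, backtrackTime_eq_top_iff, forall_and]

theorem nextLevel_of_noBacktrack {d : ℕ} {h : ℤ} {u : Site d} {x y : Path d}
    (hxy : (x, y) ∈ noBacktrack u) : nextLevel h u x y = ⊤ := by
  have h1 : backtrackTime u x = ⊤ := hxy.1
  have h2 : backtrackTime u y = ⊤ := hxy.2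
  unfold nextLevel
  rw [h1, h2, min_self]
  rfl

theorem nextLevel_of_backtracksAt {d : ℕ} {h : ℤ} {u : Site d} {x y : Path d} {b : ℕ}
    (hb : BacktracksAt u x y b) : nextLevel h u x y
      = firstCommonFresh u (max (runMax u x b) (runMax u y b) + h) x y := by
  have h1 := min_backtrackTime_eq_coe_iff.2 hb
  unfold nextLevel
  rw [h1]

theorem exists_backtracksAt {d : ℕ} {u : Site d} {x y : Path d}
    (hxy : (x, y) ∉ noBacktrack u) : ∃ b, BacktracksAt u x y b := by
  have hne : min (backtrackTime u x) (backtrackTime u y) ≠ ⊤ := fun h => by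
    rw [min_eq_top] at h
    exact hxy h
  obtain ⟨b, hb⟩ := ENat.ne_top_iff_exists.1 hne
  exact ⟨b, min_backtrackTime_eq_coe_iff.1 hb.symm⟩

theorem level_le_runMax {d : ℕ} {u : Site d} {x : Path d} {i n : ℕ} (h : i ≤ n) :
    level u (x i) ≤ runMax u x n :=
  Finset.le_sup' (fun i => level u (x i)) (Finset.mem_range.2 (by omega))

theorem runMax_le {d : ℕ} {u : Site d} {x : Path d} {n : ℕ} {a : ℤ}
    (h : ∀ i ≤ n, level u (x i) ≤ a) : runMax u x n ≤ a :=
  Finset.sup'_le _ _ fun i hi => h i (by have := Finset.mem_range.1 hi; omega)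

theorem runMax_congr {d : ℕ} {u : Site d} {x x' : Path d} {n : ℕ} (h : ∀ i ≤ n, x i = x' i) :
    runMax u x n = runMax u x' n :=
  Finset.sup'_congr _ rfl fun i hi => by
    rw [h i (by have := Finset.mem_range.1 hi; omega)]

theorem freshLevel_succ_of_firstHit {d : ℕ} {h : ℤ} {u : Site d} {x y : Path d} {k : ℕ} {ℓ : ℤ}
    {m n : ℕ} (hk : freshLevel h u x y k = ℓ) (hx : FirstHit u ℓ x m) (hy : FirstHit u ℓ y n) :
    freshLevel h u x y (k + 1) = nextLevel h u (shift m x) (shift n y) := by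
  have h1 : hitTime u ℓ x = m := hitTime_eq_iff.2 hx.enters
  have h2 : hitTime u ℓ y = n := hitTime_eq_iff.2 hy.enters
  rw [freshLevel, hk]
  simp [h1, h2]

theorem freshLevel_succ_of_top {d : ℕ} {h : ℤ} {u : Site d} {x y : Path d} {k : ℕ}
    (hk : freshLevel h u x y k = ⊤) : freshLevel h u x y (k + 1) = ⊤ := by
  rw [freshLevel, hk]

theorem freshLevel_top_mono {d : ℕ} {h : ℤ} {u : Site d} {x y : Path d} {k l : ℕ} (hkl : k ≤ l)
    (hk : freshLevel h u x y k = ⊤) : freshLevel h u x y l = ⊤ := by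
  induction l, hkl using Nat.le_induction with
  | base => exact hk
  | succ l _ ih => exact freshLevel_succ_of_top ih

theorem exists_freshLevel_of_succ {d : ℕ} {h : ℤ} {u : Site d} {x y : Path d} {k : ℕ} {ℓ : ℤ}
    (hk : freshLevel h u x y (k + 1) = ℓ) : ∃ ℓ' : ℤ, freshLevel h u x y k = ℓ' := by
  cases hk' : freshLevel h u x y k with
  | top => rw [freshLevel_succ_of_top hk'] at hk; simp at hk
  | coe a => exact ⟨a, rfl⟩

/-- One step of the recursion, unfolded: the pair of paths restarted at the common fresh level `ℓ₀`
backtracks, and `ℓ` is the first common fresh level beyond the excursion. -/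
theorem nextLevel_shift_eq_coe {d : ℕ} {h : ℤ} (hh : 1 ≤ h) {u : Site d} {x y : Path d} {ℓ₀ ℓ : ℤ}
    {m n : ℕ} (hx : FirstHit u ℓ₀ x m) (hy : FirstHit u ℓ₀ y n)
    (hl : nextLevel h u (shift m x) (shift n y) = ℓ) :
    ℓ₀ + h ≤ ℓ ∧ CommonFresh u x y ℓ ∧ ∃ b, BacktracksAt u (shift m x) (shift n y) b ∧
      firstCommonFresh u (max (runMax u (shift m x) b) (runMax u (shift n y) b) + h)
        (shift m x) (shift n y) = ℓ := by
  by_cases hnb : (shift m x, shift n y) ∈ noBacktrack u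
  · rw [nextLevel_of_noBacktrack hnb] at hl; simp at hl
  obtain ⟨b, hb⟩ := exists_backtracksAt hnb
  rw [nextLevel_of_backtracksAt hb] at hl
  have h1 := firstCommonFresh_eq_coe_iff.1 hl
  have h2 : level u (shift m x 0) ≤ runMax u (shift m x) b := level_le_runMax (Nat.zero_le _)
  have h3 : level u (shift m x 0) = ℓ₀ := hx.1
  have h4 : ℓ₀ + h ≤ ℓ := by
    have := h1.1
    have := le_max_left (runMax u (shift m x) b) (runMax u (shift n y) b)
    omega
  exact ⟨h4, (commonFresh_shift_iff hx hy (by omega)).1 h1.2.1, b, hb, hl⟩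

theorem freshLevel_spec {d : ℕ} {h : ℤ} (hh : 1 ≤ h) {u : Site d} {x y : Path d} {k : ℕ} {ℓ : ℤ}
    (hk : freshLevel h u x y k = ℓ) : level u (x 0) + h ≤ ℓ ∧ CommonFresh u x y ℓ := by
  induction k generalizing ℓ with
  | zero =>
    have := firstCommonFresh_eq_coe_iff.1 hk
    exact ⟨this.1, this.2.1⟩
  | succ k ih =>
    obtain ⟨ℓ', hℓ'⟩ := exists_freshLevel_of_succ hk
    obtain ⟨h1, h2⟩ := ih hℓ'
    obtain ⟨m, n, hm, hn⟩ := commonFresh_iff.1 h2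
    rw [freshLevel_succ_of_firstHit hℓ' hm hn] at hk
    obtain ⟨h3, h4, -⟩ := nextLevel_shift_eq_coe hh hm hn hk
    exact ⟨by omega, h4⟩

/-- `freshLevel k = ℓ` is determined by the two paths up to the times at which they hit `ℓ`. -/
theorem freshLevel_congr {d : ℕ} {h : ℤ} (hh : 1 ≤ h) {u : Site d} {x y x' y' : Path d} {k : ℕ}
    {ℓ : ℤ} {m n : ℕ} (hk : freshLevel h u x y k = ℓ) (hx : FirstHit u ℓ x m)
    (hy : FirstHit u ℓ y n) (hxx : ∀ i ≤ m, x i = x' i) (hyy : ∀ i ≤ n, y i = y' i) :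
    freshLevel h u x' y' k = ℓ := by
  induction k generalizing ℓ m n with
  | zero =>
    have h1 := firstCommonFresh_eq_coe_iff.1 hk
    refine firstCommonFresh_eq_coe_iff.2 ⟨?_, ?_, fun ℓ' h2 h3 => ?_⟩
    · rw [← hxx 0 (Nat.zero_le _)]; exact h1.1
    · rw [commonFresh_congr hx hy hxx hyy le_rfl]; exact h1.2.1
    · rw [← hxx 0 (Nat.zero_le _)] at h2
      rw [commonFresh_congr hx hy hxx hyy h3.le]; exact h1.2.2 ℓ' h2 h3
  | succ k ih =>
    obtain ⟨ℓ₀, hℓ₀⟩ := exists_freshLevel_of_succ hk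
    obtain ⟨m₀, n₀, hm₀, hn₀⟩ := commonFresh_iff.1 (freshLevel_spec hh hℓ₀).2
    rw [freshLevel_succ_of_firstHit hℓ₀ hm₀ hn₀] at hk
    obtain ⟨h1, h2, b, hb, hl⟩ := nextLevel_shift_eq_coe hh hm₀ hn₀ hk
    have hml := hm₀.lt_of_lt hx (by omega)
    have hnl := hn₀.lt_of_lt hy (by omega)
    have hxx₀ : ∀ i ≤ m₀, x i = x' i := fun i hi => hxx i (by omega)
    have hyy₀ : ∀ i ≤ n₀, y i = y' i := fun i hi => hyy i (by omega)
    rw [freshLevel_succ_of_firstHit (ih hℓ₀ hm₀ hn₀ hxx₀ hyy₀) (hm₀.congr hxx₀) (hn₀.congr hyy₀)]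
    have hle := (firstCommonFresh_eq_coe_iff.1 hl).1
    obtain ⟨m₁, rfl⟩ := Nat.exists_eq_add_of_le hml.le
    obtain ⟨n₁, rfl⟩ := Nat.exists_eq_add_of_le hnl.le
    -- The level `ℓ` exceeds the maxima up to the backtracking time `b` by at least `h ≥ 1`, so `b`
    -- precedes the hitting times of `ℓ`. The whole excursion is thus visible in the initial
    -- segments.
    have hbm : b ≤ m₁ := by
      by_contra hcon
      have : level u (shift m₀ x m₁) ≤ runMax u (shift m₀ x) b := level_le_runMax (by omega)
      have h3 : level u (shift m₀ x m₁) = ℓ := hx.1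
      have := le_max_left (runMax u (shift m₀ x) b) (runMax u (shift n₀ y) b)
      omega
    have hbn : b ≤ n₁ := by
      by_contra hcon
      have : level u (shift n₀ y n₁) ≤ runMax u (shift n₀ y) b := level_le_runMax (by omega)
      have h3 : level u (shift n₀ y n₁) = ℓ := hy.1
      have := le_max_right (runMax u (shift m₀ x) b) (runMax u (shift n₀ y) b)
      omega
    have hxs : ∀ i ≤ m₁, shift m₀ x i = shift m₀ x' i := fun i hi => hxx (m₀ + i) (by omega)
    have hys : ∀ i ≤ n₁, shift n₀ y i = shift n₀ y' i := fun i hi => hyy (n₀ + i) (by omega)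
    have hb' : BacktracksAt u (shift m₀ x') (shift n₀ y') b := by
      refine ⟨?_, fun i hi => ?_⟩
      · rw [← hxs b hbm, ← hys b hbn, ← hxs 0 (Nat.zero_le _), ← hys 0 (Nat.zero_le _)]
        exact hb.1
      · rw [← hxs i (by omega), ← hys i (by omega), ← hxs 0 (Nat.zero_le _),
          ← hys 0 (Nat.zero_le _)]
        exact hb.2 i hi
    rw [nextLevel_of_backtracksAt hb',
      ← runMax_congr (x := shift m₀ x) fun i hi => hxs i (hi.trans hbm),
      ← runMax_congr (x := shift n₀ y) fun i hi => hys i (hi.trans hbn)]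
    have h3 := firstCommonFresh_eq_coe_iff.1 hl
    have hx' : FirstHit u ℓ (shift m₀ x) m₁ := (hm₀.shift_iff (by omega)).2 hx
    have hy' : FirstHit u ℓ (shift n₀ y) n₁ := (hn₀.shift_iff (by omega)).2 hy
    refine firstCommonFresh_eq_coe_iff.2 ⟨h3.1, ?_, fun ℓ' h4 h5 => ?_⟩
    · rw [commonFresh_congr hx' hy' hxs hys le_rfl]; exact h3.2.1
    · rw [commonFresh_congr hx' hy' hxs hys h5.le]; exact h3.2.2 ℓ' h4 h5

theorem freshLevel_le_of_le {d : ℕ} {h : ℤ} (hh : 1 ≤ h) {u : Site d} {x y : Path d} {j k : ℕ}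
    {ℓ' ℓ : ℤ} (hjk : j ≤ k) (hj : freshLevel h u x y j = ℓ') (hk : freshLevel h u x y k = ℓ) :
    ℓ' ≤ ℓ := by
  induction k, hjk using Nat.le_induction generalizing ℓ with
  | base => rw [hj] at hk; exact (WithTop.coe_inj.1 hk).le
  | succ k _ ih =>
    obtain ⟨ℓ₀, hℓ₀⟩ := exists_freshLevel_of_succ hk
    obtain ⟨m₀, n₀, hm₀, hn₀⟩ := commonFresh_iff.1 (freshLevel_spec hh hℓ₀).2
    rw [freshLevel_succ_of_firstHit hℓ₀ hm₀ hn₀] at hk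
    have := (nextLevel_shift_eq_coe hh hm₀ hn₀ hk).1
    have := ih hℓ₀
    omega

theorem jointLevel_eq_coe_iff {d : ℕ} {h : ℤ} {u : Site d} {x y : Path d} {ℓ : ℤ} :
    jointLevel h u x y = ℓ ↔ (∃ n, freshLevel h u x y n = ℓ) ∧
      ∀ (n : ℕ) (ℓ' : ℤ), freshLevel h u x y n = ℓ' → ℓ' ≤ ℓ := by
  unfold jointLevel
  split_ifs with hS
  · have hmem := Int.csSup_mem hS.1 hS.2
    rw [WithTop.coe_inj]
    constructor
    · rintro rfl
      exact ⟨hmem, fun n ℓ' hn => le_csSup hS.2 ⟨n, hn⟩⟩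
    · rintro ⟨h1, h2⟩
      exact le_antisymm (csSup_le hS.1 fun ℓ' ⟨n, hn⟩ => h2 n ℓ' hn) (le_csSup hS.2 h1)
  · simp only [WithTop.top_ne_coe, false_iff]
    rintro ⟨h1, h2⟩
    exact hS ⟨⟨ℓ, h1⟩, ⟨ℓ, fun ℓ' ⟨n, hn⟩ => h2 n ℓ' hn⟩⟩

/-- The two paths have their first joint regeneration at the times `m` and `n`. -/
def JointRegen {d : ℕ} (h : ℤ) (u : Site d) (w : Path d × Path d) (m n : ℕ) : Prop :=
  ∃ (k : ℕ) (ℓ : ℤ), freshLevel h u w.1 w.2 k = ℓ ∧ FirstHit u ℓ w.1 m ∧ FirstHit u ℓ w.2 n ∧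
    shift₂ m n w ∈ noBacktrack u

/-- After a level from which neither path backtracks the recursion stops, and the earlier levels are
no larger, so this level is the supremum `Λ`. -/
theorem JointRegen.mem_jointDiffEq {d : ℕ} {h : ℤ} (hh : 1 ≤ h) {u : Site d} {w : Path d × Path d}
    {m n : ℕ} (hw : JointRegen h u w m n) (y : Site d) :
    w ∈ jointDiffEq h u y ↔ w.2 n - w.1 m = y := by
  obtain ⟨k, ℓ, hk, hm, hn, hnb⟩ := hw
  have htop : freshLevel h u w.1 w.2 (k + 1) = ⊤ := by
    rw [freshLevel_succ_of_firstHit hk hm hn]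
    exact nextLevel_of_noBacktrack hnb
  have hj : jointLevel h u w.1 w.2 = ℓ := by
    refine jointLevel_eq_coe_iff.2 ⟨⟨k, hk⟩, fun n ℓ' hn => ?_⟩
    rcases le_or_gt n k with hnk | hnk
    · exact freshLevel_le_of_le hh hnk hn hk
    · rw [freshLevel_top_mono hnk htop] at hn
      simp at hn
  constructor
  · rintro ⟨ℓ', m', n', h1, h2, h3, h4⟩
    rw [hj] at h1
    obtain rfl := WithTop.coe_inj.1 h1
    rw [(hitTime_eq_iff.1 h2).unique hm.enters, (hitTime_eq_iff.1 h3).unique hn.enters] at h4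
    exact h4
  · rintro rfl
    exact ⟨ℓ, m, n, hj, hitTime_eq_iff.2 hm.enters, hitTime_eq_iff.2 hn.enters, rfl⟩

/-- The path `x`, frozen from time `N` on. -/
def freeze {d : ℕ} (N : ℕ) (x : Path d) : Path d := fun i => x (min i N)

theorem freeze_of_le {d : ℕ} {N i : ℕ} (x : Path d) (h : i ≤ N) : freeze N x i = x i := by
  simp [freeze, h]

/-- The fresh level is determined by the paths up to `m` and `n`, and every later value of a frozen
path is a value of the original path after its regeneration time. This is what turns the
displacement into a function of finitely many steps. -/
theorem JointRegen.freeze {d : ℕ} {h : ℤ} (hh : 1 ≤ h) {u : Site d} {w : Path d × Path d}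
    {m n N : ℕ} (hw : JointRegen h u w m n) (hm : m ≤ N) (hn : n ≤ N) :
    JointRegen h u (freeze N w.1, freeze N w.2) m n := by
  obtain ⟨k, ℓ, hk, hm', hn', hnb⟩ := hw
  have hxx : ∀ i ≤ m, w.1 i = RWRE.freeze N w.1 i := fun i hi =>
    (freeze_of_le _ (hi.trans hm)).symm
  have hyy : ∀ i ≤ n, w.2 i = RWRE.freeze N w.2 i := fun i hi =>
    (freeze_of_le _ (hi.trans hn)).symm
  refine ⟨k, ℓ, freshLevel_congr hh hk hm' hn' hxx hyy, hm'.congr hxx, hn'.congr hyy, ?_⟩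
  rw [mem_noBacktrack_iff] at hnb ⊢
  intro i
  have h1 := (hnb (min (m + i) N - m)).1
  have h2 := (hnb (min (n + i) N - n)).2
  simp only [shift₂, shift] at h1 h2 ⊢
  rw [← hxx (m + 0) (by omega), ← hyy (n + 0) (by omega)]
  have e1 : m + (min (m + i) N - m) = min (m + i) N := by omega
  have e2 : n + (min (n + i) N - n) = min (n + i) N := by omega
  rw [e1] at h1
  rw [e2] at h2
  exact ⟨h1, h2⟩

/-! ### From single regenerations to a joint regeneration, for deterministic paths -/

/-- The path `x` hits the level `n` freshly at time `t` and stays above it afterwards. -/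
def RegenAt {d : ℕ} (u : Site d) (n : ℤ) (x : Path d) (t : ℕ) : Prop :=
  FirstHit u n x t ∧ ∀ j, n ≤ level u (x (t + j))

theorem regenTime_le_iff {d : ℕ} {u : Site d} {x : Path d} {g : ℕ} :
    regenTime u x ≤ g ↔ ∃ j ≤ g, 1 ≤ j ∧ (∀ m < j, level u (x m) < level u (x j)) ∧
      ∀ m, j ≤ m → level u (x j) ≤ level u (x m) := by
  constructor
  · intro h
    obtain ⟨j, hj⟩ := ENat.ne_top_iff_exists.1 (ne_top_of_le_ne_top (ENat.natCast_ne_top g) h)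
    refine ⟨j, ?_, (iInf_coe_eq_coe_iff.1 hj.symm).1⟩
    rw [← hj] at h
    exact_mod_cast h
  · rintro ⟨j, hj, hj'⟩
    exact (iInf₂_le j hj').trans (by exact_mod_cast hj)

theorem RegenAt.next {d : ℕ} {u : Site d} {n : ℤ} {x : Path d} {t g : ℕ} (h : RegenAt u n x t)
    (hg : regenTime u (shift t x) ≤ g) : ∃ j ≤ g, ∃ n' > n, RegenAt u n' x (t + j) := by
  obtain ⟨j, hj, hj1, h1, h2⟩ := regenTime_le_iff.1 hg
  have h0 : n < level u (x (t + j)) := by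
    have := h1 0 hj1
    rw [← h.1.1]; exact this
  refine ⟨j, hj, level u (x (t + j)), h0, ⟨rfl, fun i hi => ?_⟩, fun i => ?_⟩
  · rcases lt_or_ge i t with hit | hit
    · exact (h.1.2 i hit).trans h0
    · obtain ⟨k, rfl⟩ := Nat.exists_eq_add_of_le hit
      exact h1 k (by omega)
  · have := h2 (j + i) (by omega)
    simp only [shift] at this
    rwa [← add_assoc] at this

/-- If all regenerations below level `K` are followed by another one within `g` steps, then there
are regenerations shortly after each entrance time. -/
theorem exists_regenAt {d : ℕ} {u : Site d} {x : Path d} {g K : ℕ} (h0 : RegenAt u 0 x 0)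
    (hg : ∀ n < K, ∀ t, RegenAt u (n : ℤ) x t → regenTime u (shift t x) ≤ g) (n : ℕ) (hn : n ≤ K) :
    ∃ (n' : ℤ) (t : ℕ), (n : ℤ) ≤ n' ∧ RegenAt u n' x t ∧ t ≤ n * g ∧
      ∀ s, Enters u n x s → t ≤ s + g := by
  induction n with
  | zero => exact ⟨0, 0, le_rfl, h0, Nat.zero_le _, fun s _ => Nat.zero_le _⟩
  | succ n ih =>
    obtain ⟨n', t, hn', ht, htg, hs⟩ := ih (by omega)
    -- A regeneration strictly above `n` also serves level `n + 1`. One exactly at level `n` is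
    -- replaced by the next, at most `g` steps later, and any entrance into level `n + 1` comes no
    -- earlier than the old one.
    rcases hn'.lt_or_eq with hlt | rfl
    · refine ⟨n', t, by push_cast; omega, ht, htg.trans (Nat.mul_le_mul_right _ (by omega)), ?_⟩
      intro s hs'
      obtain ⟨s', hs1, hs2⟩ := exists_enters (x := x) (u := u) (ℓ := (n : ℤ)) (m := s)
        (by have := hs'.1; push_cast at this; omega)
      exact (hs s' hs2).trans (by omega)
    · obtain ⟨j, hj, n', hn', hr⟩ := ht.next (hg n (by omega) t ht)
      refine ⟨n', t + j, by push_cast; omega, hr, by rw [Nat.succ_mul]; omega, fun s hs' => ?_⟩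
      have : t ≤ s := by
        by_contra hst
        have h1 := ht.1.2 s (not_le.1 hst)
        have h2 := hs'.1
        push_cast at h2
        omega
      omega

/-- A deterministic criterion for a joint regeneration before time `T`. -/
theorem exists_jointRegen {d : ℕ} {h : ℕ} (hh : 1 ≤ h) {u : Site d} {x y : Path d}
    {R g W K D T : ℕ}
    (hx0 : level u (x 0) = 0)
    (hRx : ∀ i, level u (x (i + 1)) ≤ level u (x i) + R)
    (hRy : ∀ i, level u (y (i + 1)) ≤ level u (y i) + R)
    (hbx : ∀ n ≤ D, ∀ m b, FirstHit u (n : ℤ) x m → level u (x (m + b)) < n →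
      b ≤ g)
    (hby : ∀ n ≤ D, ∀ m b, FirstHit u (n : ℤ) y m → level u (y (m + b)) < n →
      b ≤ g)
    (hTx : ∀ n ≤ D, ∀ m, FirstHit u (n : ℤ) x m → m ≤ T)
    (hTy : ∀ n ≤ D, ∀ m, FirstHit u (n : ℤ) y m → m ≤ T)
    (hW : ∀ n ≤ D, ∃ ℓ : ℤ, n ≤ ℓ ∧ ℓ ≤ n + W ∧ CommonFresh u x y ℓ)
    (hK : freshLevel h u x y K = ⊤) (hD : (K + 1) * (R * g + h + W) ≤ D) :
    ∃ m ≤ T, ∃ n ≤ T, JointRegen h u (x, y) m n := by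
  have hh' : (1 : ℤ) ≤ h := by exact_mod_cast hh
  have hgrow : ∀ {x : Path d}, (∀ i, level u (x (i + 1)) ≤ level u (x i) + R) → ∀ m i,
      level u (shift m x i) ≤ level u (x m) + R * i := by
    intro x hx m i
    induction i with
    | zero => simp [shift]
    | succ i ih =>
      have := hx (m + i)
      simp only [shift] at ih ⊢
      push_cast
      rw [← add_assoc]
      linarith
  -- Cost of a failed attempt: backtracking occurs within `g` steps, during which both paths rise by
  -- at most `R * g`; then the margin `h` is added, and a common fresh level appears within `W`
  -- further levels.
  have step : ∀ (k ℓ m n : ℕ), freshLevel h u x y k = ((ℓ : ℤ) : WithTop ℤ) →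
      FirstHit u (ℓ : ℤ) x m → FirstHit u (ℓ : ℤ) y n → (shift m x, shift n y) ∉ noBacktrack u →
      ℓ + (R * g + h + W) ≤ D → ∃ ℓ' : ℕ, freshLevel h u x y (k + 1) = ((ℓ' : ℤ) : WithTop ℤ) ∧
        ℓ' ≤ ℓ + (R * g + h + W) := by
    intro k ℓ m n hℓ hm hn hnb hℓD
    obtain ⟨b, hb⟩ := exists_backtracksAt hnb
    have hbg : b ≤ g := by
      rcases hb.1 with h1 | h1
      · exact hbx ℓ (by omega) m b hm (by rw [← hm.1]; exact h1)
      · exact hby ℓ (by omega) n b hn (by rw [← hn.1]; exact h1)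
    have hmax : max (runMax u (shift m x) b) (runMax u (shift n y) b) ≤ ℓ + R * g := by
      have h1 : ∀ i ≤ b, (R : ℤ) * i ≤ R * g := fun i hi => by
        have : i ≤ g := hi.trans hbg
        gcongr
      refine max_le (runMax_le fun i hi => ?_) (runMax_le fun i hi => ?_)
      · have := hgrow hRx m i
        rw [hm.1] at this
        have := h1 i hi
        omega
      · have := hgrow hRy n i
        rw [hn.1] at this
        have := h1 i hi
        omega
    have hmin : (ℓ : ℤ) ≤ max (runMax u (shift m x) b) (runMax u (shift n y) b) := by
      refine le_trans ?_ (le_max_left _ _)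
      rw [← hm.1]
      exact level_le_runMax (x := shift m x) (Nat.zero_le b)
    obtain ⟨ℓ₁, h2, h3, h4⟩ := hW (ℓ + R * g + h) (by omega)
    push_cast at h2 h3
    have hRg : (0 : ℤ) ≤ R * g := by positivity
    have h5 := (commonFresh_shift_iff hm hn (by omega)).2 h4
    obtain ⟨ℓ', h6, h7⟩ := exists_firstCommonFresh_le
      (a := max (runMax u (shift m x) b) (runMax u (shift n y) b) + h) (by omega) h5
    have h8 := (firstCommonFresh_eq_coe_iff.1 h7).1
    lift ℓ' to ℕ using (by omega)
    refine ⟨ℓ', ?_, ?_⟩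
    · rw [freshLevel_succ_of_firstHit hℓ hm hn, nextLevel_of_backtracksAt hb]
      exact h7
    · have : (ℓ' : ℤ) ≤ ((ℓ + (R * g + h + W) : ℕ) : ℤ) := by push_cast; omega
      exact_mod_cast this
  -- Either the attempts continue within the budget of levels, or the index has passed `K` and
  -- nothing is claimed, or a joint regeneration has occurred. At `k = K` the first alternative
  -- contradicts `hK`, so the third remains.
  have key : ∀ k, (∃ ℓ : ℕ, freshLevel h u x y k = ((ℓ : ℤ) : WithTop ℤ) ∧
      ℓ ≤ (k + 1) * (R * g + h + W)) ∨ K < k ∨ ∃ m ≤ T, ∃ n ≤ T, JointRegen h u (x, y) m n := by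
    intro k
    induction k with
    | zero =>
      left
      have h1 : h ≤ D := by
        refine le_trans ?_ hD
        calc h ≤ R * g + h + W := by omega
          _ ≤ _ := Nat.le_mul_of_pos_left _ (by omega)
      obtain ⟨ℓ, h2, h3, h4⟩ := hW h h1
      obtain ⟨ℓ', h5, h6⟩ := exists_firstCommonFresh_le (a := level u (x 0) + h) (by omega) h4
      have h7 := (firstCommonFresh_eq_coe_iff.1 h6).1
      lift ℓ' to ℕ using (by omega)
      refine ⟨ℓ', h6, ?_⟩
      have : ℓ' ≤ h + W := by omega
      rw [zero_add, one_mul]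
      omega
    | succ k ih =>
      rcases ih with ⟨ℓ, hℓ, hle⟩ | hk | hdone
      swap
      · exact Or.inr (Or.inl (by omega))
      swap
      · exact Or.inr (Or.inr hdone)
      by_cases hk : K ≤ k
      · exact Or.inr (Or.inl (by omega))
      have hle' : (k + 1 + 1) * (R * g + h + W) ≤ D :=
        le_trans (Nat.mul_le_mul_right _ (by omega)) hD
      rw [Nat.succ_mul] at hle'
      obtain ⟨m, n, hm, hn⟩ := commonFresh_iff.1 (freshLevel_spec hh' hℓ).2
      by_cases hnb : (shift m x, shift n y) ∈ noBacktrack u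
      · exact Or.inr (Or.inr
          ⟨m, hTx ℓ (by omega) m hm, n, hTy ℓ (by omega) n hn, k, ℓ, hℓ, hm, hn, hnb⟩)
      obtain ⟨ℓ', h1, h2⟩ := step k ℓ m n hℓ hm hn hnb (by omega)
      exact Or.inl ⟨ℓ', h1, by rw [Nat.succ_mul]; omega⟩
  rcases key K with ⟨ℓ, hℓ, -⟩ | hK' | hdone
  · rw [hK] at hℓ
    simp at hℓ
  · exact absurd hK' (lt_irrefl _)
  · exact hdone

/-! ## Measurability -/

theorem measurable_level {d : ℕ} (u : Site d) (n : ℕ) :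
    Measurable fun x : Path d => level u (x n) :=
  (measurable_of_countable (level u)).comp (measurable_pi_apply n)

theorem measurableSet_level_le {d : ℕ} (u : Site d) (m n : ℕ) :
    MeasurableSet {x : Path d | level u (x m) ≤ level u (x n)} :=
  measurableSet_le (measurable_level u m) (measurable_level u n)

theorem measurableSet_const_le_level {d : ℕ} (u : Site d) (L : ℤ) (n : ℕ) :
    MeasurableSet {x : Path d | L ≤ level u (x n)} :=
  measurableSet_le measurable_const (measurable_level u n)

/-- The paths that never go below their initial level. -/
def neverBelow {d : ℕ} (u : Site d) : Set (Path d) := {x | ∀ n, level u (x 0) ≤ level u (x n)}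

theorem measurableSet_neverBelow {d : ℕ} (u : Site d) : MeasurableSet (neverBelow u) := by
  have : neverBelow u = ⋂ n, {x : Path d | level u (x 0) ≤ level u (x n)} := by
    ext; simp [neverBelow]
  rw [this]
  exact MeasurableSet.iInter fun n => measurableSet_level_le u 0 n

theorem noBacktrack_eq_prod {d : ℕ} (u : Site d) :
    noBacktrack u = neverBelow u ×ˢ neverBelow u := by
  ext w
  rw [mem_noBacktrack_iff]
  simp only [neverBelow, Set.mem_prod, Set.mem_ofPred_eq, forall_and]

theorem measurableSet_noBacktrack {d : ℕ} (u : Site d) : MeasurableSet (noBacktrack u) := by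
  rw [noBacktrack_eq_prod]
  exact (measurableSet_neverBelow u).prod (measurableSet_neverBelow u)

/-- The paths whose first regeneration time exceeds `g`. -/
def lateRegen {d : ℕ} (u : Site d) (g : ℕ) : Set (Path d) := {x | (g : ℕ∞) < regenTime u x}

theorem measurableSet_lateRegen {d : ℕ} (u : Site d) (g : ℕ) : MeasurableSet (lateRegen u g) := by
  have : lateRegen u g = (⋃ j ∈ Set.Icc 1 g, (⋂ m, ⋂ (_ : m < j),
      {x : Path d | level u (x j) ≤ level u (x m)}ᶜ) ∩
      ⋂ m, ⋂ (_ : j ≤ m), {x : Path d | level u (x j) ≤ level u (x m)})ᶜ := by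
    ext x
    rw [Set.mem_compl_iff, lateRegen, Set.mem_ofPred_eq, ← not_le, regenTime_le_iff, not_iff_not]
    simp only [Set.mem_iUnion, Set.mem_Icc, Set.mem_inter_iff, Set.mem_iInter, Set.mem_compl_iff,
      Set.mem_ofPred_eq, not_le, exists_prop]
    exact exists_congr fun j => by tauto
  rw [this]
  refine (MeasurableSet.biUnion (Set.to_countable _) fun j _ => MeasurableSet.inter ?_ ?_).compl
  · exact MeasurableSet.iInter fun m => MeasurableSet.iInter fun _ =>
      (measurableSet_level_le u j m).compl
  · exact MeasurableSet.iInter fun m => MeasurableSet.iInter fun _ => measurableSet_level_le u j m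

/-! ## The support of the steps -/

/-- The steps that the walk takes with positive probability. -/
def steps {d : ℕ} (ν : Measure (ProbVec d)) : Set (Site d) := {z | ∫⁻ p, p.1 z ∂ν ≠ 0}

theorem lintegral_env_apply {d : ℕ} (ν : Measure (ProbVec d)) [IsProbabilityMeasure ν]
    (x z : Site d) : ∫⁻ ω, (ω x).1 z ∂(envLaw ν) = ∫⁻ p, p.1 z ∂ν := by
  have h := measurePreserving_eval_infinitePi (fun _ : Site d => ν) x
  have hm : Measurable fun p : ProbVec d => p.1 z :=
    (measurable_pi_apply z).comp measurable_subtype_coe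
  exact h.lintegral_comp hm

theorem env_apply_le_one {d : ℕ} (ω : Env d) (x z : Site d) : (ω x).1 z ≤ 1 :=
  (ENNReal.le_tsum z).trans (ω x).2.le

theorem weight_le_apply {d : ℕ} (ω : Env d) {m i : ℕ} (a : Path d) (hi : i < m) :
    weight ω m a ≤ (ω (a i)).1 (a (i + 1) - a i) := by
  rw [weight, ← Finset.mul_prod_erase _ _ (Finset.mem_range.2 hi)]
  refine mul_le_of_le_one_right' (Finset.prod_le_one' fun j _ => env_apply_le_one ω _ _)

theorem lintegral_weight_eq_zero {d : ℕ} (ν : Measure (ProbVec d)) [IsProbabilityMeasure ν]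
    {m i : ℕ} {a : Path d} (hi : i < m) (h : a (i + 1) - a i ∉ steps ν) :
    ∫⁻ ω, weight ω m a ∂(envLaw ν) = 0 := by
  refine le_antisymm ?_ zero_le
  calc ∫⁻ ω, weight ω m a ∂(envLaw ν)
      ≤ ∫⁻ ω, (ω (a i)).1 (a (i + 1) - a i) ∂(envLaw ν) :=
        lintegral_mono fun ω => weight_le_apply ω a hi
    _ = 0 := by
        rw [lintegral_env_apply]
        simpa [steps] using h

/-- The paths that start at `z` and only take steps of positive probability. -/
def goodPaths {d : ℕ} (ν : Measure (ProbVec d)) (z : Site d) : Set (Path d) :=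
  {x | x 0 = z ∧ ∀ i, x (i + 1) - x i ∈ steps ν}

/-- A violation is visible on a finite cylinder with the wrong starting point or with a step of
averaged probability zero; such cylinders are null, and there are countably many. -/
theorem avg_goodPaths_compl {d : ℕ} (ν : Measure (ProbVec d)) [IsProbabilityMeasure ν]
    (z : Site d) : avg ν z (goodPaths ν z)ᶜ = 0 := by
  have hsub : (goodPaths ν z)ᶜ ⊆ {x : Path d | x 0 ≠ z} ∪
      ⋃ i, {x : Path d | x 0 = z ∧ x (i + 1) - x i ∉ steps ν} := by
    intro x hx
    by_cases h0 : x 0 = z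
    · right
      have : ¬ ∀ i, x (i + 1) - x i ∈ steps ν := fun h => hx ⟨h0, h⟩
      obtain ⟨i, hi⟩ := not_forall.1 this
      exact Set.mem_iUnion.2 ⟨i, h0, hi⟩
    · exact Or.inl h0
  refine measure_mono_null hsub (measure_union_null ?_ (measure_iUnion_null fun i => ?_))
  · refine le_antisymm ?_ zero_le
    have := measure_le_of_fibers (measurable_seg (d := d) 0) (μ₁ := avg ν z) (μ₂ := 0)
      (S := {x : Path d | x 0 ≠ z}) (T := Set.univ) fun x => ?_
    · simpa using this
    rw [seg_preimage]
    by_cases h0 : x 0 = z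
    · have : cyl 0 x ∩ {x : Path d | x 0 ≠ z} = ∅ := by
        ext x'
        simp only [Set.mem_inter_iff, Set.mem_ofPred_eq, Set.mem_empty_iff_false, iff_false,
          not_and, not_not]
        exact fun h => (h 0 le_rfl).trans h0
      rw [this]; simp
    · rw [measure_mono_null Set.inter_subset_left (avg_cyl_of_ne ν 0 h0)]
      exact zero_le
  · refine le_antisymm ?_ zero_le
    have := measure_le_of_fibers (measurable_seg (d := d) (i + 1)) (μ₁ := avg ν z) (μ₂ := 0)
      (S := {x : Path d | x 0 = z ∧ x (i + 1) - x i ∉ steps ν}) (T := Set.univ) fun x => ?_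
    · simpa using this
    rw [seg_preimage]
    by_cases h0 : x 0 = z ∧ x (i + 1) - x i ∉ steps ν
    · obtain ⟨rfl, h⟩ := h0
      refine (measure_mono Set.inter_subset_left).trans ?_
      rw [avg_cyl, lintegral_weight_eq_zero ν (Nat.lt_succ_self i) h]
      exact zero_le
    · have : cyl (i + 1) x ∩ {x : Path d | x 0 = z ∧ x (i + 1) - x i ∉ steps ν} = ∅ := by
        ext x'
        simp only [Set.mem_inter_iff, Set.mem_ofPred_eq, Set.mem_empty_iff_false, iff_false,
          not_and, not_not]
        intro h h1
        rw [h 0 (Nat.zero_le _)] at h1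
        rw [h (i + 1) le_rfl, h i (Nat.le_succ i)]
        by_contra h2
        exact h0 ⟨h1, h2⟩
      rw [this]; simp

theorem FreshLaw.ae_goodPaths {d : ℕ} {ν : Measure (ProbVec d)} [IsProbabilityMeasure ν]
    {u : Site d} {P : Site d → Site d → Measure (Path d × Path d)} (hP : FreshLaw ν u P)
    (x y : Site d) : P x y (goodPaths ν x ×ˢ goodPaths ν y)ᶜ = 0 := by
  have hm : ∀ z : Site d, ∃ T : Set (Path d), (goodPaths ν z)ᶜ ⊆ T ∧ MeasurableSet T ∧
      avg ν z T = 0 := fun z => by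
    obtain ⟨T, h1, h2, h3⟩ := exists_measurable_superset (avg ν z) (goodPaths ν z)ᶜ
    exact ⟨T, h1, h2, h3.trans (avg_goodPaths_compl ν z)⟩
  obtain ⟨T, h1, h2, h3⟩ := hm x
  obtain ⟨T', h1', h2', h3'⟩ := hm y
  have hsub : (goodPaths ν x ×ˢ goodPaths ν y)ᶜ ⊆ T ×ˢ Set.univ ∪ Set.univ ×ˢ T' := by
    intro w hw
    rw [Set.mem_compl_iff, Set.mem_prod, not_and_or] at hw
    rcases hw with hw | hw
    · exact Or.inl ⟨h1 hw, trivial⟩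
    · exact Or.inr ⟨trivial, h1' hw⟩
  refine measure_mono_null hsub (measure_union_null ?_ ?_)
  · rw [hP.fst x y h2, h3]
  · rw [hP.snd x y h2', h3']

/-- Uniform bound on the coordinates and on the level of a step. -/
def StepBound {d : ℕ} (ν : Measure (ProbVec d)) (u : Site d) (R : ℕ) : Prop :=
  ∀ z ∈ steps ν, (∀ i, |z i| ≤ R) ∧ |level u z| ≤ R

theorem abs_le_eucNorm {d : ℕ} (z : Site d) (i : Fin d) : (|z i| : ℝ) ≤ eucNorm z := by
  rw [eucNorm]
  refine Real.le_sqrt_of_sq_le ?_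
  rw [sq_abs]
  exact Finset.single_le_sum (f := fun i => ((z i : ℝ)) ^ 2) (fun i _ => sq_nonneg _)
    (Finset.mem_univ i)

theorem exists_stepBound {d : ℕ} (ν : Measure (ProbVec d)) [IsProbabilityMeasure ν] (u : Site d)
    (hsteps : ∃ M : ℝ, 0 < M ∧ ∀ z : Site d, M < eucNorm z →
      ∀ᵐ ω ∂(envLaw ν), (ω 0).1 z = 0) : ∃ R : ℕ, StepBound ν u R := by
  obtain ⟨M, hM, h⟩ := hsteps
  -- The first summand bounds the coordinates of a step, the second its level.
  refine ⟨⌈M⌉₊ + ⌈M⌉₊ * ∑ i, (u i).natAbs, fun z hz => ?_⟩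
  have h1 : eucNorm z ≤ M := by
    by_contra hlt
    have h2 := h z (not_le.1 hlt)
    apply hz
    rw [← lintegral_env_apply ν 0 z, lintegral_congr_ae h2]
    simp
  have h3 : ∀ i, |z i| ≤ (⌈M⌉₊ : ℤ) := fun i => by
    have := (abs_le_eucNorm z i).trans (h1.trans (Nat.le_ceil M))
    exact_mod_cast this
  refine ⟨fun i => (h3 i).trans ?_, ?_⟩
  · push_cast
    exact le_add_of_nonneg_right (by positivity)
  · calc |level u z| ≤ ∑ i, |z i * u i| := by
          rw [level, dotProduct]
          exact Finset.abs_sum_le_sum_abs _ _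
      _ ≤ ∑ i, (⌈M⌉₊ : ℤ) * (u i).natAbs := by
          refine Finset.sum_le_sum fun i _ => ?_
          rw [abs_mul, Int.natCast_natAbs]
          exact mul_le_mul_of_nonneg_right (h3 i) (abs_nonneg _)
      _ ≤ _ := by
          rw [← Finset.mul_sum]
          push_cast
          exact le_add_of_nonneg_left (by positivity)

theorem level_add {d : ℕ} (u x y : Site d) : level u (x + y) = level u x + level u y :=
  add_dotProduct x y u

theorem level_sub {d : ℕ} (u x y : Site d) : level u (x - y) = level u x - level u y :=
  sub_dotProduct x y u

theorem StepBound.level_succ_le {d : ℕ} {ν : Measure (ProbVec d)} {u : Site d} {R : ℕ}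
    (hR : StepBound ν u R) {x : Path d} {i : ℕ} (hx : x (i + 1) - x i ∈ steps ν) :
    level u (x (i + 1)) ≤ level u (x i) + R := by
  have := (le_abs_self _).trans (hR _ hx).2
  rw [level_sub] at this
  omega

/-! ## Regeneration estimates for one walk -/

theorem regenTime_translate {d : ℕ} (u z : Site d) (x : Path d) :
    regenTime u (fun i => z + x i) = regenTime u x := by
  simp only [regenTime, level_add, add_lt_add_iff_left, add_le_add_iff_left]

/-- If the walk never goes below its initial level, or does so only late, its first regeneration is
late. -/
theorem lateRegen_of_late_backtrack {d : ℕ} {u : Site d} {N : ℕ} {x : Path d}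
    (h1 : ∀ i ≤ N, level u (x 0) ≤ level u (x i)) (h2 : x ∉ neverBelow u) :
    x ∈ lateRegen u N := by
  rw [lateRegen, Set.mem_ofPred_eq, ← not_le, regenTime_le_iff]
  rintro ⟨j, hj, hj1, h3, h4⟩
  apply h2
  intro n
  rcases le_or_gt n N with hn | hn
  · exact h1 n hn
  · exact (h3 0 hj1).le.trans (h4 n (by omega))

/-- The time of the first hit is unique, so the events are disjoint. Thanks to this bound, summing
over hitting times costs no factor in the renewal estimates. -/
theorem tsum_avg_firstHit_le {d : ℕ} (ν : Measure (ProbVec d)) [IsProbabilityMeasure ν]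
    (u z : Site d) (n : ℤ) : ∑' t, avg ν z {x | FirstHit u n x t} ≤ 1 := by
  have hm : ∀ t, MeasurableSet {x : Path d | FirstHit u n x t} := fun t =>
    measurableSet_of_determined (measurable_seg t) fun x x' h hx =>
      FirstHit.congr hx (seg_eq_iff.1 h)
  rw [← measure_iUnion _ hm]
  · exact prob_le_one
  · intro s t hst
    refine Set.disjoint_left.2 fun x hx hx' => hst ?_
    exact (FirstHit.enters hx).unique (FirstHit.enters hx')

/-- A bound for the probability that a property holds for the walk restarted at its first hit of the
level `n`, and the restarted walk stays above `n`. -/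
theorem avg_regenAt_le {d : ℕ} (ν : Measure (ProbVec d)) [IsProbabilityMeasure ν] (u z : Site d)
    (n : ℤ) {B : Set (Path d)} (hB : MeasurableSet B)
    (hBt : ∀ (z : Site d) (x : Path d), (fun i => z + x i) ∈ B → x ∈ B) :
    avg ν z {x | ∃ t, RegenAt u n x t ∧ shift t x ∈ B} ≤ avg ν 0 (neverBelow u ∩ B) := by
  -- Renewal applies to events that stay above a fixed level; for a path starting at level `n` the
  -- set `B'` expresses never going below the start. By translation its probability is bounded by
  -- the same number from every site.
  set B' : Set (Path d) := {x | level u (x 0) = n} ∩ (⋂ k, {x | n ≤ level u (x k)}) ∩ B with hB'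
  have hB'm : MeasurableSet B' :=
    ((measurable_level u 0 (MeasurableSet.singleton n)).inter
      (MeasurableSet.iInter fun k => measurableSet_const_le_level u n k)).inter hB
  have hc : ∀ y, avg ν y B' ≤ avg ν 0 (neverBelow u ∩ B) := by
    intro y
    rw [avg_translate ν y hB'm]
    refine measure_mono fun x hx => ⟨fun k => ?_, hBt y x hx.2⟩
    have h1 : level u (y + x 0) = n := hx.1.1
    have h2 : n ≤ level u (y + x k) := Set.mem_iInter.1 hx.1.2 k
    rw [level_add] at h1 h2
    omega
  calc avg ν z {x | ∃ t, RegenAt u n x t ∧ shift t x ∈ B}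
      ≤ avg ν z (⋃ t, {x | FirstHit u n x t} ∩ shift t ⁻¹' B') := by
        refine measure_mono ?_
        rintro x ⟨t, ht, htB⟩
        exact Set.mem_iUnion.2 ⟨t, ht.1, ⟨ht.1.1, Set.mem_iInter.2 ht.2⟩, htB⟩
    _ ≤ ∑' t, avg ν z ({x | FirstHit u n x t} ∩ shift t ⁻¹' B') := measure_iUnion_le _
    _ ≤ ∑' t, avg ν 0 (neverBelow u ∩ B) * avg ν z {x | FirstHit u n x t} := by
        refine ENNReal.tsum_le_tsum fun t => ?_
        exact avg_inter_shift_le ν (L := n) (fun x x' h hx => FirstHit.congr hx h)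
          (fun x hx => hx.2) hB'm (fun x hx => Set.mem_iInter.1 hx.1.2) hc
    _ = avg ν 0 (neverBelow u ∩ B) * ∑' t, avg ν z {x | FirstHit u n x t} := ENNReal.tsum_mul_left
    _ ≤ avg ν 0 (neverBelow u ∩ B) := mul_le_of_le_one_right' (tsum_avg_firstHit_le ν u z n)

/-- Few regenerations are followed by a long regeneration interval. -/
theorem avg_regenAt_lateRegen_le {d : ℕ} (ν : Measure (ProbVec d)) [IsProbabilityMeasure ν]
    (u z : Site d) (n : ℤ) (g : ℕ) :
    avg ν z {x | ∃ t, RegenAt u n x t ∧ shift t x ∈ lateRegen u g} ≤ avg ν 0 (lateRegen u g) :=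
  (avg_regenAt_le ν u z n (measurableSet_lateRegen u g) fun z x hx => by
    simpa [lateRegen, regenTime_translate] using hx).trans (measure_mono Set.inter_subset_right)

/-- The regeneration time has polynomial tails. -/
theorem avg_lateRegen_mul_le {d : ℕ} (ν : Measure (ProbVec d)) (u : Site d) {p₀ : ℝ}
    (hp₀ : 0 ≤ p₀) (g : ℕ) : ((g : ℝ≥0∞) ^ p₀) * avg ν 0 (lateRegen u g)
      ≤ ∫⁻ X, ((regenTime u X : ℕ∞) : ℝ≥0∞) ^ p₀ ∂(avg ν 0) := by
  rw [← lintegral_indicator_const (measurableSet_lateRegen u g)]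
  refine lintegral_mono fun x => ?_
  by_cases hx : x ∈ lateRegen u g
  · rw [Set.indicator_of_mem hx]
    refine ENNReal.rpow_le_rpow ?_ hp₀
    have : ((g : ℕ∞) : ℝ≥0∞) ≤ ((regenTime u x : ℕ∞) : ℝ≥0∞) :=
      ENat.toENNReal_le.2 (le_of_lt hx)
    simpa using this
  · rw [Set.indicator_of_notMem hx]
    exact zero_le

/-! ### Consequences of a finite regeneration time -/

/-- Hypotheses shared by all estimates: bounded steps, and a regeneration time whose tails vanish. -/
structure Ballistic {d : ℕ} (ν : Measure (ProbVec d)) (u : Site d) (R : ℕ) : Prop where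
  prob : IsProbabilityMeasure ν
  bound : StepBound ν u R
  tendsto : Filter.Tendsto (fun g : ℕ => avg ν 0 (lateRegen u g)) Filter.atTop (nhds 0)

theorem Ballistic.avg_regenTime_top {d : ℕ} {ν : Measure (ProbVec d)} {u : Site d} {R : ℕ}
    (h : Ballistic ν u R) : avg ν 0 {x | regenTime u x = ⊤} = 0 := by
  refine le_antisymm (ge_of_tendsto' h.tendsto fun g => measure_mono fun x hx => ?_) zero_le
  rw [lateRegen, Set.mem_ofPred_eq, show regenTime u x = ⊤ from hx]
  exact ENat.natCast_lt_top g

/-- After a regeneration the walk never goes below its level. If that had probability zero,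
`avg_regenAt_le` would exclude a regeneration at each of the countably many levels, although the
first regeneration time is almost surely finite. -/
theorem Ballistic.avg_neverBelow_pos {d : ℕ} {ν : Measure (ProbVec d)} {u : Site d} {R : ℕ}
    (h : Ballistic ν u R) : 0 < avg ν 0 (neverBelow u) := by
  have := h.prob
  by_contra hcon
  have h0 : avg ν 0 (neverBelow u) = 0 := le_antisymm (not_lt.1 hcon) zero_le
  have hall : avg ν 0 (Set.univ : Set (Path d)) = 0 := by
    refine measure_mono_null (t := {x | regenTime u x = ⊤} ∪
      ⋃ n : ℤ, {x | ∃ t, RegenAt u n x t ∧ shift t x ∈ Set.univ}) ?_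
      (measure_union_null h.avg_regenTime_top (measure_iUnion_null fun n => ?_))
    · intro x _
      by_cases hx : regenTime u x = ⊤
      · exact Or.inl hx
      right
      obtain ⟨j, hj⟩ := ENat.ne_top_iff_exists.1 hx
      obtain ⟨j, -, hj1, h1, h2⟩ := regenTime_le_iff.1 hj.symm.le
      exact Set.mem_iUnion.2 ⟨level u (x j), j, ⟨⟨rfl, h1⟩, fun i => h2 _ (Nat.le_add_right _ _)⟩,
        trivial⟩
    · have := avg_regenAt_le ν u 0 n MeasurableSet.univ (fun _ _ _ => trivial)
      rw [Set.inter_univ, h0] at this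
      exact le_antisymm this zero_le
  rw [measure_univ] at hall
  exact one_ne_zero hall

theorem Ballistic.exists_level_pos {d : ℕ} {ν : Measure (ProbVec d)} {u : Site d} {R : ℕ}
    (h : Ballistic ν u R) : avg ν 0 {x | ∃ n, 0 < level u (x n)}ᶜ = 0 := by
  have := h.prob
  refine measure_mono_null (t := {x | regenTime u x = ⊤} ∪ (goodPaths ν 0)ᶜ) ?_
    (measure_union_null h.avg_regenTime_top (avg_goodPaths_compl ν 0))
  intro x hx
  by_contra hcon
  rw [Set.mem_union, not_or, Set.mem_compl_iff, not_not] at hcon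
  obtain ⟨j, hj⟩ := ENat.ne_top_iff_exists.1 hcon.1
  obtain ⟨j, -, hj1, h1, h2⟩ := regenTime_le_iff.1 hj.symm.le
  refine hx ⟨j, ?_⟩
  have := h1 0 hj1
  rw [hcon.2.1] at this
  simpa [level] using this

/-- A positive accessible level bounds the set of common divisors, which contains `1`; otherwise the
supremum in `ℕ` could take its default value `0`. Positivity is all that is needed of the greatest
common divisor. -/
theorem Ballistic.levelGcd_pos {d : ℕ} {ν : Measure (ProbVec d)} {u : Site d} {R : ℕ}
    (h : Ballistic ν u R) : 1 ≤ levelGcd ν u := by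
  have := h.prob
  have hex : ∃ ℓ ∈ accessibleLevels ν u, 0 < ℓ := by
    by_contra hcon
    push Not at hcon
    have hall : avg ν 0 (Set.univ : Set (Path d)) = 0 := by
      refine measure_mono_null (t := {x | ∃ n, 0 < level u (x n)}ᶜ ∪
        ⋃ ℓ : ℕ, {x | ∃ n, level u (x n) = ((ℓ + 1 : ℕ) : ℤ)}) ?_
        (measure_union_null h.exists_level_pos (measure_iUnion_null fun ℓ => ?_))
      · intro x _
        by_cases hx : ∃ n, 0 < level u (x n)
        · obtain ⟨n, hn⟩ := hx
          refine Or.inr (Set.mem_iUnion.2 ⟨(level u (x n)).toNat - 1, n, ?_⟩)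
          omega
        · exact Or.inl hx
      · by_contra hne
        have := hcon (ℓ + 1) (pos_iff_ne_zero.2 hne)
        omega
    rw [measure_univ] at hall
    exact one_ne_zero hall
  obtain ⟨ℓ, hℓ, hpos⟩ := hex
  refine le_csSup ⟨ℓ, fun g hg => Nat.le_of_dvd hpos (hg ℓ hℓ)⟩ fun ℓ _ => one_dvd ℓ

theorem Ballistic.exists_step_pos {d : ℕ} {ν : Measure (ProbVec d)} {u : Site d} {R : ℕ}
    (h : Ballistic ν u R) : ∃ s ∈ steps ν, 0 < level u s := by
  have := h.prob
  by_contra hcon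
  push Not at hcon
  have hall : avg ν 0 (Set.univ : Set (Path d)) = 0 := by
    refine measure_mono_null (t := {x | ∃ n, 0 < level u (x n)}ᶜ ∪ (goodPaths ν 0)ᶜ) ?_
      (measure_union_null h.exists_level_pos (avg_goodPaths_compl ν 0))
    intro x _
    by_cases hx : x ∈ goodPaths ν 0
    · left
      rintro ⟨n, hn⟩
      have : ∀ n, level u (x n) ≤ 0 := by
        intro n
        induction n with
        | zero => rw [hx.1]; simp [level]
        | succ n ih =>
          have := hcon _ (hx.2 n)
          rw [level_sub] at this
          omega
      exact absurd hn (not_lt.2 (this n))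
    · exact Or.inr hx
  rw [measure_univ] at hall
  exact one_ne_zero hall

/-! ## Comparison of a common environment with independent environments -/

/-- The source of every comparison between the two settings: finite paths that leave no common site
read independent parts of the environment. -/
theorem avgPair_cyl_of_disjoint {d : ℕ} (ν : Measure (ProbVec d)) [IsProbabilityMeasure ν]
    {m n : ℕ} {a b : Path d} (h : Disjoint (exits m a) (exits n b)) :
    avgPair ν (a 0) (b 0) (cyl m a ×ˢ cyl n b)
      = ((avg ν (a 0)).prod (avg ν (b 0))) (cyl m a ×ˢ cyl n b) := by
  rw [avgPair_cyl, lintegral_weight_mul_of_disjoint ν h, Measure.prod_prod, avg_cyl, avg_cyl]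

theorem StepBound.abs_sub_le {d : ℕ} {ν : Measure (ProbVec d)} {u : Site d} {R : ℕ}
    (hR : StepBound ν u R) {a : Path d} {m : ℕ} (ha : ∀ i < m, a (i + 1) - a i ∈ steps ν)
    {i : ℕ} (hi : i ≤ m) (j : Fin d) : |a i j - a 0 j| ≤ R * i := by
  induction i with
  | zero => simp
  | succ i ih =>
    have h1 := ih (by omega)
    have h2 := (hR _ (ha i (by omega))).1 j
    rw [Pi.sub_apply] at h2
    have h3 : a (i + 1) j - a 0 j = (a (i + 1) j - a i j) + (a i j - a 0 j) := by ring
    rw [h3]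
    refine (abs_add_le _ _).trans ?_
    push_cast
    linarith

/-- Started far apart, two walks do not notice before time `N` whether they share their
environment. -/
theorem avgPair_eq_prod_of_far {d : ℕ} {ν : Measure (ProbVec d)} [IsProbabilityMeasure ν]
    {u : Site d} {R : ℕ} (hR : StepBound ν u R) {N : ℕ} {x y : Site d} {j : Fin d}
    (hfar : 2 * (R * N : ℤ) < |y j - x j|) {A : Set (Path d × Path d)}
    (hA : ∀ w w', (∀ i ≤ N, w.1 i = w'.1 i) → (∀ i ≤ N, w.2 i = w'.2 i) → w ∈ A → w' ∈ A) :
    avgPair ν x y A = ((avg ν x).prod (avg ν y)) A := by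
  have hP := freshLaw_avgPair ν u
  have hQ := freshLaw_prod ν u
  have key : ∀ w : Path d × Path d, avgPair ν x y (cyl N w.1 ×ˢ cyl N w.2)
      = ((avg ν x).prod (avg ν y)) (cyl N w.1 ×ˢ cyl N w.2) := by
    intro w
    by_cases h0 : w.1 0 = x ∧ w.2 0 = y
    swap
    · rw [hP.cyl_of_ne (not_and_or.1 h0), hQ.cyl_of_ne (not_and_or.1 h0)]
    obtain ⟨rfl, rfl⟩ := h0
    by_cases h1 : ∀ i < N, w.1 (i + 1) - w.1 i ∈ steps ν
    swap
    · push Not at h1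
      obtain ⟨i, hi, h1⟩ := h1
      have h2 : avg ν (w.1 0) (cyl N w.1) = 0 := by
        rw [avg_cyl, lintegral_weight_eq_zero ν hi h1]
      rw [Measure.prod_prod, h2, zero_mul]
      refine measure_mono_null (Set.prod_mono_right (Set.subset_univ _)) ?_
      rw [hP.fst _ _ (measurableSet_cyl N w.1), h2]
    by_cases h2 : ∀ i < N, w.2 (i + 1) - w.2 i ∈ steps ν
    swap
    · push Not at h2
      obtain ⟨i, hi, h2⟩ := h2
      have h3 : avg ν (w.2 0) (cyl N w.2) = 0 := by
        rw [avg_cyl, lintegral_weight_eq_zero ν hi h2]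
      rw [Measure.prod_prod, h3, mul_zero]
      refine measure_mono_null (Set.prod_mono_left (Set.subset_univ _)) ?_
      rw [hP.snd _ _ (measurableSet_cyl N w.2), h3]
    -- Cylinders with a wrong start or a forbidden step are null under both laws. For the others, a
    -- common site would force `|y j - x j| ≤ R * i + R * k ≤ 2 * R * N`.
    refine avgPair_cyl_of_disjoint ν (Finset.disjoint_left.2 fun s hs hs' => ?_)
    obtain ⟨i, hi, rfl⟩ := mem_exits.1 hs
    obtain ⟨k, hk, hk'⟩ := mem_exits.1 hs'
    have h3 := hR.abs_sub_le h1 hi.le j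
    have h4 := hR.abs_sub_le h2 hk.le j
    rw [hk'] at h4
    have h5 : w.2 0 j - w.1 0 j = (w.1 i j - w.1 0 j) - (w.1 i j - w.2 0 j) := by ring
    rw [h5] at hfar
    have h6 := abs_sub (w.1 i j - w.1 0 j) (w.1 i j - w.2 0 j)
    have h7 : (R : ℤ) * i ≤ R * N := by gcongr
    have h8 : (R : ℤ) * k ≤ R * N := by gcongr
    omega
  have key' : ∀ w : Path d × Path d, avgPair ν x y (seg₂ N N ⁻¹' {seg₂ N N w} ∩ A)
      = ((avg ν x).prod (avg ν y)) (seg₂ N N ⁻¹' {seg₂ N N w} ∩ A) := by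
    intro w
    rw [seg₂_preimage]
    by_cases hw : w ∈ A
    · rw [Set.inter_eq_left.2 fun w' hw' => hA w w' (fun i hi => (hw'.1 i hi).symm)
        (fun i hi => (hw'.2 i hi).symm) hw]
      exact key w
    · have : (cyl N w.1 ×ˢ cyl N w.2) ∩ A = ∅ := by
        ext w'
        simp only [Set.mem_inter_iff, Set.mem_empty_iff_false, iff_false, not_and]
        exact fun h1 h2 => hw (hA w' w h1.1 h1.2 h2)
      rw [this]; simp
  exact le_antisymm (measure_le_of_fibers (measurable_seg₂ N N) fun w => (key' w).le)
    (measure_le_of_fibers (measurable_seg₂ N N) fun w => (key' w).ge)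

/-! ## The probability that neither walk backtracks -/

theorem neverBelow_translate {d : ℕ} (u z : Site d) (x : Path d) :
    (fun i => z + x i) ∈ neverBelow u ↔ x ∈ neverBelow u := by
  simp only [neverBelow, Set.mem_ofPred_eq, level_add, add_le_add_iff_left]

theorem avg_neverBelow {d : ℕ} (ν : Measure (ProbVec d)) [IsProbabilityMeasure ν] (u z : Site d) :
    avg ν z (neverBelow u) = avg ν 0 (neverBelow u) := by
  rw [avg_translate ν z (measurableSet_neverBelow u)]
  simp only [neverBelow_translate]
  rfl

theorem avg_lateRegen {d : ℕ} (ν : Measure (ProbVec d)) [IsProbabilityMeasure ν] (u z : Site d)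
    (g : ℕ) : avg ν z (lateRegen u g) = avg ν 0 (lateRegen u g) := by
  rw [avg_translate ν z (measurableSet_lateRegen u g)]
  simp only [lateRegen, Set.mem_ofPred_eq, regenTime_translate]

/-- The pairs of paths that do not backtrack up to time `N`. -/
def noBacktrackUpTo {d : ℕ} (u : Site d) (N : ℕ) : Set (Path d × Path d) :=
  {w | ∀ i ≤ N, level u (w.1 0) ≤ level u (w.1 i) ∧ level u (w.2 0) ≤ level u (w.2 i)}

theorem noBacktrack_subset_upTo {d : ℕ} (u : Site d) (N : ℕ) :
    noBacktrack u ⊆ noBacktrackUpTo u N := fun _ hw i _ => mem_noBacktrack_iff.1 hw i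

/-- A walk that first backtracks after time `N` cannot have regenerated by time `N`. This concerns
one walk at a time, so only the marginals enter. -/
theorem FreshLaw.late_backtrack_le {d : ℕ} {ν : Measure (ProbVec d)} [IsProbabilityMeasure ν]
    {u : Site d} {P : Site d → Site d → Measure (Path d × Path d)} (hP : FreshLaw ν u P)
    (x y : Site d) (N : ℕ) :
    P x y (noBacktrackUpTo u N \ noBacktrack u) ≤ 2 * avg ν 0 (lateRegen u N) := by
  have hsub : noBacktrackUpTo u N \ noBacktrack u
      ⊆ lateRegen u N ×ˢ Set.univ ∪ Set.univ ×ˢ lateRegen u N := by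
    rintro w ⟨h1, h2⟩
    rw [noBacktrack_eq_prod, Set.mem_prod, not_and_or] at h2
    rcases h2 with h2 | h2
    · exact Or.inl ⟨lateRegen_of_late_backtrack (fun i hi => (h1 i hi).1) h2, trivial⟩
    · exact Or.inr ⟨trivial, lateRegen_of_late_backtrack (fun i hi => (h1 i hi).2) h2⟩
  refine (measure_mono hsub).trans ((measure_union_le _ _).trans ?_)
  rw [hP.fst x y (measurableSet_lateRegen u N), hP.snd x y (measurableSet_lateRegen u N),
    avg_lateRegen, avg_lateRegen ν u y, two_mul]

theorem prod_noBacktrack {d : ℕ} (ν : Measure (ProbVec d)) [IsProbabilityMeasure ν]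
    (u x y : Site d) :
    ((avg ν x).prod (avg ν y)) (noBacktrack u) = avg ν 0 (neverBelow u) ^ 2 := by
  rw [noBacktrack_eq_prod, Measure.prod_prod, avg_neverBelow, avg_neverBelow ν u y, sq]

/-- Jensen's inequality for the square, by integrating `2 * c * f ≤ f ^ 2 + c ^ 2` with `c` the
mean. The bound by one keeps all terms finite. -/
theorem sq_lintegral_le {Ω : Type*} [MeasurableSpace Ω] {μ : Measure Ω} [IsProbabilityMeasure μ]
    {f : Ω → ℝ≥0∞} (hf : ∀ ω, f ω ≤ 1) : (∫⁻ ω, f ω ∂μ) ^ 2 ≤ ∫⁻ ω, f ω ^ 2 ∂μ := by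
  set c := ∫⁻ ω, f ω ∂μ with hc
  have hc1 : c ≤ 1 := by
    calc c ≤ ∫⁻ _, 1 ∂μ := lintegral_mono hf
      _ = 1 := by simp
  have hctop : c ≠ ⊤ := ne_top_of_le_ne_top ENNReal.one_ne_top hc1
  have h1 : ∀ ω, 2 * c * f ω ≤ f ω ^ 2 + c ^ 2 := by
    intro ω
    have hft : f ω ≠ ⊤ := ne_top_of_le_ne_top ENNReal.one_ne_top (hf ω)
    lift f ω to NNReal using hft with a
    lift c to NNReal using hctop with b
    have := two_mul_le_add_sq b a
    rw [add_comm]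
    exact_mod_cast this
  have h2 : 2 * c * c ≤ (∫⁻ ω, f ω ^ 2 ∂μ) + c ^ 2 := by
    have h2c : 2 * c ≠ ⊤ := ENNReal.mul_ne_top (by simp) hctop
    calc 2 * c * c = ∫⁻ ω, 2 * c * f ω ∂μ := by rw [lintegral_const_mul' _ _ h2c]
      _ ≤ ∫⁻ ω, (f ω ^ 2 + c ^ 2) ∂μ := lintegral_mono h1
      _ = _ := by rw [lintegral_add_right _ measurable_const]; simp
  have h3 : c ^ 2 + c ^ 2 ≤ (∫⁻ ω, f ω ^ 2 ∂μ) + c ^ 2 := by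
    refine le_trans (le_of_eq ?_) h2
    ring
  exact (ENNReal.add_le_add_iff_right (ENNReal.pow_ne_top hctop)).1 h3

/-- Given the environment, walks from the same site are independent with the same law, so the joint
probability is a mean of squares; a shared environment can only help. -/
theorem sq_le_avgPair_self_noBacktrack {d : ℕ} (ν : Measure (ProbVec d)) [IsProbabilityMeasure ν]
    (u x : Site d) : avg ν 0 (neverBelow u) ^ 2 ≤ avgPair ν x x (noBacktrack u) := by
  have hm := measurableSet_neverBelow u
  rw [noBacktrack_eq_prod, avgPair_prod ν x x hm hm, ← avg_neverBelow ν u x, avg_apply ν x hm]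
  simp_rw [← sq]
  exact sq_lintegral_le fun ω => prob_le_one

/-- No backtracking up to time `N` has the same probability in both settings, and replacing it by no
backtracking at all costs only the event of a late backtrack. -/
theorem le_avgPair_noBacktrack_of_far {d : ℕ} {ν : Measure (ProbVec d)} [IsProbabilityMeasure ν]
    {u : Site d} {R : ℕ} (hR : StepBound ν u R) {N : ℕ} {x y : Site d} {j : Fin d}
    (hfar : 2 * (R * N : ℤ) < |y j - x j|) :
    avg ν 0 (neverBelow u) ^ 2
      ≤ avgPair ν x y (noBacktrack u) + 2 * avg ν 0 (lateRegen u N) := by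
  calc avg ν 0 (neverBelow u) ^ 2
      = ((avg ν x).prod (avg ν y)) (noBacktrack u) := (prod_noBacktrack ν u x y).symm
    _ ≤ ((avg ν x).prod (avg ν y)) (noBacktrackUpTo u N) :=
        measure_mono (noBacktrack_subset_upTo u N)
    _ = avgPair ν x y (noBacktrackUpTo u N) :=
        (avgPair_eq_prod_of_far (A := noBacktrackUpTo u N) hR hfar fun w w' h1 h2 hw i hi => by
          rw [← h1 i hi, ← h2 i hi, ← h1 0 (Nat.zero_le _), ← h2 0 (Nat.zero_le _)]
          exact hw i hi).symm
    _ ≤ avgPair ν x y (noBacktrack u ∪ (noBacktrackUpTo u N \ noBacktrack u)) :=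
        measure_mono fun w hw => by
          by_cases h : w ∈ noBacktrack u
          · exact Or.inl h
          · exact Or.inr ⟨hw, h⟩
    _ ≤ _ := (measure_union_le _ _).trans
        (add_le_add le_rfl ((freshLaw_avgPair ν u).late_backtrack_le x y N))

/-! ### Merging two walks, and the uniform lower bound for no backtracking -/

/-- Two walks in a common environment can be merged where they meet: the second walk follows `b` up
to its first visit to the path `a`, and `a` from there on. -/
theorem le_lintegral_weight_merge {d : ℕ} (ν : Measure (ProbVec d)) [IsProbabilityMeasure ν]
    {t i j : ℕ} {a b : Path d} (hit : i ≤ t) (hab : b j = a i)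
    (hd : Disjoint (exits t a) (exits j b)) :
    (∫⁻ ω, weight ω t a ∂(envLaw ν)) ^ 2 * ∫⁻ ω, weight ω j b ∂(envLaw ν)
      ≤ ∫⁻ ω, weight ω t a * weight ω (j + (t - i)) (splice j b (shift i a)) ∂(envLaw ν) := by
  have h0 : shift i a 0 = b j := hab.symm
  have h1 : ∀ ω : Env d, (weight ω t a * weight ω t a) * (weight ω j b * weight ω 0 b)
      ≤ weight ω t a * weight ω (j + (t - i)) (splice j b (shift i a)) := by
    intro ω
    have h2 : weight ω t a ≤ weight ω (t - i) (shift i a) := by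
      obtain ⟨k, rfl⟩ := Nat.exists_eq_add_of_le hit
      rw [weight_add, Nat.add_sub_cancel_left]
      exact mul_le_of_le_one_left' (weight_le_one ω i a)
    rw [weight_add, shift_splice, weight_congr ω fun k hk => splice_of_le h0 hk]
    -- The trivial fourth factor gives the product the shape of `lintegral_weight_mul_four`. The
    -- steps shared by both walks then contribute a mean of a square, estimated by Jensen.
    have h3 : weight ω 0 b = 1 := by simp [weight]
    rw [h3, mul_one, mul_assoc, mul_comm (weight ω t a) (weight ω j b)]
    gcongr
  calc _ ≤ (∫⁻ ω, weight ω t a ^ 2 ∂(envLaw ν)) * ∫⁻ ω, weight ω j b ∂(envLaw ν) := by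
        gcongr
        exact sq_lintegral_le fun ω => weight_le_one ω t a
    _ = ∫⁻ ω, (weight ω t a * weight ω t a) * (weight ω j b * weight ω 0 b) ∂(envLaw ν) := by
        rw [lintegral_weight_mul_four ν hd subset_rfl subset_rfl subset_rfl
          (by intro s hs; obtain ⟨k, hk, -⟩ := mem_exits.1 hs; omega)]
        simp [weight, sq]
    _ ≤ _ := lintegral_mono h1

/-- The pairs of paths that stay at levels at least `L`. -/
def above {d : ℕ} (u : Site d) (L : ℤ) : Set (Path d × Path d) :=
  {w | ∀ k, L ≤ level u (w.1 k) ∧ L ≤ level u (w.2 k)}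

theorem measurableSet_above {d : ℕ} (u : Site d) (L : ℤ) : MeasurableSet (above (d := d) u L) := by
  have : above u L = ⋂ k, ({x : Path d | L ≤ level u (x k)} ×ˢ {x : Path d | L ≤ level u (x k)}) := by
    ext w; simp [above]
  rw [this]
  exact MeasurableSet.iInter fun k =>
    (measurableSet_const_le_level u L k).prod (measurableSet_const_le_level u L k)

/-- Renewal requires events that stay above a fixed level, while `noBacktrack` refers to the
starting points of the paths; the two descriptions agree off a null set. -/
theorem FreshLaw.noBacktrack_le_above {d : ℕ} {ν : Measure (ProbVec d)} [IsProbabilityMeasure ν]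
    {u : Site d} {P : Site d → Site d → Measure (Path d × Path d)} (hP : FreshLaw ν u P)
    {x y : Site d} {L : ℤ} (hx : level u x = L) (hy : level u y = L) :
    P x y (noBacktrack u) ≤ P x y (above u L) := by
  calc P x y (noBacktrack u)
      ≤ P x y (above u L ∪ (goodPaths ν x ×ˢ goodPaths ν y)ᶜ) := measure_mono fun w hw => by
        by_cases h : w ∈ goodPaths ν x ×ˢ goodPaths ν y
        · left
          have h1 := mem_noBacktrack_iff.1 hw
          rw [h.1.1, h.2.1, hx, hy] at h1
          exact h1
        · exact Or.inr h
    _ ≤ P x y (above u L) + 0 := by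
        rw [← hP.ae_goodPaths x y]
        exact measure_union_le _ _
    _ = _ := add_zero _

/-- A walk that never goes below its start regenerates at time zero. Each regeneration is almost
surely followed by another at a higher level, so regeneration levels are unbounded. -/
theorem Ballistic.avg_regen_infinite {d : ℕ} {ν : Measure (ProbVec d)} {u : Site d} {R : ℕ}
    (h : Ballistic ν u R) (z : Site d) : avg ν z (neverBelow u ∩
      {x | ∃ n, ∀ n' ≥ n, ∀ t, ¬ RegenAt u n' x t}) = 0 := by
  have := h.prob
  refine measure_mono_null (t := ⋃ n : ℤ, {x | ∃ t, RegenAt u n x t ∧ regenTime u (shift t x) = ⊤})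
    ?_ (measure_iUnion_null fun n => ?_)
  · rintro x ⟨hx, n, hn⟩
    by_contra hcon
    simp only [Set.mem_iUnion, not_exists, Set.mem_ofPred_eq, not_and] at hcon
    have key : ∀ k : ℕ, ∃ n' ≥ level u (x 0) + k, ∃ t, RegenAt u n' x t := by
      intro k
      induction k with
      | zero => exact ⟨level u (x 0), by simp, 0, ⟨rfl, fun i hi => by omega⟩, fun j => by
          rw [zero_add]; exact hx j⟩
      | succ k ih =>
        obtain ⟨n', hn', t, ht⟩ := ih
        obtain ⟨g, hg⟩ := ENat.ne_top_iff_exists.1 (hcon n' t ht)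
        obtain ⟨j, -, n'', hn'', ht'⟩ := ht.next hg.symm.le
        exact ⟨n'', by push_cast; omega, t + j, ht'⟩
    obtain ⟨n', hn', t, ht⟩ := key (n - level u (x 0)).toNat
    exact hn n' (by omega) t ht
  · refine le_antisymm (ge_of_tendsto' h.tendsto fun g => ?_) zero_le
    refine (measure_mono ?_).trans (avg_regenAt_lateRegen_le ν u z n g)
    rintro x ⟨t, ht, htop⟩
    exact ⟨t, ht, by rw [lateRegen, Set.mem_ofPred_eq, htop]; exact ENat.natCast_lt_top g⟩

theorem exists_cyl_ne_zero {d : ℕ} {μ : Measure (Path d × Path d)} {m n : ℕ}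
    {A : Set (Path d × Path d)} (h : μ A ≠ 0) : ∃ w ∈ A, μ (cyl m w.1 ×ˢ cyl n w.2) ≠ 0 := by
  by_contra hcon
  push Not at hcon
  apply h
  refine le_antisymm ?_ zero_le
  have := measure_le_of_fibers (measurable_seg₂ (d := d) m n) (μ₁ := μ) (μ₂ := 0) (S := A)
    (T := Set.univ) fun w => ?_
  · simpa using this
  rw [Measure.coe_zero, Pi.zero_apply]
  refine le_of_eq ?_
  by_cases hw : (seg₂ m n ⁻¹' {seg₂ m n w} ∩ A).Nonempty
  · obtain ⟨w', hw', hA⟩ := hw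
    have h1 : seg₂ m n w' = seg₂ m n w := hw'
    rw [← h1, seg₂_preimage]
    exact measure_mono_null Set.inter_subset_left (hcon w' hA)
  · rw [Set.not_nonempty_iff_eq_empty.1 hw, measure_empty]

/-- The second path of the pair meets the first one at time `j`, at the point visited at time `i`,
and not before; the first path enters a new half space at time `t`. -/
def MeetsAt {d : ℕ} (u : Site d) (i j t : ℕ) (w : Path d × Path d) : Prop :=
  i ≤ t ∧ w.2 j = w.1 i ∧ (∀ j' < j, ∀ i' ≤ t, w.1 i' ≠ w.2 j') ∧
    (∀ j' ≤ j, level u (w.2 j') < level u (w.1 t)) ∧ (∀ i' < t, level u (w.1 i') < level u (w.1 t)) ∧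
    (∀ i' ≤ t, level u (w.1 0) ≤ level u (w.1 i')) ∧ ∀ j' ≤ j, level u (w.2 0) ≤ level u (w.2 j')

/-- If the finite segments have positive probability for independent walks, so does the merged pair
in a common environment. Both merged walks enter a new half space at the same site `w.1 t`, and from
there the bound for walks with equal starting points applies. -/
theorem MeetsAt.noBacktrack_pos {d : ℕ} {ν : Measure (ProbVec d)} {u : Site d} {R : ℕ}
    (h : Ballistic ν u R) {i j t : ℕ} {w : Path d × Path d} (hw : MeetsAt u i j t w)
    (hl : level u (w.1 0) = level u (w.2 0))
    (hpos : ((avg ν (w.1 0)).prod (avg ν (w.2 0))) (cyl t w.1 ×ˢ cyl j w.2) ≠ 0) :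
    avgPair ν (w.1 0) (w.2 0) (noBacktrack u) ≠ 0 := by
  have := h.prob
  obtain ⟨hit, hmeet, hdis, hlev, hrec, hx0, hy0⟩ := hw
  rw [Measure.prod_prod, avg_cyl, avg_cyl] at hpos
  have hd : Disjoint (exits t w.1) (exits j w.2) := by
    refine Finset.disjoint_left.2 fun s hs hs' => ?_
    obtain ⟨i', hi', rfl⟩ := mem_exits.1 hs
    obtain ⟨j', hj', h2⟩ := mem_exits.1 hs'
    exact hdis j' hj' i' hi'.le h2.symm
  have h0 : shift i w.1 0 = w.2 j := hmeet.symm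
  set b := splice j w.2 (shift i w.1) with hb
  set n := j + (t - i) with hn
  have hb0 : b 0 = w.2 0 := splice_of_le h0 (Nat.zero_le _)
  have hbn : b n = w.1 t := by
    rw [hb, hn, splice_add, shift, Nat.add_sub_cancel' hit]
  have hW : avgPair ν (w.1 0) (b 0) (cyl t w.1 ×ˢ cyl n b) ≠ 0 := by
    rw [avgPair_cyl]
    refine ne_of_gt (lt_of_lt_of_le ?_ (le_lintegral_weight_merge ν hit hmeet hd))
    rw [mul_ne_zero_iff] at hpos
    exact pos_iff_ne_zero.2 (mul_ne_zero (pow_ne_zero _ hpos.1) hpos.2)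
  have hbval : ∀ k ≤ n, (∃ j' ≤ j, b k = w.2 j') ∨ ∃ i', j ≤ k ∧ i' ≤ t ∧ i' = i + (k - j) ∧
      b k = w.1 i' := by
    intro k hk
    rcases le_total k j with hkj | hkj
    · exact Or.inl ⟨k, hkj, splice_of_le h0 hkj⟩
    · obtain ⟨l, rfl⟩ := Nat.exists_eq_add_of_le hkj
      refine Or.inr ⟨i + l, by omega, by omega, by omega, ?_⟩
      rw [hb, splice_add]; rfl
  have hP := freshLaw_avgPair ν u
  have key := hP.cyl_inter_shift (L := level u (w.1 t)) (m := t) (n := n) (a := w.1) (b := b)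
    hrec (fun k hk => ?_) (measurableSet_above u (level u (w.1 t))) (fun w hw => hw)
  · rw [← hb0]
    refine ne_of_gt (lt_of_lt_of_le ?_ (measure_mono (s := (cyl t w.1 ×ˢ cyl n b) ∩
      shift₂ t n ⁻¹' above u (level u (w.1 t))) ?_))
    · rw [key, hbn]
      refine pos_iff_ne_zero.2 (mul_ne_zero hW (ne_of_gt ?_))
      refine lt_of_lt_of_le ?_ (hP.noBacktrack_le_above rfl rfl)
      exact lt_of_lt_of_le (ENNReal.pow_pos h.avg_neverBelow_pos 2) (sq_le_avgPair_self_noBacktrack ν u _)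
    · rintro v ⟨hv, hv'⟩
      rw [mem_noBacktrack_iff]
      have hv1 : v.1 0 = w.1 0 := hv.1 0 (Nat.zero_le _)
      have hv2 : v.2 0 = w.2 0 := (hv.2 0 (Nat.zero_le _)).trans hb0
      rw [hv1, hv2]
      intro k
      constructor
      · rcases le_total k t with hkt | hkt
        · rw [hv.1 k hkt]; exact hx0 k hkt
        · obtain ⟨l, rfl⟩ := Nat.exists_eq_add_of_le hkt
          exact (hx0 t le_rfl).trans (hv' l).1
      · rcases le_total k n with hkn | hkn
        · rw [hv.2 k hkn]
          rcases hbval k hkn with ⟨j', hj', h3⟩ | ⟨i', -, hi', -, h3⟩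
          · rw [h3]; exact hy0 j' hj'
          · rw [h3, ← hl]; exact hx0 i' hi'
        · obtain ⟨l, rfl⟩ := Nat.exists_eq_add_of_le hkn
          rw [← hl]
          exact (hx0 t le_rfl).trans (hv' l).2
  · rcases hbval k hk.le with ⟨j', hj', h3⟩ | ⟨i', hi', -, hi'', h3⟩
    · rw [h3]; exact hlev j' hj'
    · rw [h3]; exact hrec i' (by omega)

/-- Two walks in a common environment that start on a common level have a positive probability not
to backtrack. -/
theorem Ballistic.avgPair_noBacktrack_ne_zero {d : ℕ} {ν : Measure (ProbVec d)} {u : Site d} {R : ℕ}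
    (h : Ballistic ν u R) {x y : Site d} (hl : level u x = level u y) :
    avgPair ν x y (noBacktrack u) ≠ 0 := by
  have := h.prob
  intro hzero
  have hP := freshLaw_avgPair ν u
  have hQ := freshLaw_prod ν u
  -- Suppose the probability vanishes. On pairs that never meet the two settings have the same law.
  -- Pairs that meet can be stopped at the first meeting and continued to a regeneration of the
  -- first walk above everything seen so far; such segments are null by `MeetsAt.noBacktrack_pos`.
  -- So independent walks would almost surely backtrack, a contradiction. The strict inequalities in
  -- `V` match the fact that endpoints are not left.
  set V : ℕ → Set (Path d × Path d) := fun k => {w | ∀ i < k, ∀ j < k, w.1 i ≠ w.2 j} with hV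
  have hVm : MeasurableSet (⋂ k, V k) := by
    refine MeasurableSet.iInter fun k => ?_
    refine measurableSet_of_determined (measurable_seg₂ k k) fun w w' hww hw i hi j hj => ?_
    obtain ⟨h1, h2⟩ := seg₂_eq_iff.1 hww
    rw [← h1 i hi.le, ← h2 j hj.le]
    exact hw i hi j hj
  have hI : ((avg ν x).prod (avg ν y)) (noBacktrack u ∩ ⋂ k, V k) = 0 := by
    rw [← pair_measure_eq_of_cyl (avgPair ν x y) ((avg ν x).prod (avg ν y)) (V := V)
      (fun k l hkl w hw i hi j hj => hw i (hi.trans_le hkl) j (hj.trans_le hkl))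
      (fun k w w' h1 h2 hw i hi j hj => by rw [← h1 i hi.le, ← h2 j hj.le]; exact hw i hi j hj) ?_
      ((measurableSet_noBacktrack u).inter hVm) (fun k w hw => Set.mem_iInter.1 hw.2 k)]
    · exact measure_mono_null Set.inter_subset_left hzero
    · intro k w hw
      by_cases h0 : w.1 0 = x ∧ w.2 0 = y
      · obtain ⟨rfl, rfl⟩ := h0
        refine avgPair_cyl_of_disjoint ν (Finset.disjoint_left.2 fun s hs hs' => ?_)
        obtain ⟨i, hi, rfl⟩ := mem_exits.1 hs
        obtain ⟨j, hj, hj'⟩ := mem_exits.1 hs'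
        exact hw i hi j hj hj'.symm
      · rw [hP.cyl_of_ne (not_and_or.1 h0), hQ.cyl_of_ne (not_and_or.1 h0)]
  have hreg : ((avg ν x).prod (avg ν y)) ((neverBelow u ∩
      {x | ∃ n, ∀ n' ≥ n, ∀ t, ¬ RegenAt u n' x t}) ×ˢ Set.univ) = 0 := by
    rw [Measure.prod_prod, h.avg_regen_infinite x, zero_mul]
  have hmeet : ∀ i j t, ((avg ν x).prod (avg ν y))
      {w | w.1 0 = x ∧ w.2 0 = y ∧ MeetsAt u i j t w} = 0 := by
    intro i j t
    by_contra hne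
    obtain ⟨w, ⟨rfl, rfl, hw⟩, hpos⟩ := exists_cyl_ne_zero (m := t) (n := j) hne
    exact hw.noBacktrack_pos h hl hpos hzero
  have hall : ((avg ν x).prod (avg ν y)) (noBacktrack u) = 0 := by
    refine measure_mono_null (t := (noBacktrack u ∩ ⋂ k, V k) ∪ (goodPaths ν x ×ˢ goodPaths ν y)ᶜ ∪
      (neverBelow u ∩ {x | ∃ n, ∀ n' ≥ n, ∀ t, ¬ RegenAt u n' x t}) ×ˢ Set.univ ∪
      ⋃ i, ⋃ j, ⋃ t, {w | w.1 0 = x ∧ w.2 0 = y ∧ MeetsAt u i j t w}) ?_ (measure_union_null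
        (measure_union_null (measure_union_null hI (hQ.ae_goodPaths x y)) hreg)
        (measure_iUnion_null fun i => measure_iUnion_null fun j => measure_iUnion_null (hmeet i j)))
    intro w hw
    by_cases h1 : w ∈ ⋂ k, V k
    · exact Or.inl (Or.inl (Or.inl ⟨hw, h1⟩))
    by_cases h2 : w ∈ goodPaths ν x ×ˢ goodPaths ν y
    swap
    · exact Or.inl (Or.inl (Or.inr h2))
    have hnb := mem_noBacktrack_iff.1 hw
    by_cases h3 : ∃ n, ∀ n' ≥ n, ∀ t, ¬ RegenAt u n' w.1 t
    · exact Or.inl (Or.inr ⟨⟨fun n => (hnb n).1, h3⟩, trivial⟩)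
    right
    push Not at h3
    have hex : ∃ j i, w.2 j = w.1 i := by
      simp only [Set.mem_iInter, hV, Set.mem_ofPred_eq, not_forall, not_not] at h1
      obtain ⟨k, i, -, j, -, hij⟩ := h1
      exact ⟨j, i, hij.symm⟩
    classical
    obtain ⟨i, hi⟩ := Nat.find_spec hex
    have hmin := fun j' (hj' : j' < Nat.find hex) => Nat.find_min hex hj'
    set j := Nat.find hex
    obtain ⟨n', hn', t, ht⟩ := h3 (max (runMax u w.1 i) (runMax u w.2 j) + 1)
    have hmax : ∀ j' ≤ j, level u (w.2 j') < n' := fun j' hj' => by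
      have := level_le_runMax (u := u) (x := w.2) hj'
      have := le_max_right (runMax u w.1 i) (runMax u w.2 j)
      omega
    have hmaxi : ∀ i' ≤ i, level u (w.1 i') < n' := fun i' hi' => by
      have := level_le_runMax (u := u) (x := w.1) hi'
      have := le_max_left (runMax u w.1 i) (runMax u w.2 j)
      omega
    have hit : i ≤ t := by
      by_contra hcon
      have := hmaxi t (by omega)
      rw [ht.1.1] at this
      omega
    refine Set.mem_iUnion.2 ⟨i, Set.mem_iUnion.2 ⟨j, Set.mem_iUnion.2 ⟨t, h2.1.1, h2.2.1, hit, hi,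
      fun j' hj' i' _ hcon => hmin j' hj' ⟨i', hcon.symm⟩, ?_, ?_, fun i' _ => (hnb i').1,
      fun j' _ => (hnb j').2⟩⟩⟩
    · rw [ht.1.1]; exact hmax
    · rw [ht.1.1]; exact ht.1.2
  rw [prod_noBacktrack] at hall
  exact (ENNReal.pow_pos h.avg_neverBelow_pos 2).ne' hall

theorem avgPair_noBacktrack_translate {d : ℕ} (ν : Measure (ProbVec d)) [IsProbabilityMeasure ν]
    (u x y z : Site d) :
    avgPair ν (z + x) (z + y) (noBacktrack u) = avgPair ν x y (noBacktrack u) := by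
  have hm : Measurable fun (w : Path d × Path d) =>
      ((fun i => z + w.1 i, fun i => z + w.2 i) : Path d × Path d) := by
    have hz : Measurable fun (x : Path d) (i : ℕ) => z + x i :=
      measurable_pi_lambda _ fun i => measurable_const.add (measurable_pi_apply i)
    exact (hz.comp measurable_fst).prodMk (hz.comp measurable_snd)
  have hP := freshLaw_avgPair ν u
  rw [pair_measure_eq_of_cyl (avgPair ν (z + x) (z + y)) ((avgPair ν x y).map fun w =>
    ((fun i => z + w.1 i, fun i => z + w.2 i) : Path d × Path d))
    (V := fun _ => Set.univ) (fun _ _ _ => le_rfl) (fun _ _ _ _ _ _ => trivial) ?_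
    (measurableSet_noBacktrack u) (fun k => Set.subset_univ _),
    Measure.map_apply hm (measurableSet_noBacktrack u)]
  · congr 1
    ext w
    simp only [Set.mem_preimage, mem_noBacktrack_iff, level_add, add_le_add_iff_left]
  · intro k w _
    rw [Measure.map_apply hm ((measurableSet_cyl k _).prod (measurableSet_cyl k _))]
    have hset : (fun w : Path d × Path d =>
        ((fun i => z + w.1 i, fun i => z + w.2 i) : Path d × Path d)) ⁻¹' (cyl k w.1 ×ˢ cyl k w.2)
        = cyl k (fun i => -z + w.1 i) ×ˢ cyl k (fun i => -z + w.2 i) := by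
      ext v
      simp only [cyl, Set.mem_preimage, Set.mem_prod, Set.mem_ofPred_eq, eq_neg_add_iff_add_eq]
    rw [hset]
    by_cases h0 : w.1 0 = z + x ∧ w.2 0 = z + y
    · have e1 : x = (fun i => -z + w.1 i) 0 := by simp [h0.1]
      have e2 : y = (fun i => -z + w.2 i) 0 := by simp [h0.2]
      have e3 : avgPair ν x y = avgPair ν ((fun i => -z + w.1 i) 0) ((fun i => -z + w.2 i) 0) := by
        rw [← e1, ← e2]
      rw [← h0.1, ← h0.2, e3, avgPair_cyl,
        avgPair_cyl ν k k (fun i => -z + w.1 i) fun i => -z + w.2 i]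
      simp_rw [weight_translate]
      exact (lintegral_envLaw_translate ν (-z) (F := fun ω => weight ω k w.1 * weight ω k w.2)
        ((measurable_weight k w.1).mul (measurable_weight k w.2))).symm
    · rw [hP.cyl_of_ne (not_and_or.1 h0), hP.cyl_of_ne]
      rw [← not_and_or]
      rintro ⟨h1, h2⟩
      exact h0 ⟨(neg_add_eq_iff_eq_add.1 h1), (neg_add_eq_iff_eq_add.1 h2)⟩

/-- Uniform lower bound for the probability that two walks in a common environment do not
backtrack. -/
theorem Ballistic.exists_le_avgPair_noBacktrack {d : ℕ} {ν : Measure (ProbVec d)} {u : Site d}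
    {R : ℕ} (h : Ballistic ν u R) : ∃ ρ : ℝ≥0∞, 0 < ρ ∧ ∀ x y, level u x = level u y →
      ρ ≤ avgPair ν x y (noBacktrack u) := by
  have := h.prob
  have hη := h.avg_neverBelow_pos
  set η := avg ν 0 (neverBelow u) with hηdef
  have hη' : 0 < η ^ 2 / 2 := ENNReal.half_pos (ENNReal.pow_pos hη 2).ne'
  have hηtop : η ^ 2 ≠ ⊤ := ENNReal.pow_ne_top (measure_ne_top _ _)
  have h2 : Filter.Tendsto (fun g : ℕ => 2 * avg ν 0 (lateRegen u g)) Filter.atTop (nhds 0) := by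
    have := ENNReal.Tendsto.const_mul (a := 2) h.tendsto (Or.inr (by simp))
    simpa using this
  -- With this `N`, starting points further apart than `2 * R * N` in some coordinate lose at most
  -- half of `η ^ 2`. The remaining differences form a finite set, over which a minimum of positive
  -- numbers is taken.
  obtain ⟨N, hN⟩ := ((tendsto_order.1 h2).2 _ hη').exists
  have hfin : (Set.Icc (fun _ => -(2 * (R * N : ℤ))) (fun _ => 2 * (R * N : ℤ)) :
      Set (Site d)).Finite := Set.finite_Icc _ _
  classical
  set F : Finset (Site d) := hfin.toFinset.filter fun z => level u z = 0 with hF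
  refine ⟨min (η ^ 2 / 2) (F.inf fun z => avgPair ν 0 z (noBacktrack u)), ?_, ?_⟩
  · refine lt_min hη' ((Finset.lt_inf_iff ENNReal.zero_lt_top).2 fun z hz => ?_)
    have hz' : level u z = 0 := (Finset.mem_filter.1 hz).2
    exact pos_iff_ne_zero.2 (h.avgPair_noBacktrack_ne_zero (by rw [hz']; simp [level]))
  · intro x y hxy
    by_cases hfar : ∃ j, 2 * (R * N : ℤ) < |y j - x j|
    · obtain ⟨j, hj⟩ := hfar
      refine (min_le_left _ _).trans ?_
      have h3 := le_avgPair_noBacktrack_of_far h.bound hj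
      rw [← hηdef] at h3
      have h4 : η ^ 2 / 2 + η ^ 2 / 2 ≤ avgPair ν x y (noBacktrack u) + η ^ 2 / 2 := by
        rw [ENNReal.add_halves]
        exact h3.trans (add_le_add le_rfl hN.le)
      exact (ENNReal.add_le_add_iff_right (ENNReal.div_ne_top hηtop (by simp))).1 h4
    · push Not at hfar
      refine (min_le_right _ _).trans ?_
      have h3 := avgPair_noBacktrack_translate ν u 0 (y - x) x
      rw [add_zero, add_sub_cancel] at h3
      rw [h3]
      refine Finset.inf_le (f := fun z => avgPair ν 0 z (noBacktrack u)) (b := y - x) ?_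
      rw [hF, Finset.mem_filter, Set.Finite.mem_toFinset]
      refine ⟨⟨fun j => ?_, fun j => ?_⟩, by rw [level_sub, hxy, sub_self]⟩
      · exact (abs_le.1 (hfar j)).1
      · exact (abs_le.1 (hfar j)).2

/-! ## Finite paths with prescribed levels -/

/-- There is a path of `n` allowed steps from `x` to `y` that jumps only from levels in `[L, ℓ)`. -/
def Reach {d : ℕ} (ν : Measure (ProbVec d)) (u : Site d) (L ℓ : ℤ) (n : ℕ) (x y : Site d) : Prop :=
  ∃ a : Path d, a 0 = x ∧ a n = y ∧
    ∀ i < n, a (i + 1) - a i ∈ steps ν ∧ L ≤ level u (a i) ∧ level u (a i) < ℓ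

theorem Reach.refl {d : ℕ} (ν : Measure (ProbVec d)) (u : Site d) (L ℓ : ℤ) (x : Site d) :
    Reach ν u L ℓ 0 x x := ⟨fun _ => x, rfl, rfl, fun i hi => by omega⟩

theorem Reach.step {d : ℕ} {ν : Measure (ProbVec d)} {u : Site d} {L ℓ : ℤ} {x s : Site d}
    (hs : s ∈ steps ν) (h1 : L ≤ level u x) (h2 : level u x < ℓ) :
    Reach ν u L ℓ 1 x (x + s) := by
  refine ⟨fun i => if i = 0 then x else x + s, by simp, by simp, fun i hi => ?_⟩
  have : i = 0 := by omega
  subst this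
  simpa using ⟨hs, h1, h2⟩

theorem Reach.trans {d : ℕ} {ν : Measure (ProbVec d)} {u : Site d} {L ℓ : ℤ} {m n : ℕ}
    {x y z : Site d} (h : Reach ν u L ℓ m x y) (h' : Reach ν u L ℓ n y z) :
    Reach ν u L ℓ (m + n) x z := by
  obtain ⟨a, rfl, ha, ha'⟩ := h
  obtain ⟨b, hb, rfl, hb'⟩ := h'
  have h0 : b 0 = a m := hb.trans ha.symm
  refine ⟨splice m a b, splice_of_le h0 (Nat.zero_le _), splice_add m n a b, fun i hi => ?_⟩
  rcases lt_or_ge i m with him | him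
  · rw [splice_of_le h0 him.le, splice_of_le h0 (show i + 1 ≤ m from him)]
    exact ha' i him
  · obtain ⟨k, rfl⟩ := Nat.exists_eq_add_of_le him
    rw [splice_add, add_assoc, splice_add]
    exact hb' k (by omega)

theorem Reach.nsmul {d : ℕ} {ν : Measure (ProbVec d)} {u : Site d} {L ℓ : ℤ} {x s : Site d}
    (hs : s ∈ steps ν) (hpos : 0 < level u s) (k : ℕ) (h1 : L ≤ level u x)
    (h2 : level u x + k * level u s ≤ ℓ) : Reach ν u L ℓ k x (x + k • s) := by
  induction k generalizing x with
  | zero => simpa using Reach.refl ν u L ℓ x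
  | succ k ih =>
    have hk : (0 : ℤ) ≤ k * level u s := by positivity
    push_cast at h2
    have h3 := Reach.step (ν := ν) (u := u) (L := L) (ℓ := ℓ) (x := x) hs h1 (by linarith)
    have h4 := ih (x := x + s) (by rw [level_add]; omega) (by rw [level_add]; linarith)
    have h5 := h3.trans h4
    rwa [add_comm 1 k, add_assoc, ← succ_nsmul'] at h5

theorem Reach.list {d : ℕ} {ν : Measure (ProbVec d)} {u : Site d} {R : ℕ} (hR : StepBound ν u R)
    {L ℓ : ℤ} (t : List (Site d)) (ht : ∀ s ∈ t, s ∈ steps ν) {x : Site d}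
    (h1 : L + R * t.length ≤ level u x) (h2 : level u x + R * t.length < ℓ) :
    Reach ν u L ℓ t.length x (x + t.sum) := by
  induction t generalizing x with
  | nil => simpa using Reach.refl ν u L ℓ x
  | cons s t ih =>
    have hs := ht s (by simp)
    have hb := abs_le.1 (hR s hs).2
    have hk : (0 : ℤ) ≤ R * t.length := by positivity
    simp only [List.length_cons] at h1 h2 ⊢
    push_cast at h1 h2
    rw [mul_add, mul_one] at h1 h2
    have h3 := Reach.step (ν := ν) (u := u) (L := L) (ℓ := ℓ) (x := x) hs (by linarith)
      (by linarith)
    have h4 := ih (fun s hs => ht s (by simp [hs])) (x := x + s) (by rw [level_add]; linarith)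
      (by rw [level_add]; linarith)
    have h5 := h3.trans h4
    rwa [add_comm 1, add_assoc, ← List.sum_cons] at h5

theorem level_sum_le {d : ℕ} {ν : Measure (ProbVec d)} {u : Site d} {R : ℕ} (hR : StepBound ν u R)
    (t : List (Site d)) (ht : ∀ s ∈ t, s ∈ steps ν) : |level u t.sum| ≤ R * t.length := by
  induction t with
  | nil => simp [level]
  | cons s t ih =>
    rw [List.sum_cons, level_add, List.length_cons]
    push_cast
    have h1 := ih fun s hs => ht s (by simp [hs])
    have h2 := (hR s (ht s (by simp))).2
    have := abs_add_le (level u s) (level u t.sum)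
    linarith

/-! ### Steering both walks to a common level -/

/-- The levels that can be attained by sums of allowed steps. -/
def attainable {d : ℕ} (ν : Measure (ProbVec d)) (u : Site d) : Set ℤ :=
  level u '' (AddSubmonoid.closure (steps ν) : Set (Site d))

theorem level_mul {d : ℕ} (u : Site d) (k : ℕ) (x : Site d) :
    level u (k • x) = k * level u x := by
  induction k with
  | zero => simp [level]
  | succ k ih => rw [succ_nsmul, level_add, ih]; push_cast; ring

/-- If `l` is the level of a sum `v` of steps, then `p - 1` further copies of `v` bring the total to
`p * l`. Only the residue of `l` modulo `p` matters, so one list per residue suffices and the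
lengths are bounded. -/
theorem exists_correction {d : ℕ} (ν : Measure (ProbVec d)) (u : Site d) {p : ℤ} (hp : 0 < p) :
    ∃ B : ℕ, ∀ l ∈ attainable ν u, ∃ t : List (Site d), (∀ s ∈ t, s ∈ steps ν) ∧ t.length ≤ B ∧
      p ∣ l + level u t.sum := by
  classical
  have key : ∀ l ∈ attainable ν u, ∃ t : List (Site d), (∀ s ∈ t, s ∈ steps ν) ∧
      p ∣ l % p + level u t.sum := by
    rintro l ⟨v, hv, rfl⟩
    obtain ⟨t, ht, hsum⟩ := AddSubmonoid.exists_list_of_mem_closure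
      (AddSubmonoid.nsmul_mem _ hv (p.toNat - 1))
    refine ⟨t, ht, ?_⟩
    rw [hsum, level_mul]
    have h1 : ((p.toNat - 1 : ℕ) : ℤ) = p - 1 := by omega
    have h2 := Int.emod_add_mul_ediv (level u v) p
    rw [h1]
    refine ⟨level u v - level u v / p, ?_⟩
    linear_combination h2
  choose! f hf hf' using key
  set good : ℤ → Prop := fun i => ∃ t : List (Site d), (∀ s ∈ t, s ∈ steps ν) ∧
    p ∣ i + level u t.sum with hgood
  set len : ℤ → ℕ := fun i => if h : good i then h.choose.length else 0 with hlen
  refine ⟨(Finset.Ico 0 p).sup len, fun l hl => ?_⟩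
  have hg : good (l % p) := ⟨f l, hf l hl, hf' l hl⟩
  obtain ⟨h1, h2⟩ := hg.choose_spec
  refine ⟨hg.choose, h1, ?_, ?_⟩
  · have : len (l % p) = hg.choose.length := dif_pos hg
    rw [← this]
    exact Finset.le_sup (Finset.mem_Ico.2 ⟨Int.emod_nonneg _ hp.ne', Int.emod_lt_of_pos _ hp⟩)
  · have h3 := Int.emod_add_mul_ediv l p
    have : l + level u hg.choose.sum = (l % p + level u hg.choose.sum) + p * (l / p) := by
      linear_combination -h3
    rw [this]
    exact dvd_add h2 (dvd_mul_right _ _)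

/-- From every attainable level in `[L, L + R]` the walk can reach, with a bounded number of steps
and without going below `L`, a level `ℓ` that depends on `L` only. -/
theorem exists_reach {d : ℕ} {ν : Measure (ProbVec d)} {u : Site d} {R : ℕ} (hR : StepBound ν u R)
    (hs : ∃ s ∈ steps ν, 0 < level u s) : ∃ Q N : ℕ, ∀ L : ℤ, ∃ ℓ : ℤ, L + R < ℓ ∧ ℓ ≤ L + Q ∧
      ∀ x : Site d, L ≤ level u x → level u x ≤ L + R → level u x ∈ attainable ν u →
        ∃ n ≤ N, ∃ y, level u y = ℓ ∧ Reach ν u L ℓ n x y := by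
  obtain ⟨s, hs, hpos⟩ := hs
  set p := level u s with hp
  obtain ⟨B, hB⟩ := exists_correction ν u hpos
  have hp' : ((p.toNat : ℕ) : ℤ) = p := by omega
  -- The route has three stages: climb by `R * B` copies of `s`, correct the residue modulo `p` with
  -- at most `B` steps, then climb by copies of `s` to the target. The first climb keeps the
  -- correction above `L`; `q` leaves room for it below the target, which is the least multiple of
  -- `p` above `L + q`.
  set q : ℕ := R + R * B * p.toNat + 2 * (R * B) with hq
  refine ⟨q + p.toNat, R * B + B + (q + p.toNat), fun L => ⟨p * ((L + q) / p + 1), ?_, ?_, ?_⟩⟩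
  · have h1 := Int.emod_add_mul_ediv (L + q) p
    have h2 := Int.emod_lt_of_pos (L + q) hpos
    have h3 : (R : ℤ) ≤ q := by exact_mod_cast (show R ≤ q by omega)
    have : p * ((L + q) / p + 1) = p * ((L + q) / p) + p := by ring
    omega
  · have h1 := Int.emod_add_mul_ediv (L + q) p
    have h2 := Int.emod_nonneg (L + q) hpos.ne'
    have : p * ((L + q) / p + 1) = p * ((L + q) / p) + p := by ring
    push_cast
    omega
  · intro x hx1 hx2 hx3
    obtain ⟨t, ht, htB, htp⟩ := hB _ hx3
    set ℓ := p * ((L + q) / p + 1) with hℓ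
    have hℓq : L + q < ℓ ∧ ℓ ≤ L + q + p := by
      have h1 := Int.emod_add_mul_ediv (L + q) p
      have h2 := Int.emod_nonneg (L + q) hpos.ne'
      have h3 := Int.emod_lt_of_pos (L + q) hpos
      have : p * ((L + q) / p + 1) = p * ((L + q) / p) + p := by ring
      omega
    have hqv : (q : ℤ) = R + R * B * p + 2 * (R * B) := by
      rw [hq]; push_cast; rw [hp']
    have hRBp : (R * B : ℤ) ≤ R * B * p := le_mul_of_one_le_right (by positivity) hpos
    have hRt : (R * t.length : ℤ) ≤ R * B := by gcongr
    have hts := abs_le.1 (level_sum_le hR t ht)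
    have hRB : (0 : ℤ) ≤ R * B := by positivity
    have r1 := Reach.nsmul (L := L) (ℓ := ℓ) (x := x) hs hpos (R * B) hx1 (by
      push_cast; rw [← hp]; linarith)
    have l1 : level u (x + (R * B) • s) = level u x + R * B * p := by
      rw [level_add, level_mul]; push_cast; rfl
    have r2 := Reach.list hR (L := L) (ℓ := ℓ) t ht (x := x + (R * B) • s)
      (by rw [l1]; linarith) (by rw [l1]; linarith)
    set z := x + (R * B) • s + t.sum with hz
    have l2 : level u z = level u x + R * B * p + level u t.sum := by rw [hz, level_add, l1]
    obtain ⟨k, hk⟩ : p ∣ ℓ - level u z := by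
      rw [l2]
      have e : ℓ - (level u x + R * B * p + level u t.sum)
          = p * ((L + q) / p + 1) - R * B * p - (level u x + level u t.sum) := by rw [hℓ]; ring
      rw [e]
      exact dvd_sub (dvd_sub (dvd_mul_right _ _) (dvd_mul_left _ _)) htp
    have hk0 : 0 ≤ k := by
      by_contra hneg
      have : p * k < 0 := mul_neg_of_pos_of_neg hpos (not_le.1 hneg)
      linarith
    lift k to ℕ using hk0
    have l3 : level u (z + k • s) = ℓ := by
      rw [level_add, level_mul, ← hp]; linarith
    have r3 := Reach.nsmul (L := L) (ℓ := ℓ) (x := z) hs hpos k (by rw [l2]; linarith)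
      (by rw [← hp]; linarith)
    have hkq : k ≤ q + p.toNat := by
      have h1 : (k : ℤ) ≤ p * k := le_mul_of_one_le_left (by positivity) hpos
      have h2 : L ≤ level u z := by rw [l2]; linarith
      have : (k : ℤ) ≤ ((q + p.toNat : ℕ) : ℤ) := by push_cast; omega
      exact_mod_cast this
    exact ⟨R * B + t.length + k, by omega, z + k • s, l3, (r1.trans r2).trans r3⟩

/-- A shortest path is self-avoiding. -/
theorem Reach.exists_injOn {d : ℕ} {ν : Measure (ProbVec d)} {u : Site d} {L ℓ : ℤ} {n : ℕ}
    {x y : Site d} (h : Reach ν u L ℓ n x y) : ∃ m ≤ n, ∃ a : Path d, a 0 = x ∧ a m = y ∧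
      (∀ i < m, a (i + 1) - a i ∈ steps ν ∧ L ≤ level u (a i) ∧ level u (a i) < ℓ) ∧
      ∀ i j, i < j → j ≤ m → a i ≠ a j := by
  classical
  have hex : ∃ m, Reach ν u L ℓ m x y := ⟨n, h⟩
  obtain ⟨a, ha0, ha1, ha2⟩ := Nat.find_spec hex
  refine ⟨Nat.find hex, Nat.find_min' hex h, a, ha0, ha1, ha2, fun i j hij hj heq => ?_⟩
  set m := Nat.find hex
  refine Nat.find_min hex (m := i + (m - j)) (by omega) ?_
  have r1 : Reach ν u L ℓ i x (a i) := ⟨a, ha0, rfl, fun k hk => ha2 k (by omega)⟩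
  have r2 : Reach ν u L ℓ (m - j) (a i) y := ⟨shift j a, heq.symm, by
    rw [shift, Nat.add_sub_cancel' hj, ha1], fun k hk => ha2 (j + k) (by omega)⟩
  exact r1.trans r2

/-- A self-avoiding path leaves each site once, so its step probabilities are independent and its
averaged weight has a lower bound depending only on its length. -/
theorem lintegral_weight_of_injOn {d : ℕ} (ν : Measure (ProbVec d)) [IsProbabilityMeasure ν]
    {m : ℕ} {a : Path d} (h : ∀ i j, i < j → j ≤ m → a i ≠ a j) :
    ∫⁻ ω, weight ω m a ∂(envLaw ν)
      = ∏ i ∈ Finset.range m, ∫⁻ p, p.1 (a (i + 1) - a i) ∂ν := by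
  induction m with
  | zero => simp [weight]
  | succ m ih =>
    rw [Finset.prod_range_succ, ← ih fun i j hij hj => h i j hij (by omega)]
    have hd : Disjoint (exits m a) (exits 1 (shift m a)) := by
      refine Finset.disjoint_left.2 fun s hs hs' => ?_
      obtain ⟨i, hi, rfl⟩ := mem_exits.1 hs
      obtain ⟨j, hj, hj'⟩ := mem_exits.1 hs'
      obtain rfl : j = 0 := by omega
      exact h i m hi (by omega) hj'.symm
    simp_rw [weight_add]
    rw [lintegral_weight_mul_of_disjoint ν hd, ← lintegral_env_apply ν (a m)]
    congr 1
    refine lintegral_congr fun ω => ?_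
    simp [weight, shift]

theorem StepBound.finite_steps {d : ℕ} {ν : Measure (ProbVec d)} {u : Site d} {R : ℕ}
    (hR : StepBound ν u R) : (steps ν).Finite :=
  (Set.finite_Icc (fun _ : Fin d => -(R : ℤ)) (fun _ => (R : ℤ))).subset fun z hz =>
    ⟨fun i => (abs_le.1 ((hR z hz).1 i)).1, fun i => (abs_le.1 ((hR z hz).1 i)).2⟩

theorem StepBound.exists_le_lintegral {d : ℕ} {ν : Measure (ProbVec d)} [IsProbabilityMeasure ν]
    {u : Site d} {R : ℕ} (hR : StepBound ν u R) : ∃ α : ℝ≥0∞, 0 < α ∧ α ≤ 1 ∧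
      ∀ z ∈ steps ν, α ≤ ∫⁻ p, p.1 z ∂ν := by
  refine ⟨min 1 (hR.finite_steps.toFinset.inf fun z => ∫⁻ p, p.1 z ∂ν), ?_, min_le_left _ _, ?_⟩
  · refine lt_min one_pos ((Finset.lt_inf_iff ENNReal.zero_lt_top).2 fun z hz => ?_)
    exact pos_iff_ne_zero.2 (hR.finite_steps.mem_toFinset.1 hz)
  · intro z hz
    exact (min_le_right _ _).trans
      (Finset.inf_le (f := fun z => ∫⁻ p, p.1 z ∂ν) (hR.finite_steps.mem_toFinset.2 hz))

/-- From every attainable level in `[L, L + R]` the averaged walk hits, with probability bounded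
below and without going below `L`, a level `ℓ` that depends on `L` only. -/
theorem Ballistic.exists_firstHit {d : ℕ} {ν : Measure (ProbVec d)} {u : Site d} {R : ℕ}
    (h : Ballistic ν u R) : ∃ (Q : ℕ) (c : ℝ≥0∞), 0 < c ∧ c ≤ 1 ∧ ∀ L : ℤ, ∃ ℓ : ℤ, L ≤ ℓ ∧
      ℓ ≤ L + Q ∧ ∀ x : Site d, L ≤ level u x → level u x ≤ L + R → level u x ∈ attainable ν u →
        ∃ (n : ℕ) (a : Path d), a 0 = x ∧ FirstHit u ℓ a n ∧ (∀ i < n, L ≤ level u (a i)) ∧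
          c ≤ ∫⁻ ω, weight ω n a ∂(envLaw ν) := by
  have := h.prob
  obtain ⟨Q, N, hQ⟩ := exists_reach h.bound h.exists_step_pos
  obtain ⟨α, hα, hα1, hα'⟩ := h.bound.exists_le_lintegral
  refine ⟨Q, α ^ N, ENNReal.pow_pos hα N, pow_le_one' hα1 N, fun L => ?_⟩
  obtain ⟨ℓ, h1, h2, h3⟩ := hQ L
  refine ⟨ℓ, by omega, h2, fun x hx1 hx2 hx3 => ?_⟩
  obtain ⟨n, hn, y, hy, hr⟩ := h3 x hx1 hx2 hx3
  obtain ⟨m, hm, a, ha0, ha1, ha2, hinj⟩ := hr.exists_injOn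
  refine ⟨m, a, ha0, ⟨by rw [ha1, hy], fun i hi => (ha2 i hi).2.2⟩, fun i hi => (ha2 i hi).2.1, ?_⟩
  rw [lintegral_weight_of_injOn ν hinj]
  calc α ^ N ≤ α ^ m := pow_le_pow_right_of_le_one' hα1 (hm.trans hn)
    _ = ∏ i ∈ Finset.range m, α := by simp
    _ ≤ _ := Finset.prod_le_prod' fun i hi => hα' _ (ha2 i (Finset.mem_range.1 hi)).1

/-- Both walks of a pair can reach a common fresh level, with probability bounded below. -/
def HitsTogether {d : ℕ} (ν : Measure (ProbVec d)) (u : Site d) (R : ℕ)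
    (P : Site d → Site d → Measure (Path d × Path d)) (Q : ℕ) (c : ℝ≥0∞) : Prop :=
  ∀ (L : ℤ) (x y : Site d), L ≤ level u x → level u x ≤ L + R → level u x ∈ attainable ν u →
    L ≤ level u y → level u y ≤ L + R → level u y ∈ attainable ν u →
    ∃ (ℓ : ℤ) (k l : ℕ) (a b : Path d), L ≤ ℓ ∧ ℓ ≤ L + Q ∧ FirstHit u ℓ a k ∧ FirstHit u ℓ b l ∧
      (∀ i < k, L ≤ level u (a i)) ∧ (∀ i < l, L ≤ level u (b i)) ∧
      c ≤ P x y (cyl k a ×ˢ cyl l b)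

/-- The target level of `exists_firstHit` depends on `L` alone, so both walks aim at the same level
and independence multiplies the bounds. -/
theorem Ballistic.hitsTogether_prod {d : ℕ} {ν : Measure (ProbVec d)} {u : Site d} {R : ℕ}
    (h : Ballistic ν u R) : ∃ (Q : ℕ) (c : ℝ≥0∞), 0 < c ∧ c ≤ 1 ∧
      HitsTogether ν u R (fun x y => (avg ν x).prod (avg ν y)) Q c := by
  have := h.prob
  obtain ⟨Q, c, hc, hc1, hQ⟩ := h.exists_firstHit
  refine ⟨Q, c * c, ENNReal.mul_pos hc.ne' hc.ne', mul_le_one' hc1 hc1, ?_⟩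
  intro L x y hx1 hx2 hx3 hy1 hy2 hy3
  obtain ⟨ℓ, h1, h2, h3⟩ := hQ L
  obtain ⟨k, a, rfl, ha1, ha2, ha3⟩ := h3 x hx1 hx2 hx3
  obtain ⟨l, b, rfl, hb1, hb2, hb3⟩ := h3 y hy1 hy2 hy3
  refine ⟨ℓ, k, l, a, b, h1, h2, ha1, hb1, ha2, hb2, ?_⟩
  rw [Measure.prod_prod, avg_cyl, avg_cyl]
  gcongr

/-- If the two prescribed paths are disjoint, they are independent. If they meet, the second is
rerouted along the first from the first meeting on; it still ends freshly at the same level, and the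
merging bound gives `c ^ 2 * c`. -/
theorem Ballistic.hitsTogether_avgPair {d : ℕ} {ν : Measure (ProbVec d)} {u : Site d} {R : ℕ}
    (h : Ballistic ν u R) : ∃ (Q : ℕ) (c : ℝ≥0∞), 0 < c ∧ c ≤ 1 ∧
      HitsTogether ν u R (avgPair ν) Q c := by
  have := h.prob
  obtain ⟨Q, c, hc, hc1, hQ⟩ := h.exists_firstHit
  refine ⟨Q, c ^ 2 * c, ENNReal.mul_pos (ENNReal.pow_pos hc 2).ne' hc.ne',
    mul_le_one' (pow_le_one' hc1 2) hc1, ?_⟩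
  intro L x y hx1 hx2 hx3 hy1 hy2 hy3
  obtain ⟨ℓ, h1, h2, h3⟩ := hQ L
  obtain ⟨k, a, rfl, ha1, ha2, ha3⟩ := h3 x hx1 hx2 hx3
  obtain ⟨l, b, rfl, hb1, hb2, hb3⟩ := h3 y hy1 hy2 hy3
  by_cases hmeet : ∃ j ≤ l, ∃ i ≤ k, b j = a i
  · classical
    obtain ⟨hjl, i, hik, hji⟩ := Nat.find_spec hmeet
    have hmin := fun j' (hj' : j' < Nat.find hmeet) => Nat.find_min hmeet hj'
    set j := Nat.find hmeet
    have h0 : shift i a 0 = b j := hji.symm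
    have hval : ∀ q < j + (k - i), (∃ q' < l, splice j b (shift i a) q = b q') ∨
        ∃ q' < k, splice j b (shift i a) q = a q' := by
      intro q hq
      rcases lt_or_ge q j with hqj | hqj
      · exact Or.inl ⟨q, by omega, splice_of_lt _ _ hqj⟩
      · obtain ⟨r, rfl⟩ := Nat.exists_eq_add_of_le hqj
        exact Or.inr ⟨i + r, by omega, by rw [splice_add]; rfl⟩
    refine ⟨ℓ, k, j + (k - i), a, splice j b (shift i a), h1, h2, ha1, ⟨?_, ?_⟩, ha2, ?_, ?_⟩
    · rw [splice_add, shift, Nat.add_sub_cancel' hik]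
      exact ha1.1
    · intro q hq
      rcases hval q hq with ⟨q', hq', hv⟩ | ⟨q', hq', hv⟩ <;> rw [hv]
      exacts [hb1.2 q' hq', ha1.2 q' hq']
    · intro q hq
      rcases hval q hq with ⟨q', hq', hv⟩ | ⟨q', hq', hv⟩ <;> rw [hv]
      exacts [hb2 q' hq', ha2 q' hq']
    · have hb0 : b 0 = splice j b (shift i a) 0 := (splice_of_le h0 (Nat.zero_le _)).symm
      rw [hb0, avgPair_cyl]
      refine le_trans ?_ (le_lintegral_weight_merge ν hik hji ?_)
      · gcongr
        refine hb3.trans (lintegral_mono fun ω => ?_)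
        obtain ⟨r, hr⟩ := Nat.exists_eq_add_of_le hjl
        rw [hr, weight_add]
        exact mul_le_of_le_one_right' (weight_le_one _ _ _)
      · refine Finset.disjoint_left.2 fun s hs hs' => ?_
        obtain ⟨i', hi', rfl⟩ := mem_exits.1 hs
        obtain ⟨j', hj', hj''⟩ := mem_exits.1 hs'
        exact hmin j' hj' ⟨by omega, i', hi'.le, hj''⟩
  · refine ⟨ℓ, k, l, a, b, h1, h2, ha1, hb1, ha2, hb2, ?_⟩
    rw [avgPair_cyl, lintegral_weight_mul_of_disjoint]
    · calc c ^ 2 * c ≤ c * c := by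
            gcongr
            calc c ^ 2 = c * c := sq c
              _ ≤ c := mul_le_of_le_one_right' hc1
        _ ≤ _ := by gcongr
    · refine Finset.disjoint_left.2 fun s hs hs' => hmeet ?_
      obtain ⟨i', hi', rfl⟩ := mem_exits.1 hs
      obtain ⟨j', hj', hj''⟩ := mem_exits.1 hs'
      exact ⟨j', hj'.le, i', hi'.le, hj''⟩

/-! ## Geometric bounds -/

/-- One round of a geometric trial: the `A i` partition the situations before the round, and `G i`
is success with conditional probability at least `c`. -/
theorem measure_iUnion_diff_le {Ω ι : Type*} [MeasurableSpace Ω] [Countable ι] {μ : Measure Ω}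
    [IsFiniteMeasure μ] {A G : ι → Set Ω} (hA : ∀ i, MeasurableSet (A i))
    (hG : ∀ i, MeasurableSet (G i)) (hd : Pairwise (Function.onFun Disjoint A)) {c : ℝ≥0∞}
    (h : ∀ i, c * μ (A i) ≤ μ (A i ∩ G i)) : μ (⋃ i, A i \ G i) ≤ (1 - c) * μ (⋃ i, A i) := by
  calc μ (⋃ i, A i \ G i) ≤ ∑' i, μ (A i \ G i) := measure_iUnion_le _
    _ ≤ ∑' i, (1 - c) * μ (A i) := by
        refine ENNReal.tsum_le_tsum fun i => ?_
        rw [ENNReal.sub_mul fun _ _ => measure_ne_top _ _, one_mul,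
          ← Set.sdiff_inter_self_eq_sdiff, Set.inter_comm,
          measure_sdiff Set.inter_subset_left ((hA i).inter (hG i)).nullMeasurableSet
            (measure_ne_top _ _)]
        exact tsub_le_tsub_left (h i) _
    _ = _ := by rw [ENNReal.tsum_mul_left, measure_iUnion hd hA]

theorem measurableSet_commonFresh {d : ℕ} (u : Site d) (ℓ : ℤ) :
    MeasurableSet {w : Path d × Path d | CommonFresh u w.1 w.2 ℓ} := by
  have : {w : Path d × Path d | CommonFresh u w.1 w.2 ℓ}
      = ⋃ m, ⋃ n, {w | FirstHit u ℓ w.1 m ∧ FirstHit u ℓ w.2 n} := by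
    ext w
    simp only [Set.mem_ofPred_eq, commonFresh_iff, Set.mem_iUnion]
  rw [this]
  refine MeasurableSet.iUnion fun m => MeasurableSet.iUnion fun n =>
    measurableSet_of_determined (measurable_seg₂ m n) fun w w' h hw => ?_
  obtain ⟨h1, h2⟩ := seg₂_eq_iff.1 h
  exact ⟨hw.1.congr h1, hw.2.congr h2⟩

theorem Enters.congr {d : ℕ} {u : Site d} {ℓ : ℤ} {x x' : Path d} {m : ℕ}
    (h : Enters u ℓ x m) (hx : ∀ i ≤ m, x i = x' i) : Enters u ℓ x' m :=
  ⟨by rw [← hx m le_rfl]; exact h.1, fun i hi => by rw [← hx i hi.le]; exact h.2 i hi⟩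

theorem FirstHit.lt_of_enters {d : ℕ} {u : Site d} {ℓ L : ℤ} {x : Path d} {i m : ℕ}
    (h : FirstHit u ℓ x i) (h' : Enters u L x m) (hl : ℓ < L) : i < m := by
  by_contra hcon
  rcases (not_lt.1 hcon).lt_or_eq with hlt | rfl
  · have := h.2 m hlt
    have := h'.1
    omega
  · have := h.1
    have := h'.1
    omega

theorem CommonFresh.congr_of_enters {d : ℕ} {u : Site d} {ℓ L : ℤ} {x y x' y' : Path d} {m n : ℕ}
    (h : CommonFresh u x y ℓ) (hx : Enters u L x m) (hy : Enters u L y n) (hl : ℓ < L)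
    (hxx : ∀ i ≤ m, x i = x' i) (hyy : ∀ i ≤ n, y i = y' i) : CommonFresh u x' y' ℓ := by
  obtain ⟨i, j, hi, hj⟩ := commonFresh_iff.1 h
  have h1 := hi.lt_of_enters hx hl
  have h2 := hj.lt_of_enters hy hl
  exact commonFresh_iff.2 ⟨i, j, hi.congr fun k hk => hxx k (by omega),
    hj.congr fun k hk => hyy k (by omega)⟩

theorem FirstHit.of_shift {d : ℕ} {u : Site d} {ℓ L : ℤ} {x : Path d} {m k : ℕ}
    (hx : Enters u L x m) (h : FirstHit u ℓ (shift m x) k) (hl : L ≤ ℓ) :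
    FirstHit u ℓ x (m + k) := by
  refine ⟨h.1, fun i hi => ?_⟩
  rcases lt_or_ge i m with him | him
  · exact (hx.2 i him).trans_le hl
  · obtain ⟨j, rfl⟩ := Nat.exists_eq_add_of_le him
    exact h.2 j (by omega)

/-- The path starts at `z` and takes `m` allowed steps. -/
def GoodUpTo {d : ℕ} (ν : Measure (ProbVec d)) (z : Site d) (m : ℕ) (x : Path d) : Prop :=
  x 0 = z ∧ ∀ i < m, x (i + 1) - x i ∈ steps ν

theorem GoodUpTo.attainable {d : ℕ} {ν : Measure (ProbVec d)} {u z : Site d} {m : ℕ} {x : Path d}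
    (h : GoodUpTo ν z m x) (hz : level u z = 0) : level u (x m) ∈ attainable ν u := by
  refine ⟨x m - z, ?_, by rw [level_sub, hz, sub_zero]⟩
  obtain ⟨h0, h⟩ := h
  clear hz
  induction m with
  | zero => rw [h0, sub_self]; exact zero_mem _
  | succ m ih =>
    have : x (m + 1) - z = (x m - z) + (x (m + 1) - x m) := by abel
    rw [this]
    exact add_mem (ih fun i hi => h i (by omega)) (AddSubmonoid.subset_closure (h m (by omega)))

theorem GoodUpTo.level_le {d : ℕ} {ν : Measure (ProbVec d)} {u z : Site d} {R m : ℕ} {x : Path d}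
    (hR : StepBound ν u R) (h : GoodUpTo ν z m x) (hz : level u z = 0) {L : ℤ} (hL : 0 ≤ L)
    (hx : Enters u L x m) : level u (x m) ≤ L + R := by
  rcases m with _ | m
  · rw [h.1, hz]
    have := Nat.zero_le R
    omega
  · have h1 := hR.level_succ_le (h.2 m (by omega))
    have h2 := hx.2 m (by omega)
    omega

/-- Both paths enter `{level ≥ L}`, but no level in `[a, L)` is common fresh. -/
def NoFreshBefore {d : ℕ} (ν : Measure (ProbVec d)) (u x y : Site d) (a L : ℤ) (m n : ℕ) :
    Set (Path d × Path d) :=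
  {w | (Enters u L w.1 m ∧ Enters u L w.2 n) ∧ (GoodUpTo ν x m w.1 ∧ GoodUpTo ν y n w.2) ∧
    ∀ ℓ, a ≤ ℓ → ℓ < L → ¬ CommonFresh u w.1 w.2 ℓ}

theorem NoFreshBefore.congr {d : ℕ} {ν : Measure (ProbVec d)} {u x y : Site d} {a L : ℤ} {m n : ℕ}
    {w w' : Path d × Path d} (h1 : ∀ i ≤ m, w.1 i = w'.1 i) (h2 : ∀ i ≤ n, w.2 i = w'.2 i)
    (h : w ∈ NoFreshBefore ν u x y a L m n) : w' ∈ NoFreshBefore ν u x y a L m n := by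
  obtain ⟨⟨h3, h4⟩, ⟨⟨h5, h6⟩, ⟨h7, h8⟩⟩, h9⟩ := h
  refine ⟨⟨h3.congr h1, h4.congr h2⟩, ⟨⟨by rw [← h1 0 (Nat.zero_le _)]; exact h5, fun i hi => ?_⟩,
    ⟨by rw [← h2 0 (Nat.zero_le _)]; exact h7, fun i hi => ?_⟩⟩, fun ℓ hl hl' hcf => ?_⟩
  · rw [← h1 i hi.le, ← h1 (i + 1) hi]; exact h6 i hi
  · rw [← h2 i hi.le, ← h2 (i + 1) hi]; exact h8 i hi
  · exact h9 ℓ hl hl' (hcf.congr_of_enters (h3.congr h1) (h4.congr h2) hl'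
      (fun i hi => (h1 i hi).symm) fun i hi => (h2 i hi).symm)

/-- On entering `{level ≥ L}` both walks overshoot by at most `R` and see a fresh environment, so
`HitsTogether` produces a common fresh level in `[L, L + Q]` with conditional probability at least
`c`. The shift by `Q + 1` moves past that block. -/
theorem FreshLaw.noFresh_step {d : ℕ} {ν : Measure (ProbVec d)} {u : Site d} {R : ℕ}
    (hR : StepBound ν u R)
    {P : Site d → Site d → Measure (Path d × Path d)} (hP : FreshLaw ν u P) {Q : ℕ} {c : ℝ≥0∞}
    (hc : HitsTogether ν u R P Q c) {x y : Site d} (hx : level u x = 0) (hy : level u y = 0)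
    {a L : ℤ} (hL : 0 ≤ L) (haL : a ≤ L) :
    P x y (⋃ i : ℕ × ℕ, NoFreshBefore ν u x y a (L + (Q + 1 : ℕ)) i.1 i.2)
      ≤ (1 - c) * P x y (⋃ i : ℕ × ℕ, NoFreshBefore ν u x y a L i.1 i.2) := by
  have := hP.prob x y
  set G : Set (Path d × Path d) := ⋃ ℓ ∈ Set.Icc L (L + Q), {w | CommonFresh u w.1 w.2 ℓ} with hG
  have hGm : MeasurableSet G :=
    MeasurableSet.biUnion (Set.to_countable _) fun ℓ _ => measurableSet_commonFresh u ℓ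
  refine le_trans (measure_mono ?_) (measure_iUnion_diff_le
    (A := fun i : ℕ × ℕ => NoFreshBefore ν u x y a L i.1 i.2) (G := fun _ => G)
    (fun i => measurableSet_of_determined (measurable_seg₂ i.1 i.2) fun w w' h hw =>
      NoFreshBefore.congr (seg₂_eq_iff.1 h).1 (seg₂_eq_iff.1 h).2 hw) (fun _ => hGm) ?_ ?_)
  · intro w hw
    obtain ⟨⟨m, n⟩, ⟨h1, h2⟩, ⟨h3, h4⟩, h5⟩ := Set.mem_iUnion.1 hw
    have e1 := h1.1
    have e2 := h2.1
    push_cast at h5 e1 e2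
    obtain ⟨m', hm', h1'⟩ := exists_enters (u := u) (ℓ := L) (x := w.1) (m := m) (by omega)
    obtain ⟨n', hn', h2'⟩ := exists_enters (u := u) (ℓ := L) (x := w.2) (m := n) (by omega)
    refine Set.mem_iUnion.2 ⟨(m', n'), ⟨⟨h1', h2'⟩, ⟨⟨h3.1, fun i hi => h3.2 i (by omega)⟩,
      ⟨h4.1, fun i hi => h4.2 i (by omega)⟩⟩, fun ℓ hl hl' => h5 ℓ hl (by omega)⟩, ?_⟩
    intro hwG
    obtain ⟨ℓ, hℓ, hcf⟩ := Set.mem_iUnion₂.1 hwG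
    exact h5 ℓ (haL.trans hℓ.1) (by have := hℓ.2; omega) hcf
  · rintro ⟨m, n⟩ ⟨m', n'⟩ hne
    refine Set.disjoint_left.2 fun w hw hw' => hne ?_
    have h2 : m = m' := hw.1.1.unique hw'.1.1
    have h3 : n = n' := hw.1.2.unique hw'.1.2
    rw [h2, h3]
  · rintro ⟨m, n⟩
    refine hP.le_inter_of_cyl (L := L) (m := m) (n := n)
      (fun w w' h1 h2 hw => NoFreshBefore.congr h1 h2 hw)
      (fun w hw => ⟨hw.1.1.2, hw.1.2.2⟩) fun w hw => ?_
    obtain ⟨ℓ, k, l, α, β, hl1, hl2, hα, hβ, hα', hβ', hcp⟩ := hc L (w.1 m) (w.2 n) hw.1.1.1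
      (hw.2.1.1.level_le hR hx hL hw.1.1) (hw.2.1.1.attainable hx) hw.1.2.1
      (hw.2.1.2.level_le hR hy hL hw.1.2) (hw.2.1.2.attainable hy)
    refine ⟨k, l, α, β, hα', hβ', hcp, fun w' hw' h1 h2 => ?_⟩
    refine Set.mem_iUnion₂.2 ⟨ℓ, ⟨hl1, hl2⟩, commonFresh_iff.2 ⟨m + k, n + l, ?_, ?_⟩⟩
    · exact FirstHit.of_shift hw'.1.1 (hα.congr fun i hi => (h1 i hi).symm) hl1
    · exact FirstHit.of_shift hw'.1.2 (hβ.congr fun i hi => (h2 i hi).symm) hl1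

/-- Long intervals without common fresh levels are unlikely. -/
theorem FreshLaw.noFresh_le {d : ℕ} {ν : Measure (ProbVec d)} {u : Site d} {R : ℕ}
    (hR : StepBound ν u R)
    {P : Site d → Site d → Measure (Path d × Path d)} (hP : FreshLaw ν u P) {Q : ℕ} {c : ℝ≥0∞}
    (hc : HitsTogether ν u R P Q c) {x y : Site d} (hx : level u x = 0) (hy : level u y = 0)
    (a j : ℕ) :
    P x y (⋃ i : ℕ × ℕ, NoFreshBefore ν u x y a ((a + j * (Q + 1) : ℕ) : ℤ) i.1 i.2)
      ≤ (1 - c) ^ j := by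
  have := hP.prob x y
  induction j with
  | zero => simpa using prob_le_one
  | succ j ih =>
    have h1 := hP.noFresh_step hR hc hx hy (a := a) (L := ((a + j * (Q + 1) : ℕ) : ℤ))
      (by positivity) (by push_cast; linarith [show (0 : ℤ) ≤ j * (Q + 1) by positivity])
    have e : ((a + (j + 1) * (Q + 1) : ℕ) : ℤ)
        = ((a + j * (Q + 1) : ℕ) : ℤ) + (Q + 1 : ℕ) := by push_cast; ring
    rw [e, pow_succ']
    exact h1.trans (by gcongr)

/-- Many unsuccessful attempts at a joint regeneration are unlikely. -/
theorem FreshLaw.freshLevel_ne_top_le {d : ℕ} {ν : Measure (ProbVec d)} [IsProbabilityMeasure ν]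
    {u : Site d} {P : Site d → Site d → Measure (Path d × Path d)} (hP : FreshLaw ν u P)
    {ρ : ℝ≥0∞} (hρ : ∀ x y, level u x = level u y → ρ ≤ P x y (noBacktrack u)) {h : ℤ} (hh : 1 ≤ h)
    (x y : Site d) (k : ℕ) :
    P x y {w | freshLevel h u w.1 w.2 k ≠ ⊤} ≤ (1 - ρ) ^ k := by
  have := hP.prob x y
  induction k with
  | zero => simpa using prob_le_one
  | succ k ih =>
    -- The pieces are indexed by the current fresh level and its two hitting times; they are
    -- disjoint and determined by the paths up to those times. Success of the attempt means that
    -- both walks stay above the level, which makes the next level infinite.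
    set A : ℤ × ℕ × ℕ → Set (Path d × Path d) := fun i => {w | freshLevel h u w.1 w.2 k = i.1 ∧
      FirstHit u i.1 w.1 i.2.1 ∧ FirstHit u i.1 w.2 i.2.2} with hA
    have hdet : ∀ (i : ℤ × ℕ × ℕ) (w w' : Path d × Path d), (∀ j ≤ i.2.1, w.1 j = w'.1 j) →
        (∀ j ≤ i.2.2, w.2 j = w'.2 j) → w ∈ A i → w' ∈ A i := fun i w w' h1 h2 hw =>
      ⟨freshLevel_congr hh hw.1 hw.2.1 hw.2.2 h1 h2, hw.2.1.congr h1, hw.2.2.congr h2⟩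
    have hle := measure_iUnion_diff_le (μ := P x y) (A := A)
      (G := fun i => shift₂ i.2.1 i.2.2 ⁻¹' above u i.1) (c := ρ)
      (fun i => measurableSet_of_determined (measurable_seg₂ i.2.1 i.2.2) fun w w' h hw =>
        hdet i w w' (seg₂_eq_iff.1 h).1 (seg₂_eq_iff.1 h).2 hw)
      (fun i => measurable_shift₂ _ _ (measurableSet_above u i.1)) ?_ ?_
    · rw [pow_succ']
      refine le_trans (measure_mono ?_) (hle.trans ?_)
      · intro w hw
        obtain ⟨ℓ, hℓ⟩ := WithTop.ne_top_iff_exists.1 hw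
        obtain ⟨ℓ', hℓ'⟩ := exists_freshLevel_of_succ hℓ.symm
        obtain ⟨m, n, hm, hn⟩ := commonFresh_iff.1 (freshLevel_spec hh hℓ').2
        refine Set.mem_iUnion.2 ⟨(ℓ', m, n), ⟨hℓ', hm, hn⟩, fun hcon => hw ?_⟩
        rw [freshLevel_succ_of_firstHit hℓ' hm hn]
        refine nextLevel_of_noBacktrack (mem_noBacktrack_iff.2 fun i => ?_)
        have h1 : level u (shift m w.1 0) = ℓ' := hm.1
        have h2 : level u (shift n w.2 0) = ℓ' := hn.1
        rw [h1, h2]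
        exact hcon i
      · gcongr
        refine le_trans (measure_mono ?_) ih
        refine Set.iUnion_subset fun i w hw => ?_
        rw [Set.mem_ofPred_eq, hw.1]
        exact WithTop.coe_ne_top
    · rintro ⟨ℓ, m, n⟩ ⟨ℓ', m', n'⟩ hne
      refine Set.disjoint_left.2 fun w hw hw' => hne ?_
      have h1 : ℓ = ℓ' := WithTop.coe_inj.1 (hw.1.symm.trans hw'.1)
      subst h1
      have h2 : m = m' := hw.2.1.enters.unique hw'.2.1.enters
      have h3 : n = n' := hw.2.2.enters.unique hw'.2.2.enters
      rw [h2, h3]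
    · rintro ⟨ℓ, m, n⟩
      refine hP.le_inter_shift (L := ℓ) (hdet (ℓ, m, n)) (fun w hw => ⟨hw.2.1.2, hw.2.2.2⟩)
        (measurableSet_above u ℓ) (fun w hw => hw) fun w hw => ?_
      exact (hρ _ _ (hw.2.1.1.trans hw.2.2.1.symm)).trans
        (hP.noBacktrack_le_above hw.2.1.1 hw.2.2.1)

/-! ## The tail of the first joint regeneration time -/

/-- Passing to a measurable hull gives the inequality for arbitrary sets, so the exceptional events
of the tail estimate need no measurability proof. -/
theorem FreshLaw.fst_le {d : ℕ} {ν : Measure (ProbVec d)} {u : Site d}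
    {P : Site d → Site d → Measure (Path d × Path d)} (hP : FreshLaw ν u P) (x y : Site d)
    (A : Set (Path d)) : P x y (A ×ˢ Set.univ) ≤ avg ν x A := by
  rw [← measure_toMeasurable A, ← hP.fst x y (measurableSet_toMeasurable _ A)]
  exact measure_mono (Set.prod_mono (subset_toMeasurable _ A) le_rfl)

theorem FreshLaw.snd_le {d : ℕ} {ν : Measure (ProbVec d)} {u : Site d}
    {P : Site d → Site d → Measure (Path d × Path d)} (hP : FreshLaw ν u P) (x y : Site d)
    (A : Set (Path d)) : P x y (Set.univ ×ˢ A) ≤ avg ν y A := by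
  rw [← measure_toMeasurable A, ← hP.snd x y (measurableSet_toMeasurable _ A)]
  exact measure_mono (Set.prod_mono le_rfl (subset_toMeasurable _ A))

/-- A joint regeneration of the pair before time `T`. -/
def jointRegenBy {d : ℕ} (h : ℤ) (u : Site d) (T : ℕ) : Set (Path d × Path d) :=
  {w | ∃ m ≤ T, ∃ n ≤ T, JointRegen h u w m n}

/-- A regeneration at some level `≥ n` occurs by time `n * g` and at most `g` steps after the hit of
`n`. From then on the path stays at or above `n`, so later backtracking below `n` is impossible. -/
theorem firstHit_le_and_backtrack_le {d : ℕ} {u : Site d} {x : Path d} {g K : ℕ}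
    (h0 : RegenAt u 0 x 0)
    (hg : ∀ n < K, ∀ t, RegenAt u (n : ℤ) x t → regenTime u (shift t x) ≤ g) {n m : ℕ} (hn : n ≤ K)
    (hm : FirstHit u (n : ℤ) x m) :
    m ≤ n * g ∧ ∀ b, level u (x (m + b)) < n → b ≤ g := by
  obtain ⟨n', t, hn', ht, htg, hts⟩ := exists_regenAt h0 hg n hn
  refine ⟨(hm.le_of_le ht.1 hn').trans htg, fun b hb => ?_⟩
  by_contra hcon
  have h1 := hts m hm.enters
  have h2 := ht.2 (m + b - t)
  rw [show t + (m + b - t) = m + b by omega] at h2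
  omega

/-- The three terms bound the exceptional sets `A` (a long regeneration interval of either walk),
`B` (a long gap between common fresh levels) and `F` (too many failed attempts). Outside them, and
off a null set, the deterministic criterion applies. -/
theorem FreshLaw.jointRegenBy_tail {d : ℕ} {ν : Measure (ProbVec d)} [IsProbabilityMeasure ν]
    {u : Site d} {R : ℕ} (hR : StepBound ν u R)
    {P : Site d → Site d → Measure (Path d × Path d)} (hP : FreshLaw ν u P) {Q : ℕ} {c ρ : ℝ≥0∞}
    (hc : HitsTogether ν u R P Q c)
    (hρ : ∀ x y, level u x = level u y → ρ ≤ P x y (noBacktrack u)) {h : ℕ} (hh : 1 ≤ h)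
    {x y : Site d} (hx : level u x = 0) (hy : level u y = 0) {s D : ℕ}
    (hD : (s + 1) * (R * s + h + s * (Q + 1)) ≤ D) :
    P x y (noBacktrack u \ jointRegenBy h u (D * s))
      ≤ (D + s * (Q + 1) : ℕ) * (2 * avg ν 0 (lateRegen u s)) + (D + 1 : ℕ) * (1 - c) ^ s
        + (1 - ρ) ^ s := by
  -- Windows starting at levels up to `D` extend to `D + s * (Q + 1)`; regenerations are controlled
  -- up to there so that both walks are known to enter the end of each window.
  set K := D + s * (Q + 1) with hK
  set L : ℕ → Set (Path d) := fun n => {x | ∃ t, RegenAt u (n : ℤ) x t ∧ shift t x ∈ lateRegen u s}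
    with hL
  set A : Set (Path d × Path d) := ⋃ n ∈ Finset.range K, (L n ×ˢ Set.univ ∪ Set.univ ×ˢ L n) with hA
  set B : Set (Path d × Path d) := ⋃ n ∈ Finset.range (D + 1), ⋃ i : ℕ × ℕ,
    NoFreshBefore ν u x y (n : ℤ) ((n + s * (Q + 1) : ℕ) : ℤ) i.1 i.2 with hB
  set F : Set (Path d × Path d) := {w | freshLevel h u w.1 w.2 s ≠ ⊤} with hF
  have hsub : noBacktrack u \ jointRegenBy h u (D * s)
      ⊆ ((A ∪ B) ∪ F) ∪ (goodPaths ν x ×ˢ goodPaths ν y)ᶜ := by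
    rintro w ⟨hw, hwJ⟩
    by_contra hcon
    simp only [Set.mem_union, not_or, Set.mem_compl_iff, not_not] at hcon
    obtain ⟨⟨⟨hwA, hwB⟩, hwF⟩, hgx, hgy⟩ := hcon
    have hwF' : freshLevel h u w.1 w.2 s = ⊤ := by_contra hwF
    rw [mem_noBacktrack_iff] at hw
    have hx0 : level u (w.1 0) = 0 := by rw [hgx.1, hx]
    have hy0 : level u (w.2 0) = 0 := by rw [hgy.1, hy]
    have h0 : ∀ {z : Path d}, level u (z 0) = 0 → (∀ n, level u (z 0) ≤ level u (z n)) →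
        RegenAt u 0 z 0 := fun {z} h1 h2 =>
      ⟨⟨h1, fun i hi => absurd hi (Nat.not_lt_zero i)⟩, fun j => by
        rw [zero_add, ← h1]; exact h2 j⟩
    have hAx : ∀ n < K, ∀ t, RegenAt u (n : ℤ) w.1 t → regenTime u (shift t w.1) ≤ s := by
      intro n hn t ht
      by_contra hlt
      exact hwA (Set.mem_iUnion₂.2 ⟨n, Finset.mem_range.2 hn, Or.inl ⟨⟨t, ht, not_le.1 hlt⟩, trivial⟩⟩)
    have hAy : ∀ n < K, ∀ t, RegenAt u (n : ℤ) w.2 t → regenTime u (shift t w.2) ≤ s := by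
      intro n hn t ht
      by_contra hlt
      exact hwA (Set.mem_iUnion₂.2 ⟨n, Finset.mem_range.2 hn, Or.inr ⟨trivial, ⟨t, ht, not_le.1 hlt⟩⟩⟩)
    have hrx := h0 hx0 fun n => (hw n).1
    have hry := h0 hy0 fun n => (hw n).2
    have henter : ∀ {z : Path d}, RegenAt u 0 z 0 → (∀ n < K, ∀ t, RegenAt u (n : ℤ) z t →
        regenTime u (shift t z) ≤ s) → ∀ n ≤ K, ∃ m, Enters u (n : ℤ) z m := by
      intro z h1 h2 n hn
      obtain ⟨n', t, hn', ht, -⟩ := exists_regenAt h1 h2 n hn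
      obtain ⟨m, -, hm⟩ := exists_enters (u := u) (ℓ := (n : ℤ)) (x := z) (m := t)
        (by rw [ht.1.1]; exact hn')
      exact ⟨m, hm⟩
    -- The same `s` serves as bound for the regeneration intervals, for the number of blocks in a
    -- window and for the number of attempts.
    refine hwJ (exists_jointRegen (W := s * (Q + 1)) (g := s) (K := s) hh hx0
      (fun i => hR.level_succ_le (hgx.2 i)) (fun i => hR.level_succ_le (hgy.2 i))
      (fun n hn m b hm => (firstHit_le_and_backtrack_le hrx hAx (by omega) hm).2 b)
      (fun n hn m b hm => (firstHit_le_and_backtrack_le hry hAy (by omega) hm).2 b)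
      (fun n hn m hm => (firstHit_le_and_backtrack_le hrx hAx (by omega) hm).1.trans
        (Nat.mul_le_mul_right _ hn))
      (fun n hn m hm => (firstHit_le_and_backtrack_le hry hAy (by omega) hm).1.trans
        (Nat.mul_le_mul_right _ hn))
      (fun n hn => ?_) hwF' hD)
    obtain ⟨m, hm⟩ := henter hrx hAx (n + s * (Q + 1)) (by omega)
    obtain ⟨m', hm'⟩ := henter hry hAy (n + s * (Q + 1)) (by omega)
    by_contra hno
    push Not at hno
    refine hwB (Set.mem_iUnion₂.2 ⟨n, Finset.mem_range.2 (by omega), Set.mem_iUnion.2 ⟨(m, m'),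
      ⟨hm, hm'⟩, ⟨⟨hgx.1, fun i _ => hgx.2 i⟩, ⟨hgy.1, fun i _ => hgy.2 i⟩⟩, fun ℓ h1 h2 => ?_⟩⟩)
    exact hno ℓ h1 (by push_cast at h2 ⊢; exact h2.le)
  have hA' : P x y A ≤ (K : ℕ) * (2 * avg ν 0 (lateRegen u s)) := by
    calc P x y A ≤ ∑ n ∈ Finset.range K, P x y (L n ×ˢ Set.univ ∪ Set.univ ×ˢ L n) :=
          measure_biUnion_finset_le _ _
      _ ≤ ∑ n ∈ Finset.range K, 2 * avg ν 0 (lateRegen u s) := by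
          refine Finset.sum_le_sum fun n _ => (measure_union_le _ _).trans ?_
          rw [two_mul]
          exact add_le_add
            ((hP.fst_le x y _).trans (avg_regenAt_lateRegen_le ν u x n s))
            ((hP.snd_le x y _).trans (avg_regenAt_lateRegen_le ν u y n s))
      _ = _ := by simp
  have hB' : P x y B ≤ (D + 1 : ℕ) * (1 - c) ^ s := by
    calc P x y B ≤ ∑ n ∈ Finset.range (D + 1), _ := measure_biUnion_finset_le _ _
      _ ≤ ∑ n ∈ Finset.range (D + 1), (1 - c) ^ s :=
          Finset.sum_le_sum fun n _ => hP.noFresh_le hR hc hx hy n s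
      _ = _ := by simp
  calc P x y (noBacktrack u \ jointRegenBy h u (D * s))
      ≤ P x y (((A ∪ B) ∪ F) ∪ (goodPaths ν x ×ˢ goodPaths ν y)ᶜ) := measure_mono hsub
    _ ≤ ((P x y A + P x y B) + P x y F) + 0 := by
        refine (measure_union_le _ _).trans (add_le_add ?_ (hP.ae_goodPaths x y).le)
        exact (measure_union_le _ _).trans (add_le_add_left (measure_union_le _ _) _)
    _ ≤ _ := by
        rw [add_zero]
        gcongr
        exact hP.freshLevel_ne_top_le hρ (by exact_mod_cast hh) x y s

/-! ## Measurability of the joint regeneration -/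

theorem measurableSet_freshLevel_eq {d : ℕ} {h : ℤ} (hh : 1 ≤ h) (u : Site d) (k : ℕ) (ℓ : ℤ) :
    MeasurableSet {w : Path d × Path d | freshLevel h u w.1 w.2 k = ℓ} := by
  have : {w : Path d × Path d | freshLevel h u w.1 w.2 k = ℓ}
      = ⋃ i : ℕ × ℕ, {w | freshLevel h u w.1 w.2 k = ℓ ∧ FirstHit u ℓ w.1 i.1 ∧
        FirstHit u ℓ w.2 i.2} := by
    ext w
    simp only [Set.mem_iUnion]
    constructor
    · intro hw
      obtain ⟨m, n, hm, hn⟩ := commonFresh_iff.1 (freshLevel_spec hh hw).2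
      exact ⟨(m, n), hw, hm, hn⟩
    · rintro ⟨i, hw, -⟩
      exact hw
  rw [this]
  refine MeasurableSet.iUnion fun i =>
    measurableSet_of_determined (measurable_seg₂ i.1 i.2) fun w w' hww' hw => ?_
  obtain ⟨h1, h2⟩ := seg₂_eq_iff.1 hww'
  exact ⟨freshLevel_congr hh hw.1 hw.2.1 hw.2.2 h1 h2, hw.2.1.congr h1, hw.2.2.congr h2⟩

theorem measurableSet_jointLevel_eq {d : ℕ} {h : ℤ} (hh : 1 ≤ h) (u : Site d) (ℓ : ℤ) :
    MeasurableSet {w : Path d × Path d | jointLevel h u w.1 w.2 = ℓ} := by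
  have : {w : Path d × Path d | jointLevel h u w.1 w.2 = ℓ}
      = (⋃ n, {w | freshLevel h u w.1 w.2 n = ℓ}) ∩
        ⋂ (n : ℕ) (ℓ' : ℤ) (_ : ¬ ℓ' ≤ ℓ),
          {w : Path d × Path d | freshLevel h u w.1 w.2 n = ℓ'}ᶜ := by
    ext w
    simp only [Set.mem_ofPred_eq, jointLevel_eq_coe_iff, Set.mem_inter_iff, Set.mem_iUnion,
      Set.mem_iInter, Set.mem_compl_iff]
    exact and_congr_right fun _ => forall_congr' fun n => forall_congr' fun ℓ' => not_imp_not.symm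
  rw [this]
  exact (MeasurableSet.iUnion fun n => measurableSet_freshLevel_eq hh u n ℓ).inter
    (MeasurableSet.iInter fun n => MeasurableSet.iInter fun ℓ' => MeasurableSet.iInter fun _ =>
      (measurableSet_freshLevel_eq hh u n ℓ').compl)

theorem measurableSet_jointDiffEq {d : ℕ} {h : ℤ} (hh : 1 ≤ h) (u y : Site d) :
    MeasurableSet (jointDiffEq h u y) := by
  have : jointDiffEq h u y = ⋃ (ℓ : ℤ) (m : ℕ) (n : ℕ), {w | jointLevel h u w.1 w.2 = ℓ} ∩
      {w | (Enters u ℓ w.1 m ∧ Enters u ℓ w.2 n) ∧ w.2 n - w.1 m = y} := by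
    ext w
    simp only [jointDiffEq, Set.mem_ofPred_eq, Set.mem_iUnion, Set.mem_inter_iff, hitTime_eq_iff,
      and_assoc]
  rw [this]
  refine MeasurableSet.iUnion fun ℓ => MeasurableSet.iUnion fun m => MeasurableSet.iUnion fun n =>
    (measurableSet_jointLevel_eq hh u ℓ).inter
      (measurableSet_of_determined (measurable_seg₂ m n) fun w w' hww' hw => ?_)
  obtain ⟨h1, h2⟩ := seg₂_eq_iff.1 hww'
  refine ⟨⟨hw.1.1.congr h1, hw.1.2.congr h2⟩, ?_⟩
  rw [← h1 m le_rfl, ← h2 n le_rfl]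
  exact hw.2

theorem jointDiffEq_disjoint {d : ℕ} (h : ℤ) (u : Site d) {y y' : Site d} (hy : y ≠ y') :
    Disjoint (jointDiffEq h u y) (jointDiffEq h u y') := by
  refine Set.disjoint_left.2 fun w hw hw' => hy ?_
  obtain ⟨ℓ, m, n, h1, h2, h3, rfl⟩ := hw
  obtain ⟨ℓ', m', n', h1', h2', h3', rfl⟩ := hw'
  obtain rfl := WithTop.coe_inj.1 (h1.symm.trans h1')
  rw [(hitTime_eq_iff.1 h2).unique (hitTime_eq_iff.1 h2'),
    (hitTime_eq_iff.1 h3).unique (hitTime_eq_iff.1 h3')]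

/-! ## Comparison of two laws of pairs of paths -/

theorem freeze_mem_noBacktrack_iff {d : ℕ} {u : Site d} {N : ℕ} {w : Path d × Path d} :
    (freeze N w.1, freeze N w.2) ∈ noBacktrack u ↔ w ∈ noBacktrackUpTo u N := by
  rw [mem_noBacktrack_iff]
  constructor
  · intro hw i hi
    have := hw i
    simp only at this
    rwa [freeze_of_le _ (Nat.zero_le N), freeze_of_le _ (Nat.zero_le N), freeze_of_le _ hi,
      freeze_of_le _ hi] at this
  · intro hw i
    simp only
    rw [freeze_of_le _ (Nat.zero_le N), freeze_of_le _ (Nat.zero_le N)]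
    exact hw (min i N) (min_le_right _ _)

theorem freeze_mem_jointDiffEq_iff {d : ℕ} {h : ℤ} (hh : 1 ≤ h) {u : Site d} {N : ℕ}
    {w : Path d × Path d} (hw : w ∈ jointRegenBy h u N) (y : Site d) :
    (freeze N w.1, freeze N w.2) ∈ jointDiffEq h u y ↔ w ∈ jointDiffEq h u y := by
  obtain ⟨m, hm, n, hn, hJ⟩ := hw
  rw [(hJ.freeze hh hm hn).mem_jointDiffEq hh, hJ.mem_jointDiffEq hh]
  simp only
  rw [freeze_of_le _ hm, freeze_of_le _ hn]

/-- Two laws that agree on the events determined by the first `N` steps nearly agree on the events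
determined by the first joint regeneration. -/
theorem measure_noBacktrack_inter_le {d : ℕ} {h : ℤ} (hh : 1 ≤ h) {u : Site d} {N : ℕ}
    {P P' : Measure (Path d × Path d)} {t : ℝ≥0∞}
    (hPP' : ∀ A : Set (Path d × Path d), (∀ w w', (∀ i ≤ N, w.1 i = w'.1 i) →
      (∀ i ≤ N, w.2 i = w'.2 i) → w ∈ A → w' ∈ A) → P A = P' A)
    (h1 : P (noBacktrack u \ jointRegenBy h u N) ≤ t)
    (h2 : P' (noBacktrack u \ jointRegenBy h u N) ≤ t)
    (h3 : P' (noBacktrackUpTo u N \ noBacktrack u) ≤ t) (S : Set (Site d)) :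
    P (noBacktrack u ∩ ⋃ y ∈ S, jointDiffEq h u y)
      ≤ P' (noBacktrack u ∩ ⋃ y ∈ S, jointDiffEq h u y) + 3 * t := by
  set J := noBacktrack u ∩ ⋃ y ∈ S, jointDiffEq h u y with hJ
  -- `E` depends on the first `N` steps only, so both laws give it the same mass. Passing from `J`
  -- to `E` costs one exceptional event under `P`; returning costs two under `P'`, since a frozen
  -- pair may hide a late backtrack.
  set E : Set (Path d × Path d) := {w | (freeze N w.1, freeze N w.2) ∈ J} with hE
  have hmem : ∀ w ∈ jointRegenBy h u N,
      (freeze N w.1, freeze N w.2) ∈ (⋃ y ∈ S, jointDiffEq h u y) ↔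
        w ∈ ⋃ y ∈ S, jointDiffEq h u y := by
    intro w hw
    simp only [Set.mem_iUnion, freeze_mem_jointDiffEq_iff hh hw]
  have hJE : J ⊆ E ∪ (noBacktrack u \ jointRegenBy h u N) := by
    rintro w ⟨hw1, hw2⟩
    by_cases hw : w ∈ jointRegenBy h u N
    · exact Or.inl ⟨freeze_mem_noBacktrack_iff.2 (noBacktrack_subset_upTo u N hw1),
        (hmem w hw).2 hw2⟩
    · exact Or.inr ⟨hw1, hw⟩
  have hEJ : E ⊆ J ∪ ((noBacktrack u \ jointRegenBy h u N) ∪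
      (noBacktrackUpTo u N \ noBacktrack u)) := by
    rintro w ⟨hw1, hw2⟩
    by_cases hnb : w ∈ noBacktrack u
    · by_cases hw : w ∈ jointRegenBy h u N
      · exact Or.inl ⟨hnb, (hmem w hw).1 hw2⟩
      · exact Or.inr (Or.inl ⟨hnb, hw⟩)
    · exact Or.inr (Or.inr ⟨freeze_mem_noBacktrack_iff.1 hw1, hnb⟩)
  have hdet : P E = P' E := hPP' E fun w w' e1 e2 hw => by
    have e1' : freeze N w.1 = freeze N w'.1 := funext fun i => e1 _ (min_le_right _ _)
    have e2' : freeze N w.2 = freeze N w'.2 := funext fun i => e2 _ (min_le_right _ _)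
    rw [hE, Set.mem_ofPred_eq, ← e1', ← e2']
    exact hw
  calc P J ≤ P E + t := (measure_mono hJE).trans ((measure_union_le _ _).trans (by gcongr))
    _ = P' E + t := by rw [hdet]
    _ ≤ P' J + (t + t) + t := by
        gcongr
        refine (measure_mono hEJ).trans ((measure_union_le _ _).trans ?_)
        gcongr
        exact (measure_union_le _ _).trans (by gcongr)
    _ = P' J + 3 * t := by ring

theorem measure_noBacktrack_le {d : ℕ} {u : Site d} {N : ℕ}
    {P P' : Measure (Path d × Path d)} {t : ℝ≥0∞}
    (hPP' : ∀ A : Set (Path d × Path d), (∀ w w', (∀ i ≤ N, w.1 i = w'.1 i) →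
      (∀ i ≤ N, w.2 i = w'.2 i) → w ∈ A → w' ∈ A) → P A = P' A)
    (h3 : P' (noBacktrackUpTo u N \ noBacktrack u) ≤ t) :
    P (noBacktrack u) ≤ P' (noBacktrack u) + t := by
  calc P (noBacktrack u) ≤ P (noBacktrackUpTo u N) := measure_mono (noBacktrack_subset_upTo u N)
    _ = P' (noBacktrackUpTo u N) := hPP' _ fun w w' e1 e2 hw i hi => by
        rw [← e1 i hi, ← e2 i hi, ← e1 0 (Nat.zero_le N), ← e2 0 (Nat.zero_le N)]
        exact hw i hi
    _ ≤ P' (noBacktrack u ∪ (noBacktrackUpTo u N \ noBacktrack u)) :=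
        measure_mono fun w hw => by
          by_cases h : w ∈ noBacktrack u
          · exact Or.inl h
          · exact Or.inr ⟨hw, h⟩
    _ ≤ _ := (measure_union_le _ _).trans (by gcongr)

/-- Comparison of the conditional probabilities `a / b` and `a' / b'`: the numerators contribute `3
* t / ρ`, and changing the denominator contributes `t / ρ` because `a' / b' ≤ 1`. -/
theorem inv_mul_le_inv_mul_add {a a' b b' t ρ : ℝ≥0∞} (ha : a ≤ a' + 3 * t) (hb : b' ≤ b + t)
    (hab : a' ≤ b') (hρ : 0 < ρ) (hρb : ρ ≤ b) (hρb' : ρ ≤ b') (hb1 : b ≠ ⊤) (hb1' : b' ≠ ⊤) :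
    b⁻¹ * a ≤ b'⁻¹ * a' + 4 * (ρ⁻¹ * t) := by
  have hb0 : b ≠ 0 := (hρ.trans_le hρb).ne'
  have hb0' : b' ≠ 0 := (hρ.trans_le hρb').ne'
  have hinv : b⁻¹ ≤ ρ⁻¹ := ENNReal.inv_le_inv.2 hρb
  have h1 : b'⁻¹ * a' ≤ 1 := by
    calc b'⁻¹ * a' ≤ b'⁻¹ * b' := by gcongr
      _ = 1 := ENNReal.inv_mul_cancel hb0' hb1'
  have h2 : b⁻¹ * a' ≤ b'⁻¹ * a' + ρ⁻¹ * t := by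
    calc b⁻¹ * a' = b⁻¹ * (b' * b'⁻¹) * a' := by rw [ENNReal.mul_inv_cancel hb0' hb1', mul_one]
      _ = b⁻¹ * b' * (b'⁻¹ * a') := by ring
      _ ≤ b⁻¹ * (b + t) * (b'⁻¹ * a') := by gcongr
      _ = (b⁻¹ * b) * (b'⁻¹ * a') + b⁻¹ * t * (b'⁻¹ * a') := by ring
      _ ≤ 1 * (b'⁻¹ * a') + ρ⁻¹ * t * 1 := by
          gcongr
          exact (ENNReal.inv_mul_cancel hb0 hb1).le
      _ = _ := by rw [one_mul, mul_one]
  calc b⁻¹ * a ≤ b⁻¹ * (a' + 3 * t) := by gcongr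
    _ = b⁻¹ * a' + 3 * (b⁻¹ * t) := by ring
    _ ≤ (b'⁻¹ * a' + ρ⁻¹ * t) + 3 * (ρ⁻¹ * t) := by gcongr
    _ = _ := by ring

/-! ## The maximal coupling -/

/-- The common part `m`, the minimum of the two laws, is read off from a Hahn decomposition and
placed on the diagonal; the remainders are coupled independently. The mass possibly off the diagonal
is `1 - m univ = μ s - μ' s`, so a one-sided bound on the laws is enough. -/
theorem exists_maximal_coupling {H : Type*} [MeasurableSpace H] [Countable H]
    [MeasurableSingletonClass H] (μ μ' : Measure H) [IsProbabilityMeasure μ]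
    [IsProbabilityMeasure μ'] : ∃ π : Measure (H × H), π.map Prod.fst = μ ∧ π.map Prod.snd = μ' ∧
      ∀ δ : ℝ≥0∞, (∀ S, μ S ≤ μ' S + δ) → π {w | w.1 ≠ w.2} ≤ δ := by
  obtain ⟨s, hs, h1, h2⟩ := hahn_decomposition μ μ'
  set m : Measure H := μ'.restrict s + μ.restrict sᶜ with hm
  have hmμ : m ≤ μ := by
    rw [← Measure.restrict_add_restrict_compl (μ := μ) hs, hm]
    refine add_le_add_left (Measure.le_iff.2 fun t ht => ?_) _
    rw [Measure.restrict_apply ht, Measure.restrict_apply ht]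
    exact h1 _ (ht.inter hs) Set.inter_subset_right
  have hmμ' : m ≤ μ' := by
    conv_rhs => rw [← Measure.restrict_add_restrict_compl (μ := μ') hs]
    rw [hm]
    refine add_le_add_right (Measure.le_iff.2 fun t ht => ?_) _
    rw [Measure.restrict_apply ht, Measure.restrict_apply ht]
    exact h2 _ (ht.inter hs.compl) Set.inter_subset_right
  have : IsFiniteMeasure m := isFiniteMeasure_of_le μ hmμ
  set r : ℝ≥0∞ := 1 - m Set.univ with hr
  have hr1 : (μ - m) Set.univ = r := by
    rw [Measure.sub_apply MeasurableSet.univ hmμ, measure_univ]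
  have hr2 : (μ' - m) Set.univ = r := by
    rw [Measure.sub_apply MeasurableSet.univ hmμ', measure_univ]
  have hrtop : r ≠ ⊤ := ne_top_of_le_ne_top ENNReal.one_ne_top tsub_le_self
  -- When `r = 0` the normalisation `r⁻¹` is infinite, but then the remainders vanish and the
  -- identity still holds.
  have hscale : ∀ ξ : Measure H, ξ Set.univ = r → (r⁻¹ * r) • ξ = ξ := by
    intro ξ hξ
    by_cases h0 : r = 0
    · rw [h0] at hξ
      rw [Measure.measure_univ_eq_zero.1 hξ, smul_zero]
    · rw [ENNReal.inv_mul_cancel h0 hrtop, one_smul]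
  have hdiag : Measurable fun y : H => (y, y) := measurable_id.prodMk measurable_id
  refine ⟨m.map (fun y => (y, y)) + r⁻¹ • (μ - m).prod (μ' - m), ?_, ?_, fun δ hδ => ?_⟩
  · rw [Measure.map_add _ _ measurable_fst, Measure.map_map measurable_fst hdiag,
      Measure.map_smul, Measure.map_fst_prod, hr2, smul_smul, hscale _ hr1, add_comm]
    have : (Prod.fst ∘ fun y : H => (y, y)) = id := rfl
    rw [this, Measure.map_id]
    exact Measure.sub_add_cancel_of_le hmμ
  · rw [Measure.map_add _ _ measurable_snd, Measure.map_map measurable_snd hdiag,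
      Measure.map_smul, Measure.map_snd_prod, hr1, smul_smul, hscale _ hr2, add_comm]
    have : (Prod.snd ∘ fun y : H => (y, y)) = id := rfl
    rw [this, Measure.map_id]
    exact Measure.sub_add_cancel_of_le hmμ'
  · have hne : MeasurableSet {w : H × H | w.1 ≠ w.2} := (Set.to_countable _).measurableSet
    have hrδ : r ≤ δ := by
      rw [hr, tsub_le_iff_right]
      have e : m Set.univ = μ' s + μ sᶜ := by
        rw [hm, Measure.add_apply, Measure.restrict_apply_univ, Measure.restrict_apply_univ]
      calc (1 : ℝ≥0∞) = μ s + μ sᶜ := (prob_add_prob_compl hs).symm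
        _ ≤ (μ' s + δ) + μ sᶜ := by gcongr; exact hδ s
        _ = δ + m Set.univ := by rw [e]; ring
    rw [Measure.add_apply, Measure.map_apply hdiag hne, Measure.smul_apply, smul_eq_mul]
    have e : (fun y : H => (y, y)) ⁻¹' {w : H × H | w.1 ≠ w.2} = ∅ := by ext; simp
    rw [e, measure_empty, zero_add]
    calc r⁻¹ * ((μ - m).prod (μ' - m)) {w | w.1 ≠ w.2}
        ≤ r⁻¹ * ((μ - m).prod (μ' - m)) (Set.univ ×ˢ Set.univ) := by
          gcongr; simp
      _ = r⁻¹ * r * r := by rw [Measure.prod_prod, hr1, hr2, mul_assoc]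
      _ ≤ 1 * r := by gcongr; exact ENNReal.inv_mul_le_one r
      _ ≤ δ := by rw [one_mul]; exact hrδ

/-! ## Polynomial bounds -/

theorem exists_pow_le_rpow {r : ℝ≥0∞} (hr : r < 1) (a : ℝ) :
    ∃ C : ℝ≥0∞, C ≠ ⊤ ∧ ∀ s : ℕ, 1 ≤ s → r ^ s ≤ C * (s : ℝ≥0∞) ^ (-a) := by
  have hrtop : r ≠ ⊤ := ne_top_of_lt hr
  have h1 : |r.toReal| < 1 := by
    rw [abs_of_nonneg ENNReal.toReal_nonneg]
    exact (ENNReal.toReal_lt_toReal hrtop ENNReal.one_ne_top).2 hr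
  obtain ⟨B, hB⟩ :=
    (tendsto_pow_const_mul_const_pow_of_abs_lt_one ⌈a⌉₊ h1).bddAbove_range
  refine ⟨ENNReal.ofReal B, ENNReal.ofReal_ne_top, fun s hs => ?_⟩
  have h2 : (s : ℝ) ^ ⌈a⌉₊ * r.toReal ^ s ≤ B := hB ⟨s, rfl⟩
  have hs0 : (s : ℝ≥0∞) ≠ 0 := by
    rw [Nat.cast_ne_zero]; omega
  have h3 : (s : ℝ≥0∞) ^ a * r ^ s ≤ ENNReal.ofReal B := by
    calc (s : ℝ≥0∞) ^ a * r ^ s ≤ (s : ℝ≥0∞) ^ ((⌈a⌉₊ : ℕ) : ℝ) * r ^ s := by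
          gcongr
          · exact_mod_cast hs
          · exact Nat.le_ceil a
      _ = ENNReal.ofReal ((s : ℝ) ^ ⌈a⌉₊ * r.toReal ^ s) := by
          rw [ENNReal.rpow_natCast, ENNReal.ofReal_mul (by positivity),
            ENNReal.ofReal_pow (by positivity), ENNReal.ofReal_natCast,
            ENNReal.ofReal_pow ENNReal.toReal_nonneg, ENNReal.ofReal_toReal hrtop]
      _ ≤ _ := ENNReal.ofReal_le_ofReal h2
  calc r ^ s = ((s : ℝ≥0∞) ^ a * (s : ℝ≥0∞) ^ (-a)) * r ^ s := by
        rw [← ENNReal.rpow_add _ _ hs0 (ENNReal.natCast_ne_top s), add_neg_cancel,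
          ENNReal.rpow_zero, one_mul]
    _ = ((s : ℝ≥0∞) ^ a * r ^ s) * (s : ℝ≥0∞) ^ (-a) := by ring
    _ ≤ _ := by gcongr

theorem avg_lateRegen_le {d : ℕ} (ν : Measure (ProbVec d)) (u : Site d) {p : ℝ} (hp : 0 ≤ p)
    {s : ℕ} (hs : 1 ≤ s) : avg ν 0 (lateRegen u s)
      ≤ (∫⁻ X, ((regenTime u X : ℕ∞) : ℝ≥0∞) ^ p ∂(avg ν 0)) * (s : ℝ≥0∞) ^ (-p) := by
  have hs0 : (s : ℝ≥0∞) ≠ 0 := by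
    rw [Nat.cast_ne_zero]; omega
  calc avg ν 0 (lateRegen u s)
      = ((s : ℝ≥0∞) ^ p * (s : ℝ≥0∞) ^ (-p)) * avg ν 0 (lateRegen u s) := by
        rw [← ENNReal.rpow_add _ _ hs0 (ENNReal.natCast_ne_top s), add_neg_cancel,
          ENNReal.rpow_zero, one_mul]
    _ = ((s : ℝ≥0∞) ^ p * avg ν 0 (lateRegen u s)) * (s : ℝ≥0∞) ^ (-p) := by ring
    _ ≤ _ := by gcongr; exact avg_lateRegen_mul_le ν u hp s

theorem tendsto_natCast_rpow_neg {a : ℝ} (ha : 0 < a) :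
    Filter.Tendsto (fun s : ℕ => (s : ℝ≥0∞) ^ (-a)) Filter.atTop (nhds 0) := by
  have h := (ENNReal.continuous_rpow_const (y := a)).continuousAt.tendsto.comp
    (ENNReal.tendsto_inv_nat_nhds_zero)
  simp only [ENNReal.zero_rpow_of_pos ha] at h
  refine h.congr fun s => ?_
  simp only [Function.comp_apply]
  rw [ENNReal.inv_rpow, ENNReal.rpow_neg]

theorem jointRegenBy_mono {d : ℕ} {h : ℤ} {u : Site d} {T T' : ℕ} (hT : T ≤ T') :
    jointRegenBy h u T ⊆ jointRegenBy (d := d) h u T' := fun _ ⟨m, hm, n, hn, hJ⟩ =>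
  ⟨m, hm.trans hT, n, hn.trans hT, hJ⟩

/-- The first joint regeneration time has polynomial tails, uniformly in the starting points. -/
theorem FreshLaw.exists_jointRegenBy_tail {d : ℕ} {ν : Measure (ProbVec d)}
    [IsProbabilityMeasure ν] {u : Site d} {R : ℕ} (hR : StepBound ν u R)
    {P : Site d → Site d → Measure (Path d × Path d)} (hP : FreshLaw ν u P) {Q : ℕ} {c ρ : ℝ≥0∞}
    (hc0 : 0 < c) (hc : HitsTogether ν u R P Q c) (hρ0 : 0 < ρ)
    (hρ : ∀ x y, level u x = level u y → ρ ≤ P x y (noBacktrack u)) {h : ℕ} (hh : 1 ≤ h)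
    {p : ℝ} (hp : 4 ≤ p) (hmom : ∫⁻ X, ((regenTime u X : ℕ∞) : ℝ≥0∞) ^ p ∂(avg ν 0) < ⊤) :
    ∃ (A : ℕ) (C : ℝ≥0∞), C ≠ ⊤ ∧ ∀ A' ≥ A, ∀ s : ℕ, 1 ≤ s → ∀ x y, level u x = 0 →
      level u y = 0 → P x y (noBacktrack u \ jointRegenBy h u (A' * s ^ 3))
        ≤ C * (s : ℝ≥0∞) ^ (-(p / 2)) := by
  set m := ∫⁻ X, ((regenTime u X : ℕ∞) : ℝ≥0∞) ^ p ∂(avg ν 0) with hm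
  -- The extra `2` in the exponent absorbs the number of window positions, which is of order `s ^
  -- 2`.
  obtain ⟨C₁, hC₁, h₁⟩ := exists_pow_le_rpow
    (ENNReal.sub_lt_self ENNReal.one_ne_top one_ne_zero hc0.ne') (p / 2 + 2)
  obtain ⟨C₂, hC₂, h₂⟩ := exists_pow_le_rpow
    (ENNReal.sub_lt_self ENNReal.one_ne_top one_ne_zero hρ0.ne') (p / 2)
  -- The factor `2` comes from `s + 1 ≤ 2 * s`. With `D = A * s ^ 2` levels, each taking at most `s`
  -- steps, the time horizon is of order `s ^ 3`.
  set A := 2 * (R + h + (Q + 1)) with hA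
  refine ⟨A, (A + (Q + 1) : ℕ) * (2 * m) + (A + 1 : ℕ) * C₁ + C₂, ?_, fun A' hA' s hs x y hx hy => ?_⟩
  · exact ENNReal.add_ne_top.2 ⟨ENNReal.add_ne_top.2 ⟨ENNReal.mul_ne_top (ENNReal.natCast_ne_top _)
      (ENNReal.mul_ne_top ENNReal.ofNat_ne_top hmom.ne),
      ENNReal.mul_ne_top (ENNReal.natCast_ne_top _) hC₁⟩, hC₂⟩
  have hs0 : (s : ℝ≥0∞) ≠ 0 := by
    rw [Nat.cast_ne_zero]; omega
  have hs1 : (1 : ℝ≥0∞) ≤ s := by exact_mod_cast hs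
  have hD : (s + 1) * (R * s + h + s * (Q + 1)) ≤ A * s ^ 2 := by
    calc (s + 1) * (R * s + h + s * (Q + 1)) ≤ (2 * s) * (R * s + h * s + s * (Q + 1)) := by
          gcongr
          · omega
          · exact Nat.le_mul_of_pos_right _ hs
      _ = A * s ^ 2 := by rw [hA]; ring
  have hsq : ∀ a : ℝ, (s : ℝ≥0∞) ^ 2 * (s : ℝ≥0∞) ^ a = (s : ℝ≥0∞) ^ (2 + a) := fun a => by
    rw [ENNReal.rpow_add _ _ hs0 (ENNReal.natCast_ne_top s), ENNReal.rpow_ofNat]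
  have hle : A * s ^ 2 * s ≤ A' * s ^ 3 := by
    calc A * s ^ 2 * s = A * s ^ 3 := by ring
      _ ≤ _ := Nat.mul_le_mul_right _ hA'
  have e1 : ((A * s ^ 2 + s * (Q + 1) : ℕ) : ℝ≥0∞) ≤ (A + (Q + 1) : ℕ) * (s : ℝ≥0∞) ^ 2 := by
    have : A * s ^ 2 + s * (Q + 1) ≤ (A + (Q + 1)) * s ^ 2 := by
      have : s ≤ s ^ 2 := Nat.le_self_pow two_ne_zero s
      calc A * s ^ 2 + s * (Q + 1) ≤ A * s ^ 2 + s ^ 2 * (Q + 1) := by gcongr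
        _ = _ := by ring
    exact_mod_cast this
  have e2 : ((A * s ^ 2 + 1 : ℕ) : ℝ≥0∞) ≤ (A + 1 : ℕ) * (s : ℝ≥0∞) ^ 2 := by
    have : A * s ^ 2 + 1 ≤ (A + 1) * s ^ 2 := by
      have : 1 ≤ s ^ 2 := Nat.one_le_pow _ _ hs
      calc A * s ^ 2 + 1 ≤ A * s ^ 2 + s ^ 2 := by gcongr
        _ = _ := by ring
    exact_mod_cast this
  calc P x y (noBacktrack u \ jointRegenBy h u (A' * s ^ 3))
      ≤ P x y (noBacktrack u \ jointRegenBy h u (A * s ^ 2 * s)) :=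
        measure_mono (Set.sdiff_subset_sdiff_right (jointRegenBy_mono hle))
    _ ≤ _ := hP.jointRegenBy_tail hR hc hρ hh hx hy hD
    _ ≤ ((A + (Q + 1) : ℕ) * (s : ℝ≥0∞) ^ 2) * (2 * (m * (s : ℝ≥0∞) ^ (-p)))
          + ((A + 1 : ℕ) * (s : ℝ≥0∞) ^ 2) * (C₁ * (s : ℝ≥0∞) ^ (-(p / 2 + 2)))
          + C₂ * (s : ℝ≥0∞) ^ (-(p / 2)) := by
        gcongr
        · exact avg_lateRegen_le ν u (by linarith) hs
        · exact h₁ s hs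
        · exact h₂ s hs
    _ = ((A + (Q + 1) : ℕ) * (2 * m)) * ((s : ℝ≥0∞) ^ 2 * (s : ℝ≥0∞) ^ (-p))
          + ((A + 1 : ℕ) * C₁) * ((s : ℝ≥0∞) ^ 2 * (s : ℝ≥0∞) ^ (-(p / 2 + 2)))
          + C₂ * (s : ℝ≥0∞) ^ (-(p / 2)) := by ring
    _ ≤ ((A + (Q + 1) : ℕ) * (2 * m)) * (s : ℝ≥0∞) ^ (-(p / 2))
          + ((A + 1 : ℕ) * C₁) * (s : ℝ≥0∞) ^ (-(p / 2))
          + C₂ * (s : ℝ≥0∞) ^ (-(p / 2)) := by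
        -- The first term requires `2 - p ≤ -(p / 2)`, which is the condition `4 ≤ p`.
        rw [hsq, hsq]
        gcongr <;> first | exact hs1 | linarith
    _ = _ := by ring

/-! ## The law of the difference at the first joint regeneration -/

/-- The law, given no backtracking, of the difference of the walks at the first joint
regeneration. -/
noncomputable def diffLaw {d : ℕ} (h : ℤ) (u : Site d) (P : Measure (Path d × Path d)) :
    Measure (Hyper u) :=
  Measure.sum fun y : Hyper u => cond P (noBacktrack u) (jointDiffEq h u y) • Measure.dirac y

/-- The hyperplane is countable and the events of different displacements are disjoint, so the sum
of point masses is the conditional probability of a union. -/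
theorem diffLaw_apply {d : ℕ} {h : ℤ} (hh : 1 ≤ h) (u : Site d) (P : Measure (Path d × Path d))
    (S : Set (Hyper u)) : diffLaw h u P S = (P (noBacktrack u))⁻¹ *
      P (noBacktrack u ∩ ⋃ y ∈ Subtype.val '' S, jointDiffEq h u y) := by
  have hS : MeasurableSet S := (Set.to_countable _).measurableSet
  rw [← cond_apply (measurableSet_noBacktrack u), diffLaw, Measure.sum_apply _ hS,
    Set.biUnion_image, measure_biUnion (Set.to_countable S)
      (fun y _ y' _ hne => jointDiffEq_disjoint h u fun e => hne (Subtype.ext e))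
      fun y _ => measurableSet_jointDiffEq hh u y,
    tsum_subtype S fun y : Hyper u => cond P (noBacktrack u) (jointDiffEq h u y)]
  refine tsum_congr fun y => ?_
  rw [Measure.smul_apply, Measure.dirac_apply' _ hS, smul_eq_mul]
  by_cases hy : y ∈ S <;> simp [hy]

theorem diffLaw_singleton {d : ℕ} {h : ℤ} (hh : 1 ≤ h) (u : Site d)
    (P : Measure (Path d × Path d)) (y : Hyper u) :
    diffLaw h u P {y} = cond P (noBacktrack u) (jointDiffEq h u y) := by
  rw [diffLaw_apply hh, cond_apply (measurableSet_noBacktrack u)]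
  simp

theorem jointRegenBy_subset {d : ℕ} {h : ℤ} (hh : 1 ≤ h) (u : Site d) (T : ℕ) :
    jointRegenBy h u T ⊆ ⋃ y ∈ Subtype.val '' (Set.univ : Set (Hyper u)), jointDiffEq h u y := by
  rintro w ⟨m, -, n, -, hJ⟩
  have hy : level u (w.2 n - w.1 m) = 0 := by
    obtain ⟨k, ℓ, -, hm, hn, -⟩ := hJ
    rw [level_sub, hm.1, hn.1, sub_self]
  exact Set.mem_iUnion₂.2 ⟨w.2 n - w.1 m, ⟨⟨_, hy⟩, trivial, rfl⟩, (hJ.mem_jointDiffEq hh _).2 rfl⟩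

/-- Letting `s` tend to infinity in the tail bound shows that, without backtracking, a joint
regeneration almost surely occurs. Its displacement lies in the hyperplane because both walks are
then on the same level. -/
theorem isProbabilityMeasure_diffLaw {d : ℕ} {h : ℤ} (hh : 1 ≤ h) {u : Site d}
    {P : Measure (Path d × Path d)} [IsFiniteMeasure P] (h0 : P (noBacktrack u) ≠ 0) {A : ℕ}
    {C : ℝ≥0∞} (hC : C ≠ ⊤) {a : ℝ} (ha : 0 < a)
    (ht : ∀ s : ℕ, 1 ≤ s → P (noBacktrack u \ jointRegenBy h u (A * s ^ 3))
      ≤ C * (s : ℝ≥0∞) ^ (-a)) : IsProbabilityMeasure (diffLaw h u P) := by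
  constructor
  rw [diffLaw_apply hh]
  set J : Set (Path d × Path d) :=
    ⋃ y ∈ Subtype.val '' (Set.univ : Set (Hyper u)), jointDiffEq h u y with hJ
  have hdiff : P (noBacktrack u \ J) = 0 := by
    have hlim := ENNReal.Tendsto.const_mul (tendsto_natCast_rpow_neg ha) (Or.inr hC)
    rw [mul_zero] at hlim
    refine le_antisymm (ge_of_tendsto hlim ?_) zero_le
    filter_upwards [Filter.eventually_ge_atTop 1] with s hs
    exact (measure_mono (Set.sdiff_subset_sdiff_right (jointRegenBy_subset hh u _))).trans (ht s hs)
  have hJm : MeasurableSet J := MeasurableSet.biUnion (Set.to_countable _) fun y _ =>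
    measurableSet_jointDiffEq hh u y
  rw [← add_zero (P (noBacktrack u ∩ J)), ← hdiff, measure_inter_add_sdiff _ hJm]
  exact ENNReal.inv_mul_cancel h0 (measure_ne_top _ _)

theorem diffLaw_le {d : ℕ} {h : ℤ} (hh : 1 ≤ h) {u : Site d} {N : ℕ}
    {P P' : Measure (Path d × Path d)} [IsFiniteMeasure P] [IsFiniteMeasure P'] {t ρ : ℝ≥0∞}
    (hPP' : ∀ A : Set (Path d × Path d), (∀ w w', (∀ i ≤ N, w.1 i = w'.1 i) →
      (∀ i ≤ N, w.2 i = w'.2 i) → w ∈ A → w' ∈ A) → P A = P' A)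
    (h1 : P (noBacktrack u \ jointRegenBy h u N) ≤ t)
    (h2 : P' (noBacktrack u \ jointRegenBy h u N) ≤ t)
    (h3 : P (noBacktrackUpTo u N \ noBacktrack u) ≤ t)
    (h4 : P' (noBacktrackUpTo u N \ noBacktrack u) ≤ t)
    (hρ : 0 < ρ) (h5 : ρ ≤ P (noBacktrack u)) (h6 : ρ ≤ P' (noBacktrack u)) (S : Set (Hyper u)) :
    diffLaw h u P S ≤ diffLaw h u P' S + 4 * (ρ⁻¹ * t) := by
  rw [diffLaw_apply hh, diffLaw_apply hh]
  exact inv_mul_le_inv_mul_add (measure_noBacktrack_inter_le hh hPP' h1 h2 h4 _)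
    (measure_noBacktrack_le (fun A hA => (hPP' A hA).symm) h3) (measure_mono Set.inter_subset_left)
    hρ h5 h6 (measure_ne_top _ _) (measure_ne_top _ _)

/-! ### Choice of the scale and the final estimate -/

/-- The comparison of the walks needs separation in a single coordinate; the largest coordinate
provides it at the price of a factor `d`. -/
theorem exists_eucNorm_le {d : ℕ} (x : Site d) (hx : x ≠ 0) :
    ∃ j, eucNorm x ≤ d * (|x j| : ℝ) := by
  obtain ⟨j₀, -⟩ := Function.ne_iff.1 hx
  obtain ⟨j, -, hj⟩ := Finset.exists_max_image Finset.univ (fun i => |x i|) ⟨j₀, Finset.mem_univ _⟩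
  refine ⟨j, Real.sqrt_le_iff.2 ⟨by positivity, ?_⟩⟩
  have hd : (1 : ℝ) ≤ d := by exact_mod_cast j₀.pos
  calc ∑ i, (x i : ℝ) ^ 2 ≤ ∑ i : Fin d, (|x j| : ℝ) ^ 2 := by
        refine Finset.sum_le_sum fun i _ => ?_
        have : |(x i : ℝ)| ≤ |(x j : ℝ)| := by exact_mod_cast hj i (Finset.mem_univ i)
        rw [sq_abs]
        exact sq_le_sq.2 this
    _ = d * (|x j| : ℝ) ^ 2 := by simp
    _ ≤ d * (d * (|x j| : ℝ) ^ 2) := le_mul_of_one_le_left (by positivity) hd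
    _ = _ := by ring

theorem eucNorm_pos {d : ℕ} {x : Site d} (hx : x ≠ 0) : 0 < eucNorm x := by
  obtain ⟨j, hj⟩ := Function.ne_iff.1 hx
  refine lt_of_lt_of_le ?_ (abs_le_eucNorm x j)
  simpa using hj

/-- The scale `s` of order `(r / κ) ^ (1 / 3)` that belongs to a distance `r`. -/
theorem exists_scale {κ p : ℝ} (hκ : 0 < κ) (hp : 0 ≤ p) : ∃ C : ℝ, 0 < C ∧ ∀ r : ℝ, 0 < r →
    1 ≤ C * r ^ (-p / 6) ∨ ∃ s : ℕ, 1 ≤ s ∧ κ * (s : ℝ) ^ 3 ≤ r ∧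
      (s : ℝ) ^ (-(p / 2)) ≤ C * r ^ (-p / 6) := by
  refine ⟨2 ^ (p / 2) * κ ^ (p / 6), by positivity, fun r hr => ?_⟩
  have h2 : (1 : ℝ) ≤ 2 ^ (p / 2) := Real.one_le_rpow one_le_two (by positivity)
  have hκr : κ ^ (p / 6) * r ^ (-p / 6) = (r / κ) ^ (-p / 6) := by
    rw [Real.div_rpow hr.le hκ.le, neg_div, Real.rpow_neg hκ.le, div_inv_eq_mul, mul_comm]
  rw [mul_assoc, hκr]
  set z := r / κ with hz
  have hz0 : 0 < z := div_pos hr hκ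
  -- If the floor is zero, the distance is below `κ` and the claimed bound exceeds one. Otherwise
  -- rounding down loses at most a factor `2`, which explains the constant `2 ^ (p / 2)`.
  set s := ⌊z ^ (1 / 3 : ℝ)⌋₊ with hs
  rcases Nat.eq_zero_or_pos s with h0 | hpos
  · left
    have hz1 : z < 1 := by
      have := Nat.floor_eq_zero.1 h0
      by_contra hge
      exact absurd (Real.one_le_rpow (not_lt.1 hge) (by norm_num)) (not_le.2 this)
    have : 1 ≤ z ^ (-p / 6) :=
      Real.one_le_rpow_of_pos_of_le_one_of_nonpos hz0 hz1.le (by linarith)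
    nlinarith
  · right
    have hs1 : (1 : ℝ) ≤ s := by exact_mod_cast hpos
    have hsz : (s : ℝ) ≤ z ^ (1 / 3 : ℝ) := Nat.floor_le (by positivity)
    have hzs : z ^ (1 / 3 : ℝ) ≤ 2 * s := by
      have := (Nat.lt_floor_add_one (z ^ (1 / 3 : ℝ))).le
      linarith
    refine ⟨s, hpos, ?_, ?_⟩
    · have h3 : (z ^ (1 / 3 : ℝ)) ^ 3 = z := by
        rw [← Real.rpow_natCast, ← Real.rpow_mul hz0.le]; norm_num
      calc κ * (s : ℝ) ^ 3 ≤ κ * (z ^ (1 / 3 : ℝ)) ^ 3 := by gcongr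
        _ = r := by rw [h3, hz]; field_simp
    · have h4 : (z ^ (1 / 3 : ℝ)) ^ (-(p / 2)) = z ^ (-p / 6) := by
        rw [← Real.rpow_mul hz0.le]; congr 1; ring
      rw [← h4]
      have h5 : (2 * (s : ℝ)) ^ (-(p / 2)) ≤ (z ^ (1 / 3 : ℝ)) ^ (-(p / 2)) :=
        Real.rpow_le_rpow_of_nonpos (by positivity) hzs (by linarith)
      calc (s : ℝ) ^ (-(p / 2)) = 2 ^ (p / 2) * (2 * (s : ℝ)) ^ (-(p / 2)) := by
            rw [Real.mul_rpow (by norm_num) (by positivity), ← mul_assoc,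
              ← Real.rpow_add two_pos, add_neg_cancel, Real.rpow_zero, one_mul]
        _ ≤ _ := by gcongr

theorem exists_ballistic {d : ℕ} (ν : Measure (ProbVec d)) [IsProbabilityMeasure ν] (u : Site d)
    {p : ℝ} (hp : 0 < p)
    (hmom : ∫⁻ X, ((regenTime u X : ℕ∞) : ℝ≥0∞) ^ p ∂(avg ν 0) < ⊤)
    (hsteps : ∃ M : ℝ, 0 < M ∧ ∀ z : Site d, M < eucNorm z →
      ∀ᵐ ω ∂(envLaw ν), (ω 0).1 z = 0) : ∃ R, Ballistic ν u R := by
  obtain ⟨R, hR⟩ := exists_stepBound ν u hsteps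
  refine ⟨R, inferInstance, hR, ?_⟩
  have hlim := ENNReal.Tendsto.const_mul (tendsto_natCast_rpow_neg hp) (Or.inr hmom.ne)
  rw [mul_zero] at hlim
  refine tendsto_of_tendsto_of_tendsto_of_le_of_le' tendsto_const_nhds hlim
    (Filter.Eventually.of_forall fun _ => zero_le) ?_
  filter_upwards [Filter.eventually_ge_atTop 1] with s hs
  exact avg_lateRegen_le ν u hp.le hs

/-- Both difference laws are probability measures, and they are close to each other for distant
starting points. -/
theorem Ballistic.exists_diffLaw_bound {d : ℕ} {ν : Measure (ProbVec d)} {u : Site d} {R : ℕ}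
    (hB : Ballistic ν u R) {p : ℝ} (hp : 4 ≤ p)
    (hmom : ∫⁻ X, ((regenTime u X : ℕ∞) : ℝ≥0∞) ^ p ∂(avg ν 0) < ⊤) :
    (∀ x : Hyper u, IsProbabilityMeasure (diffLaw (levelGcd ν u) u (avgPair ν 0 x)) ∧
      IsProbabilityMeasure (diffLaw (levelGcd ν u) u ((avg ν 0).prod (avg ν x)))) ∧
    ∃ (A : ℕ) (C : ℝ≥0∞), C ≠ ⊤ ∧ ∀ (s : ℕ) (x : Hyper u) (j : Fin d), 1 ≤ s →
      (2 * (R * (A * s ^ 3 : ℕ)) : ℤ) < |x.1 j| → ∀ S,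
        diffLaw (levelGcd ν u) u (avgPair ν 0 x) S
          ≤ diffLaw (levelGcd ν u) u ((avg ν 0).prod (avg ν x)) S
            + C * (s : ℝ≥0∞) ^ (-(p / 2)) := by
  have := hB.prob
  have hh := hB.levelGcd_pos
  set h := levelGcd ν u with hh'
  have hhZ : (1 : ℤ) ≤ h := by exact_mod_cast hh
  have hlev : level u (0 : Site d) = 0 := by simp [level]
  obtain ⟨ρ₁, hρ₁, h₁⟩ := hB.exists_le_avgPair_noBacktrack
  set ρ₂ := avg ν 0 (neverBelow u) ^ 2 with hρ₂def
  have hρ₂ : 0 < ρ₂ := ENNReal.pow_pos hB.avg_neverBelow_pos 2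
  have h₂ : ∀ x y : Site d, ρ₂ ≤ ((avg ν x).prod (avg ν y)) (noBacktrack u) := fun x y =>
    (prod_noBacktrack ν u x y).ge
  obtain ⟨Q₁, c₁, hc₁, -, hQ₁⟩ := hB.hitsTogether_avgPair
  obtain ⟨Q₂, c₂, hc₂, -, hQ₂⟩ := hB.hitsTogether_prod
  obtain ⟨A₁, C₁, hC₁, t₁⟩ := (freshLaw_avgPair ν u).exists_jointRegenBy_tail hB.bound hc₁ hQ₁ hρ₁
    h₁ hh hp hmom
  obtain ⟨A₂, C₂, hC₂, t₂⟩ := (freshLaw_prod ν u).exists_jointRegenBy_tail hB.bound hc₂ hQ₂ hρ₂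
    (fun x y _ => h₂ x y) hh hp hmom
  have hp2 : 0 < p / 2 := by linarith
  refine ⟨fun x => ⟨?_, ?_⟩, ?_⟩
  · exact isProbabilityMeasure_diffLaw hhZ (hρ₁.trans_le (h₁ 0 x (hlev.trans x.2.symm))).ne' hC₁ hp2
      fun s hs => t₁ A₁ le_rfl s hs 0 x hlev x.2
  · exact isProbabilityMeasure_diffLaw hhZ (hρ₂.trans_le (h₂ 0 x)).ne' hC₂ hp2
      fun s hs => t₂ A₂ le_rfl s hs 0 x hlev x.2
  set m := ∫⁻ X, ((regenTime u X : ℕ∞) : ℝ≥0∞) ^ p ∂(avg ν 0) with hm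
  -- The constants are made common to both laws. The tail bounds hold for every larger multiple of
  -- `s ^ 3`, so one horizon serves both, and the `+ 1` in `A` ensures `s ≤ A * s ^ 3`.
  set ρ := min ρ₁ ρ₂ with hρdef
  have hρ : 0 < ρ := lt_min hρ₁ hρ₂
  set C := C₁ + C₂ + 2 * m with hC
  have hCtop : C ≠ ⊤ := ENNReal.add_ne_top.2 ⟨ENNReal.add_ne_top.2 ⟨hC₁, hC₂⟩,
    ENNReal.mul_ne_top ENNReal.ofNat_ne_top hmom.ne⟩
  set A := A₁ + A₂ + 1 with hA
  refine ⟨A, 4 * (ρ⁻¹ * C), ENNReal.mul_ne_top ENNReal.ofNat_ne_top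
    (ENNReal.mul_ne_top (ENNReal.inv_ne_top.2 hρ.ne') hCtop), fun s x j hs hfar S => ?_⟩
  have hback : 2 * avg ν 0 (lateRegen u (A * s ^ 3)) ≤ C * (s : ℝ≥0∞) ^ (-(p / 2)) := by
    have hsN : s ≤ A * s ^ 3 := (Nat.le_self_pow three_ne_zero s).trans
      (Nat.le_mul_of_pos_left _ (by omega))
    calc 2 * avg ν 0 (lateRegen u (A * s ^ 3)) ≤ 2 * avg ν 0 (lateRegen u s) := by
          gcongr
          intro z hz
          exact lt_of_le_of_lt (by exact_mod_cast hsN) (show _ < regenTime u z from hz)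
      _ ≤ 2 * (m * (s : ℝ≥0∞) ^ (-p)) := by
          gcongr
          exact avg_lateRegen_le ν u (by linarith) hs
      _ = (2 * m) * (s : ℝ≥0∞) ^ (-p) := by ring
      _ ≤ C * (s : ℝ≥0∞) ^ (-(p / 2)) := by
          gcongr
          · exact le_add_self
          · exact_mod_cast hs
          · linarith
  have hCle₁ : C₁ * (s : ℝ≥0∞) ^ (-(p / 2)) ≤ C * (s : ℝ≥0∞) ^ (-(p / 2)) := by
    gcongr
    rw [hC, add_assoc]
    exact le_self_add
  have hCle₂ : C₂ * (s : ℝ≥0∞) ^ (-(p / 2)) ≤ C * (s : ℝ≥0∞) ^ (-(p / 2)) := by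
    gcongr
    rw [hC, add_comm C₁, add_assoc]
    exact le_self_add
  have := diffLaw_le hhZ (u := u) (N := A * s ^ 3) (P := avgPair ν 0 x)
    (P' := (avg ν 0).prod (avg ν x)) (t := C * (s : ℝ≥0∞) ^ (-(p / 2))) (ρ := ρ)
    (fun B hBdet => avgPair_eq_prod_of_far hB.bound (j := j) (by simpa using hfar) hBdet)
    ((t₁ A (by omega) s hs 0 x hlev x.2).trans hCle₁)
    ((t₂ A (by omega) s hs 0 x hlev x.2).trans hCle₂)
    (((freshLaw_avgPair ν u).late_backtrack_le 0 x _).trans hback)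
    (((freshLaw_prod ν u).late_backtrack_le 0 x _).trans hback) hρ
    ((min_le_left _ _).trans (h₁ 0 x (hlev.trans x.2.symm))) ((min_le_right _ _).trans (h₂ 0 x)) S
  calc _ ≤ _ := this
    _ = _ := by ring

end RWRE

theorem proposition7p6 (d : ℕ) (hd : 2 ≤ d)
    (ν : Measure (RWRE.ProbVec d)) [IsProbabilityMeasure ν] (u : RWRE.Site d)
    -- transience in direction `u`
    (htrans : ∀ᵐ X ∂(RWRE.avg ν 0),
      Filter.Tendsto (fun n => RWRE.level u (X n)) Filter.atTop Filter.atTop)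
    -- moment bound on the first regeneration time
    (p₀ : ℝ) (hp₀ : 176 * (d : ℝ) < p₀)
    (hmoment : ∫⁻ X, ((RWRE.regenTime u X : ℕ∞) : ℝ≥0∞) ^ p₀ ∂(RWRE.avg ν 0) < ⊤)
    -- bounded steps
    (hsteps : ∃ M : ℝ, 0 < M ∧ ∀ z : RWRE.Site d, M < RWRE.eucNorm z →
      ∀ᵐ ω ∂(RWRE.envLaw ν), (ω 0).1 z = 0) :
    ∃ C : ℝ, 0 < C ∧
      ∃ κ : Kernel (RWRE.Hyper u × RWRE.Hyper u) (RWRE.Hyper u × RWRE.Hyper u),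
        IsMarkovKernel κ ∧
        (∀ x x' y : RWRE.Hyper u, κ (x, x') {w | w.1 = y} = RWRE.q ν u x y) ∧
        (∀ x x' y : RWRE.Hyper u, κ (x, x') {w | w.2 = y} = RWRE.qbar ν u x' y) ∧
        ∀ x : RWRE.Hyper u, (x : RWRE.Site d) ≠ 0 →
          κ (x, x) {w | w.1 ≠ w.2} ≤
            ENNReal.ofReal (C * RWRE.eucNorm (x : RWRE.Site d) ^ (-p₀ / 6)) := by
  open RWRE in
  have hd' : (2 : ℝ) ≤ d := by exact_mod_cast hd
  have hp : 4 ≤ p₀ := by linarith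
  obtain ⟨R, hB⟩ := exists_ballistic ν u (by linarith) hmoment hsteps
  have hh : (1 : ℤ) ≤ levelGcd ν u := by exact_mod_cast hB.levelGcd_pos
  obtain ⟨hprob, A, C, hC, hclose⟩ := hB.exists_diffLaw_bound hp hmoment
  have hprob₁ := fun x => (hprob x).1
  have hprob₂ := fun x => (hprob x).2
  -- The coupling is chosen independently for every pair of states; measurability in the state is
  -- automatic because the state space is countable.
  choose π hπ₁ hπ₂ hπ using fun z : Hyper u × Hyper u =>
    exists_maximal_coupling (diffLaw (levelGcd ν u) u (avgPair ν 0 z.1))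
      (diffLaw (levelGcd ν u) u ((avg ν 0).prod (avg ν z.2)))
  have hπprob : ∀ z, IsProbabilityMeasure (π z) := fun z => by
    constructor
    have h1 : (π z).map Prod.fst Set.univ = 1 := by rw [hπ₁]; exact measure_univ
    rwa [Measure.map_apply measurable_fst MeasurableSet.univ, Set.preimage_univ] at h1
  -- With this constant `κ₀ * s ^ 3 ≤ |x|` forces some coordinate of `x` to exceed `2 * R * (A * s ^
  -- 3)`. The `+ 1` makes the inequality strict and `κ₀` positive.
  set κ₀ : ℝ := d * (2 * R * A + 1) with hκ₀
  have hκ₀pos : 0 < κ₀ := by positivity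
  obtain ⟨C', hC', hscale⟩ := exists_scale hκ₀pos (show 0 ≤ p₀ by linarith)
  refine ⟨(C.toReal + 1) * C', by positivity, Kernel.ofFunOfCountable π, ⟨hπprob⟩,
    fun x x' y => ?_, fun x x' y => ?_, fun x hx => ?_⟩
  · have h1 := diffLaw_singleton hh u (avgPair ν 0 x) y
    rw [← hπ₁ (x, x'), Measure.map_apply measurable_fst (MeasurableSet.singleton y)] at h1
    exact h1
  · have h1 := diffLaw_singleton hh u ((avg ν 0).prod (avg ν x')) y
    rw [← hπ₂ (x, x'), Measure.map_apply measurable_snd (MeasurableSet.singleton y)] at h1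
    exact h1
  · have hr := eucNorm_pos hx
    change π (x, x) {w | w.1 ≠ w.2} ≤ _
    -- For small `|x|` the right-hand side is at least one and the bound is trivial; the `+ 1` in
    -- the constant covers this case.
    rcases hscale _ hr with h1 | ⟨s, hs, hs3, hsp⟩
    · refine (prob_le_one).trans ?_
      rw [← ENNReal.ofReal_one]
      refine ENNReal.ofReal_le_ofReal ?_
      have : 0 ≤ C.toReal := ENNReal.toReal_nonneg
      rw [mul_assoc]
      nlinarith
    · obtain ⟨j, hj⟩ := exists_eucNorm_le _ hx
      have hd0 : (0 : ℝ) < d := by linarith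
      have hs1 : (1 : ℝ) ≤ (s : ℝ) ^ 3 := one_le_pow₀ (by exact_mod_cast hs)
      have hfar : 2 * (R * (A * (s : ℝ) ^ 3)) < |(x.1 j : ℝ)| := by
        have h2 : (d : ℝ) * ((2 * R * A + 1) * (s : ℝ) ^ 3) ≤ d * |(x.1 j : ℝ)| := by
          rw [← mul_assoc]
          exact hs3.trans hj
        have h3 := le_of_mul_le_mul_left h2 hd0
        linarith
      have h4 := hπ (x, x) _ fun S => hclose s x j hs (by exact_mod_cast hfar) S
      refine h4.trans ?_
      have hs0 : (0 : ℝ) < s := by exact_mod_cast hs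
      rw [← ENNReal.ofReal_natCast s, ENNReal.ofReal_rpow_of_pos hs0, ← ENNReal.ofReal_toReal hC,
        ← ENNReal.ofReal_mul ENNReal.toReal_nonneg]
      refine ENNReal.ofReal_le_ofReal ?_
      rw [mul_assoc, ENNReal.toReal_ofReal ENNReal.toReal_nonneg]
      have h5 : 0 ≤ C.toReal := ENNReal.toReal_nonneg
      have h6 : 0 ≤ (s : ℝ) ^ (-(p₀ / 2)) := by positivity
      nlinarith
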